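/- **Setting.** A projective variety is a Zariski closed subset of a complex projective space; singular homology $H_k(\cdot,\mathbb Z)$, the fundamental group $\pi_1$ and the Betti numbers $\beta_k=\operatorname{rank}H_k(\cdot,\mathbb Z)$ are taken with respect to the classical (analytic) topology. A $\mathbb C^*$-action is an algebraic (in particular holomorphic) one, i.e. the action map $\mathbb C^*\times X\to X$ is a morphism of varieties. It has isolated fixed points if every fixed point is isolated in the fixed point set. **Theorem.** 1. Let $C\subset\mathbb P^2$ be an irreducible cubic plane curve over $\mathbb C$ with a node (ordinary double point) $p$. Then $C$ is an irreducible projective variety of dimension $1$, and: (a) there are a normalization (finite birational morphism onto $C$) $\sigma:\mathbb P^1\to C$ with $\sigma^{-1}(p)=\{[1:0],[0:1]\}$, and a $\mathbb C^*$-action on $C$ with $t\cdot\sigma(x)=\sigma(t\cdot x)$ for all $t\in\mathbb C^*$, $x\in\mathbb P^1$, where $\mathbb C^*$ acts on $\mathbb P^1$ by $t\cdot[x:y]=[tx:y]$; the only fixed point of the action on $C$ is $p$; (b) $\pi_1(C,p)\cong\mathbb Z$ and $H_1(C,\mathbb Z)\cong\mathbb Z$, so $\beta_1(C)=1\ne 0$;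 (c) for every $n\ge 1$, the product $X=C\times\mathbb P^{n-1}$ (embedded by the Segre embedding) is an irreducible projective variety of dimension $n$ with $\beta_1(X)=\beta_1(C)$; moreover $\mathbb P^{n-1}$ has a $\mathbb C^*$-action with isolated fixed points such that the product of it with the action of (a) is a $\mathbb C^*$-action on $X$ with isolated fixed points. 2. The action $t\cdot[x:y]=[tx:y]$ on $\mathbb P^1$ has exactly the two fixed points $[1:0]$ and $[0:1]$. 3. The cubic $C_0=(zy^2=x^3+x^2z)\subset\mathbb P^2$ is irreducible with a node at $p_0=[0:0:1]$, and for $C=C_0$, $p=p_0$, a map $\sigma$ for which (a) holds is $$\sigma:\mathbb P^1\to C_0,\qquad [s:t]\mapsto[-4st(s+t):-4st(s-t):(s+t)^3].$$ 4. Consequently the answer to Carrell's question is negative in every dimension: for no $n\ge1$ is it true that $H_k(X,\mathbb Z)=0$ for all odd $k$ and all irreducible complex projective varieties $X$ of dimension $n$ that admit a $\mathbb C^*$-action with isolated fixed points. -/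

import Mathlib

open scoped LinearAlgebra.Projectivization Topology

namespace ProjVar

noncomputable section

open CategoryTheory MvPolynomial

/-- Complex projective space with homogeneous coordinates indexed by `ι`;
`PSpace (Fin (m + 1))` is `P^m`. -/
abbrev PSpace (ι : Type) : Type := ℙ ℂ (ι → ℂ)

/-- The classical (analytic) topology: the quotient topology of `ℂ^ι ∖ {0}`. This is the topology
used on projective space and, as subspace topology, on its subsets, unless said otherwise. -/
instance analyticTopology (ι : Type) : TopologicalSpace (PSpace ι) :=
  TopologicalSpace.coinduced (Projectivization.mk' ℂ : {v : ι → ℂ // v ≠ 0} → PSpace ι)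
    inferInstance

/-- The zero locus in projective space of a polynomial (meaningful for homogeneous ones). -/
def zeroLocus {ι : Type} (F : MvPolynomial ι ℂ) : Set (PSpace ι) :=
  {x | eval x.rep F = 0}

/-- The Zariski topology: the complements of the zero loci of homogeneous polynomials form a
basis. -/
abbrev zariski (ι : Type) : TopologicalSpace (PSpace ι) :=
  TopologicalSpace.generateFrom
    {U | ∃ (F : MvPolynomial ι ℂ) (d : ℕ), F.IsHomogeneous d ∧ U = (zeroLocus F)ᶜ}

/-- An irreducible (embedded) complex projective variety: a Zariski closed subset of projective
space, irreducible (in particular non-empty) in the Zariski topology. -/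
structure IsProjectiveVariety {ι : Type} (X : Set (PSpace ι)) : Prop where
  isClosed : IsClosed[zariski ι] X
  irreducible : @IsIrreducible (PSpace ι) (zariski ι) X

/-- The affine cone over `X`. -/
def affineCone {ι : Type} (X : Set (PSpace ι)) : Set (ι → ℂ) :=
  {v | ∀ h : v ≠ 0, Projectivization.mk ℂ v h ∈ X}

/-- The homogeneous coordinate ring of `X`. -/
abbrev HomogeneousCoordinateRing {ι : Type} (X : Set (PSpace ι)) : Type :=
  MvPolynomial ι ℂ ⧸ vanishingIdeal ℂ (affineCone X)

/-- The irreducible projective variety `X` has dimension `n`: its function field has transcendence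
degree `n` over `ℂ`, i.e. its homogeneous coordinate ring (the coordinate ring of the affine cone)
has transcendence degree `n + 1`. -/
def HasDimension {ι : Type} (X : Set (PSpace ι)) (n : ℕ) : Prop :=
  Algebra.trdeg ℂ (HomogeneousCoordinateRing X) = ((n + 1 : ℕ) : Cardinal)

/-- `f` is a regular map (morphism of varieties) on the set `V`: around every point of `V` it is
given by homogeneous polynomials of one degree. Only the values of `f` on `V` matter. -/
def IsRegularOn {ι κ : Type} (f : PSpace ι → PSpace κ) (V : Set (PSpace ι)) : Prop :=
  ∀ x ∈ V, ∃ (d : ℕ) (P : κ → MvPolynomial ι ℂ), (∀ k, (P k).IsHomogeneous d) ∧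
    (fun k => eval x.rep (P k)) ≠ 0 ∧
    ∀ y ∈ V, ∀ h : (fun k => eval y.rep (P k)) ≠ 0,
      f y = Projectivization.mk ℂ (fun k => eval y.rep (P k)) h

/-- The value at `(t, v)` of a polynomial in the coordinates whose coefficients are polynomials
in a parameter. -/
def evalAt {ι : Type} (t : ℂ) (v : ι → ℂ) (P : MvPolynomial ι (Polynomial ℂ)) : ℂ :=
  eval₂ (Polynomial.evalRingHom t) v P

/-- An algebraic `ℂ^*`-action on `X`: a group action whose action map `ℂ^* × X → X` is a morphism
of varieties, i.e. is locally given by polynomials in `(t, x)`, homogeneous of one degree in `x`.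
(Negative powers of `t` may be cleared, since homogeneous coordinates are only defined up to a
common factor.) -/
structure CStarAction {ι : Type} (X : Set (PSpace ι)) where
  act : ℂˣ → X → X
  one_act : ∀ x, act 1 x = x
  mul_act : ∀ s t x, act (s * t) x = act s (act t x)
  regular : ∀ (t₀ : ℂˣ) (x₀ : X), ∃ (d : ℕ) (P : ι → MvPolynomial ι (Polynomial ℂ)),
    (∀ i, (P i).IsHomogeneous d) ∧
    (fun i => evalAt (t₀ : ℂ) x₀.1.rep (P i)) ≠ 0 ∧
    ∀ (t : ℂˣ) (x : X), ∀ h : (fun i => evalAt (t : ℂ) x.1.rep (P i)) ≠ 0,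
      (act t x : PSpace ι) = Projectivization.mk ℂ (fun i => evalAt (t : ℂ) x.1.rep (P i)) h

/-- The fixed point set `X^{ℂ^*}`. -/
def CStarAction.fixedPoints {ι : Type} {X : Set (PSpace ι)} (a : CStarAction X) : Set X :=
  {x | ∀ t, a.act t x = x}

/-- Every fixed point is isolated in the fixed point set. -/
def CStarAction.HasIsolatedFixedPoints {ι : Type} {X : Set (PSpace ι)} (a : CStarAction X) :
    Prop :=
  ∀ x ∈ a.fixedPoints, ∃ U : Set X, IsOpen U ∧ x ∈ U ∧ ∀ y ∈ U, y ∈ a.fixedPoints → y = x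

/-- `σ : P^1 → X` is a normalization of `X`: a finite birational morphism from `P^1` onto `X`
(`P^1` is smooth, hence normal; a morphism from a projective variety is finite as soon as its
fibres are finite). -/
structure IsNormalization (X : Set (PSpace (Fin 3)))
    (σ : PSpace (Fin 2) → PSpace (Fin 3)) : Prop where
  regular : IsRegularOn σ Set.univ
  range_eq : Set.range σ = X
  finite_fibers : ∀ y, (σ ⁻¹' {y}).Finite
  birational : ∃ (U : Set (PSpace (Fin 3))) (g : PSpace (Fin 3) → PSpace (Fin 2)),
    IsOpen[zariski (Fin 3)] U ∧ (X ∩ U).Nonempty ∧ IsRegularOn g (X ∩ U) ∧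
    (∀ y ∈ X ∩ U, σ (g y) = y) ∧ ∀ x, σ x ∈ U → g (σ x) = x

/-- The point `[1 : 0]` of `P^1`. -/
def pointOneZero : PSpace (Fin 2) := Projectivization.mk ℂ ![1, 0] (by simp)

/-- The point `[0 : 1]` of `P^1`. -/
def pointZeroOne : PSpace (Fin 2) := Projectivization.mk ℂ ![0, 1] (by simp)

lemma diagonal_injective (t : ℂˣ) :
    Function.Injective (Matrix.toLin' (Matrix.diagonal ![(t : ℂ), 1])) := by
  intro v w h
  ext i
  have := congrFun h i
  fin_cases i <;> simpa [Matrix.mulVec_diagonal] using this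

/-- The standard action of `t ∈ ℂ^*` on `P^1`, `[x : y] ↦ [t x : y]`. -/
def scale (t : ℂˣ) : PSpace (Fin 2) → PSpace (Fin 2) :=
  Projectivization.map (Matrix.toLin' (Matrix.diagonal ![(t : ℂ), 1])) (diagonal_injective t)

/-- The plane curve `F = 0` has a node (ordinary double point) at `p`: `F` and its first partial
derivatives vanish at `p`, and the Hessian matrix of `F` at `p` has rank `2`, i.e. the tangent cone
at `p` consists of two distinct lines. -/
def IsNode (F : MvPolynomial (Fin 3) ℂ) (p : PSpace (Fin 3)) : Prop :=
  p ∈ zeroLocus F ∧ (∀ i, eval p.rep (pderiv i F) = 0) ∧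
    (Matrix.of fun i j => eval p.rep (pderiv i (pderiv j F))).rank = 2

/-- The cubic form `z y^2 - x^3 - x^2 z`, where `x, y, z` are the coordinates `0, 1, 2`. -/
def standardCubic : MvPolynomial (Fin 3) ℂ :=
  X 2 * X 1 ^ 2 - X 0 ^ 3 - X 0 ^ 2 * X 2

/-- The point `[0 : 0 : 1]` of `P^2`. -/
def standardNode : PSpace (Fin 3) := Projectivization.mk ℂ ![0, 0, 1] (by simp)

/-- The Segre embedding `([x], [y]) ↦ [x_i y_j]`. -/
def segre {ι κ : Type} (x : PSpace ι) (y : PSpace κ) : PSpace (ι × κ) :=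
  Projectivization.mk ℂ (fun ij => x.rep ij.1 * y.rep ij.2) (by
    obtain ⟨i, hi⟩ := Function.ne_iff.mp x.rep_nonzero
    obtain ⟨j, hj⟩ := Function.ne_iff.mp y.rep_nonzero
    exact Function.ne_iff.mpr ⟨(i, j), mul_ne_zero hi hj⟩)

/-- The product of two subsets of projective spaces, realized in projective space by the Segre
embedding. -/
def segreProduct {ι κ : Type} (X : Set (PSpace ι)) (Y : Set (PSpace κ)) : Set (PSpace (ι × κ)) :=
  Set.image2 segre X Y

/-- A `ℂ^*`-action on the Segre product is the one induced by actions on the two factors. -/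
def CStarAction.IsProductOf {ι κ : Type} {X : Set (PSpace ι)} {Y : Set (PSpace κ)}
    (c : CStarAction (segreProduct X Y)) (a : CStarAction X) (b : CStarAction Y) : Prop :=
  ∀ (t : ℂˣ) (x : X) (y : Y),
    (c.act t ⟨segre x.1 y.1, Set.mem_image2_of_mem x.2 y.2⟩ : PSpace (ι × κ)) =
      segre (a.act t x).1 (b.act t y).1

/-- Singular homology `H_k(X, ℤ)` of a topological space. -/
abbrev H (k : ℕ) (X : Type) [TopologicalSpace X] : ModuleCat.{0} ℤ :=
  ((AlgebraicTopology.singularHomologyFunctor (ModuleCat.{0} ℤ) k).obj (ModuleCat.of ℤ ℤ)).obj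
    (TopCat.of X)

/-- The Betti number `β_k(X)`, the rank of `H_k(X, ℤ)`. -/
def betti (k : ℕ) (X : Type) [TopologicalSpace X] : Cardinal :=
  Module.rank ℤ (H k X)

end

end ProjVar

open ProjVar

/-! A cubic with a node `p` has equation `z q(x, y) + g(x, y) = 0` in coordinates with `p =
[0:0:1]`, where `q` is a nondegenerate quadratic form. Taking the two tangent lines as axes and
absorbing the terms `x²y`, `xy²` into `z` leaves `xyz + αx³ + δy³`. Irreducibility gives `α, δ ≠ 0`,
and rescaling gives `xyz = x³ + y³` (`exists_isNodalForm`). This model is parametrized by `[x:y] ↦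
[x²y : xy² : x³+y³]`, which identifies `[1:0]` with `[0:1]` and nothing else (`nodalMap_eq_iff`).
Both points are fixed by `[x:y] ↦ [tx:y]`, so the action descends to the curve with the node as only
fixed point. That it is algebraic at the node needs its own formulas (`evalAt_actFormulaNode`).

Topologically the curve is a sphere with two points identified (`IsPinching`). Its fundamental group
is generated by the image of a path joining the two points: near the node paths can be pushed
through it, and away from it they lift to `P^1`, which is simply connected
(`IsPinching.exists_trans_eq`). The generator has infinite order since the height function on the
sphere, taken modulo 1, descends to a map to the circle of degree `-1` on it
(`IsPinching.nodeLoop_zpow_eq_one`). A path connected space with infinite cyclic fundamental group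
has `H_1 ≅ ℤ` (`nonempty_H_one_iso`, the Hurewicz argument in this case).

A simply connected factor `P^{n-1}` does not change the fundamental group, so `H_1` of the product
is again `ℤ`. The action with weights `0, 1, 2, …` has finitely many fixed points on `P^{n-1}`,
hence so has the product action. Irreducibility and dimension come from a polynomial parametrization
of the affine cone (`IsConeParam`): the coordinate ring is a subalgebra of a polynomial ring over
which the variables are algebraic. Since `H_1 ≠ 0`, the products answer Carrell's question
negatively. -/

namespace ProjVar
noncomputable section

open CategoryTheory Simplicial Limits

/-! ### Singular edges and triangles, and 1-chains modulo boundaries. -/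

variable {X : Type} [TopologicalSpace X]

/-- The singular simplex given by a continuous map. -/
def singularSimplex {n : ℕ} (f : C(stdSimplex ℝ (Fin (n + 1)), X)) :
    (TopCat.toSSet.obj (TopCat.of X)) _⦋n⦌ :=
  (TopCat.toSSetObjEquiv (TopCat.of X) (.op ⦋n⦌)).symm f

lemma singularSimplex_surjective {n : ℕ} (s : (TopCat.toSSet.obj (TopCat.of X)) _⦋n⦌) :
    ∃ f : C(stdSimplex ℝ (Fin (n + 1)), X), singularSimplex f = s :=
  (TopCat.toSSetObjEquiv (TopCat.of X) (.op ⦋n⦌)).symm.surjective s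

/-- The inclusion of the `i`-th face of the standard simplex. -/
def faceMap {n : ℕ} (i : Fin (n + 2)) :
    C(stdSimplex ℝ (Fin (n + 1)), stdSimplex ℝ (Fin (n + 2))) :=
  ⟨stdSimplex.map i.succAbove, stdSimplex.continuous_map _⟩

lemma δ_singularSimplex {n : ℕ} (i : Fin (n + 2)) (f : C(stdSimplex ℝ (Fin (n + 2)), X)) :
    (TopCat.toSSet.obj (TopCat.of X)).δ i (singularSimplex f) =
      singularSimplex (f.comp (faceMap i)) :=
  TopCat.toSSetObjEquiv_symm_naturality (X := TopCat.of X) (SimplexCategory.δ i) f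

/-- The singular vertex given by a point. -/
def singularVertex (x : X) : (TopCat.toSSet.obj (TopCat.of X)) _⦋0⦌ :=
  singularSimplex (.const _ x)

/-- The singular edge given by a path. -/
def singularEdge {x y : X} (γ : Path x y) : (TopCat.toSSet.obj (TopCat.of X)) _⦋1⦌ :=
  singularSimplex ⟨fun s => γ (stdSimplexHomeomorphUnitInterval s), by fun_prop⟩

/-- The path traced by a singular edge. -/
def edgePath (f : C(stdSimplex ℝ (Fin 2), X)) :
    Path (f (stdSimplexHomeomorphUnitInterval.symm 0))
      (f (stdSimplexHomeomorphUnitInterval.symm 1)) where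
  toFun t := f (stdSimplexHomeomorphUnitInterval.symm t)
  source' := rfl
  target' := rfl

lemma singularEdge_edgePath (f : C(stdSimplex ℝ (Fin 2), X)) :
    singularEdge (edgePath f) = singularSimplex f := by
  unfold singularEdge
  congr 1
  ext s
  simp [edgePath]

lemma singularEdge_surjective (s : (TopCat.toSSet.obj (TopCat.of X)) _⦋1⦌) :
    ∃ (x y : X) (γ : Path x y), singularEdge γ = s := by
  obtain ⟨f, rfl⟩ := singularSimplex_surjective s
  exact ⟨_, _, _, singularEdge_edgePath f⟩

lemma stdSimplex_one_apply (s : stdSimplex ℝ (Fin 1)) : s.1 0 = 1 := by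
  have := s.2.2
  simpa using this

lemma faceMap_coe {n : ℕ} (i : Fin (n + 2)) (s : stdSimplex ℝ (Fin (n + 1))) (k : Fin (n + 2)) :
    (faceMap i s).1 k = ∑ j with i.succAbove j = k, s.1 j :=
  FunOnFinite.linearMap_apply_apply ℝ ℝ _ _ _

lemma unitInterval_faceMap_zero (s : stdSimplex ℝ (Fin 1)) :
    stdSimplexHomeomorphUnitInterval (faceMap 0 s) = 1 := by
  ext
  change (faceMap 0 s).1 1 = 1
  rw [faceMap_coe]
  simp [Finset.sum_filter, stdSimplex_one_apply]

lemma unitInterval_faceMap_one (s : stdSimplex ℝ (Fin 1)) :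
    stdSimplexHomeomorphUnitInterval (faceMap 1 s) = 0 := by
  ext
  change (faceMap 1 s).1 1 = 0
  rw [faceMap_coe]
  simp

@[simp]
lemma δ_zero_singularEdge {x y : X} (γ : Path x y) :
    (TopCat.toSSet.obj (TopCat.of X)).δ 0 (singularEdge γ) = singularVertex y := by
  unfold singularEdge singularVertex
  rw [δ_singularSimplex]
  congr 1
  ext s
  simp [unitInterval_faceMap_zero]

@[simp]
lemma δ_one_singularEdge {x y : X} (γ : Path x y) :
    (TopCat.toSSet.obj (TopCat.of X)).δ 1 (singularEdge γ) = singularVertex x := by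
  unfold singularEdge singularVertex
  rw [δ_singularSimplex]
  congr 1
  ext s
  simp [unitInterval_faceMap_one]

lemma faceMap_zero_coe (s : stdSimplex ℝ (Fin 2)) : (faceMap 0 s).1 = ![0, s.1 0, s.1 1] := by
  ext k
  rw [faceMap_coe, Finset.sum_filter, Fin.sum_univ_two]
  fin_cases k <;> simp

lemma faceMap_one_coe (s : stdSimplex ℝ (Fin 2)) : (faceMap 1 s).1 = ![s.1 0, 0, s.1 1] := by
  ext k
  rw [faceMap_coe, Finset.sum_filter, Fin.sum_univ_two]
  fin_cases k <;> simp [Fin.succAbove]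

lemma faceMap_two_coe (s : stdSimplex ℝ (Fin 2)) : (faceMap 2 s).1 = ![s.1 0, s.1 1, 0] := by
  ext k
  rw [faceMap_coe, Finset.sum_filter, Fin.sum_univ_two]
  fin_cases k <;> simp [Fin.succAbove]

instance (n : ℕ) : ContractibleSpace (stdSimplex ℝ (Fin (n + 1))) :=
  (convex_stdSimplex ℝ (Fin (n + 1))).contractibleSpace ⟨_, single_mem_stdSimplex ℝ 0⟩

/-- The boundary of a singular triangle, as paths with a homotopy. -/
lemma exists_paths_of_triangle (f : C(stdSimplex ℝ (Fin 3), X)) :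
    ∃ (x y z : X) (a : Path x y) (b : Path y z) (c : Path x z),
      singularSimplex (f.comp (faceMap 0)) = singularEdge b ∧
      singularSimplex (f.comp (faceMap 1)) = singularEdge c ∧
      singularSimplex (f.comp (faceMap 2)) = singularEdge a ∧
      (a.trans b).Homotopic c := by
  have key : ∀ i : Fin 3, singularSimplex (f.comp (faceMap i)) =
      singularEdge ((edgePath (faceMap i)).map f.continuous) := by
    intro i
    rw [← singularEdge_edgePath]
    rfl
  let e := stdSimplexHomeomorphUnitInterval
  have h01 : faceMap 1 (e.symm 0) = faceMap (2 : Fin 3) (e.symm 0) := by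
    apply Subtype.ext; rw [faceMap_one_coe, faceMap_two_coe]; simp [e]
  have h12 : faceMap 0 (e.symm 0) = faceMap (2 : Fin 3) (e.symm 1) := by
    apply Subtype.ext; rw [faceMap_zero_coe, faceMap_two_coe]; simp [e]
  have h02 : faceMap 0 (e.symm 1) = faceMap (1 : Fin 3) (e.symm 1) := by
    apply Subtype.ext; rw [faceMap_zero_coe, faceMap_one_coe]; simp [e]
  let a := edgePath (faceMap (2 : Fin 3))
  let b := (edgePath (faceMap (0 : Fin 3))).cast h12.symm rfl
  let c := (edgePath (faceMap (1 : Fin 3))).cast h01.symm h02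
  refine ⟨_, _, _, a.map f.continuous, b.map f.continuous, c.map f.continuous,
    key 0, key 1, key 2, ?_⟩
  -- The edges already satisfy the relation inside the contractible standard triangle; `f` pushes
  -- the homotopy forward.
  rw [← Path.map_trans]
  exact (SimplyConnectedSpace.paths_homotopic (a.trans b) c).map f

variable (X) in
/-- The singular chain complex with integral coefficients. -/
abbrev singularChains : ChainComplex (ModuleCat.{0} ℤ) ℕ :=
  (TopCat.toSSet.obj (TopCat.of X)).chainComplex (ModuleCat.of ℤ ℤ)

/-- The class of a singular edge in the group of `1`-chains modulo boundaries. -/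
def edgeClass (s : (TopCat.toSSet.obj (TopCat.of X)) _⦋1⦌) : (singularChains X).opcycles 1 :=
  (((TopCat.toSSet.obj (TopCat.of X)).ιChainComplex (R := ModuleCat.of ℤ ℤ) s ≫ (singularChains X).pOpcycles 1).hom
    (1 : ℤ))

/-- The `0`-chain of a vertex. -/
def vertexChain (x : X) : (singularChains X).X 0 :=
  ((TopCat.toSSet.obj (TopCat.of X)).ιChainComplex (R := ModuleCat.of ℤ ℤ) (singularVertex x)).hom (1 : ℤ)

/-- The boundary `δ₀ - δ₁ + δ₂` of a 2-simplex dies in `opcycles 1`, the cokernel of `d 2 1`. -/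
lemma edgeClass_triangle (s : (TopCat.toSSet.obj (TopCat.of X)) _⦋2⦌) :
    edgeClass ((TopCat.toSSet.obj (TopCat.of X)).δ 1 s) =
      edgeClass ((TopCat.toSSet.obj (TopCat.of X)).δ 2 s) +
      edgeClass ((TopCat.toSSet.obj (TopCat.of X)).δ 0 s) := by
  have h : (TopCat.toSSet.obj (TopCat.of X)).ιChainComplex (R := ModuleCat.of ℤ ℤ) s ≫ (singularChains X).d 2 1 ≫
      (singularChains X).pOpcycles 1 = 0 := by simp
  rw [← Category.assoc, SSet.ιChainComplex_d] at h
  have := congr($(h).hom (1 : ℤ))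
  simp [Fin.sum_univ_three, Preadditive.add_comp, Preadditive.neg_comp] at this
  simp [edgeClass]
  rw [← sub_eq_zero, ← neg_eq_zero, ← this]
  abel

lemma fromOpcycles_edgeClass {x y : X} (γ : Path x y) :
    ((singularChains X).fromOpcycles 1 0).hom (edgeClass (singularEdge γ)) =
      vertexChain y - vertexChain x := by
  have h : (TopCat.toSSet.obj (TopCat.of X)).ιChainComplex (R := ModuleCat.of ℤ ℤ) (singularEdge γ) ≫
      (singularChains X).pOpcycles 1 ≫ (singularChains X).fromOpcycles 1 0 =
      (TopCat.toSSet.obj (TopCat.of X)).ιChainComplex (R := ModuleCat.of ℤ ℤ) (singularEdge γ) ≫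
      (singularChains X).d 1 0 := by simp
  rw [SSet.ιChainComplex_d] at h
  have := congr($(h).hom (1 : ℤ))
  simp [Fin.sum_univ_two, -SSet.ιChainComplex_d, -SSet.ιChainComplex_d_assoc,
    -HomologicalComplex.p_fromOpcycles] at this
  simp [edgeClass, vertexChain, this, sub_eq_add_neg]

lemma continuous_stdSimplex_apply {n : ℕ} (i : Fin n) :
    Continuous fun s : stdSimplex ℝ (Fin n) => s.1 i :=
  (continuous_apply i).comp continuous_subtype_val

lemma edgeClass_comp_faceMap (f : C(stdSimplex ℝ (Fin 3), X)) :
    edgeClass (singularSimplex (f.comp (faceMap 1))) =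
      edgeClass (singularSimplex (f.comp (faceMap 2))) +
      edgeClass (singularSimplex (f.comp (faceMap 0))) := by
  simp_rw [← δ_singularSimplex]
  exact edgeClass_triangle _

/-- The triangle is collapsed affinely onto the unit interval with vertices going to `0`, `1/2`,
`1`. Composed with `a.trans b`, its faces 2, 0 and 1 become `a`, `b` and the concatenation. -/
lemma edgeClass_trans {x y z : X} (a : Path x y) (b : Path y z) :
    edgeClass (singularEdge (a.trans b)) = edgeClass (singularEdge a) +
      edgeClass (singularEdge b) := by
  have hI (s : stdSimplex ℝ (Fin 3)) : s.1 1 / 2 + s.1 2 ∈ unitInterval := by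
    have h0 := s.2.1 0
    have h1 := s.2.1 1
    have h2 := s.2.1 2
    have h3 := s.2.2
    rw [Fin.sum_univ_three] at h3
    constructor <;> linarith
  let f : C(stdSimplex ℝ (Fin 3), X) := ⟨fun s => a.trans b ⟨s.1 1 / 2 + s.1 2, hI s⟩, by
    exact (a.trans b).continuous.comp
      (((continuous_stdSimplex_apply 1).div_const 2).add
        (continuous_stdSimplex_apply 2) |>.subtype_mk _)⟩
  convert edgeClass_comp_faceMap f using 2
  · unfold singularEdge
    congr 2
    ext s
    change a.trans b _ = a.trans b _
    congr 1
    ext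
    simp [faceMap_one_coe]
  · unfold singularEdge
    congr 2
    ext s
    have h1 : s.1 1 ≤ 1 := stdSimplex.le_one s 1
    change a _ = a.trans b _
    rw [Path.trans_apply, dif_pos (by simp [faceMap_two_coe]; linarith)]
    congr 1
    ext
    simp [faceMap_two_coe]
    ring_nf
  · unfold singularEdge
    congr 2
    ext s
    have h1 : s.1 0 + s.1 1 = 1 := stdSimplex.add_eq_one s
    have h2 : 0 ≤ s.1 1 := s.2.1 1
    obtain h | h := h2.eq_or_lt
    · have : stdSimplexHomeomorphUnitInterval s = 0 := Subtype.ext h.symm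
      change b _ = a.trans b _
      rw [this, Path.trans_apply, dif_pos (by simp [faceMap_zero_coe]; linarith), b.source]
      refine a.target.symm.trans (congrArg a (Subtype.ext ?_))
      simp [faceMap_zero_coe]
      linarith
    · change b _ = a.trans b _
      rw [Path.trans_apply, dif_neg (by simp [faceMap_zero_coe]; linarith)]
      congr 1
      ext
      simp [faceMap_zero_coe]
      change s.1 1 = _
      linarith

lemma edgeClass_refl (x : X) : edgeClass (singularEdge (Path.refl x)) = 0 := by
  have := edgeClass_trans (Path.refl x) (Path.refl x)
  rwa [Path.refl_trans_refl, left_eq_add] at this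

lemma edgeClass_eq_of_homotopic {x y : X} {a b : Path x y} (h : a.Homotopic b) :
    edgeClass (singularEdge a) = edgeClass (singularEdge b) := by
  obtain ⟨F⟩ := h
  have h12 (s : stdSimplex ℝ (Fin 3)) : s.1 1 + s.1 2 ∈ unitInterval := by
    have h0 := s.2.1 0
    have h1 := s.2.1 1
    have h2 := s.2.1 2
    have h3 := s.2.2
    rw [Fin.sum_univ_three] at h3
    constructor <;> linarith
  have h2 (s : stdSimplex ℝ (Fin 3)) : s.1 2 ∈ unitInterval :=
    ⟨s.2.1 2, stdSimplex.le_one s 2⟩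
  -- The square of the homotopy is cut along its diagonal: `f` and `g` are the two halves. They
  -- share the diagonal as face 1, and their remaining faces are `a`, `b` and two constant edges,
  -- whose class is zero.
  let f : C(stdSimplex ℝ (Fin 3), X) :=
    ⟨fun s => F (⟨s.1 2, h2 s⟩, ⟨s.1 1 + s.1 2, h12 s⟩), by
      exact F.continuous.comp (((continuous_stdSimplex_apply 2).subtype_mk _).prodMk
        (((continuous_stdSimplex_apply 1).add (continuous_stdSimplex_apply 2)).subtype_mk _))⟩
  let g : C(stdSimplex ℝ (Fin 3), X) :=
    ⟨fun s => F (⟨s.1 1 + s.1 2, h12 s⟩, ⟨s.1 2, h2 s⟩), by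
      exact F.continuous.comp ((((continuous_stdSimplex_apply 1).add
        (continuous_stdSimplex_apply 2)).subtype_mk _).prodMk
        ((continuous_stdSimplex_apply 2).subtype_mk _))⟩
  have hf := edgeClass_comp_faceMap f
  have hg := edgeClass_comp_faceMap g
  have hfg : f.comp (faceMap 1) = g.comp (faceMap 1) := by
    ext s
    change F _ = F _
    congr 2 <;> ext <;> simp [faceMap_one_coe]
  have e1 : singularSimplex (f.comp (faceMap 2)) = singularEdge a := by
    unfold singularEdge
    congr 1
    ext s
    refine (congrArg F (Prod.ext (Subtype.ext ?_) (Subtype.ext ?_))).trans (F.apply_zero _) <;>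
      simp [faceMap_two_coe]
  have e2 : singularSimplex (f.comp (faceMap 0)) = singularEdge (Path.refl y) := by
    unfold singularEdge
    congr 1
    ext s
    change F _ = y
    refine (show ∀ t : unitInterval, t = 1 → ∀ u, F (u, t) = y from ?_) _ (Subtype.ext ?_) _
    · rintro _ rfl u
      exact F.target u
    · simp only [faceMap_zero_coe]
      exact stdSimplex.add_eq_one s
  have e3 : singularSimplex (g.comp (faceMap 0)) = singularEdge b := by
    unfold singularEdge
    congr 1
    ext s
    refine (congrArg F (Prod.ext (Subtype.ext ?_) (Subtype.ext ?_))).trans (F.apply_one _)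
    · simp only [faceMap_zero_coe]
      exact stdSimplex.add_eq_one s
    · simp [faceMap_zero_coe]
  have e4 : singularSimplex (g.comp (faceMap 2)) = singularEdge (Path.refl x) := by
    unfold singularEdge
    congr 1
    ext s
    change F _ = x
    refine (show ∀ t : unitInterval, t = 0 → ∀ u, F (u, t) = x from ?_) _ (Subtype.ext ?_) _
    · rintro _ rfl u
      exact F.source u
    · simp [faceMap_two_coe]
  rw [e1, e2, edgeClass_refl, add_zero] at hf
  rw [e3, e4, edgeClass_refl, zero_add] at hg
  rw [← hf, ← hg, hfg]

/-- The class of a homotopy class of paths in the group of `1`-chains modulo boundaries. -/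
def pathClass {x y : X} (γ : Path.Homotopic.Quotient x y) : (singularChains X).opcycles 1 :=
  Quotient.lift (fun γ : Path x y => edgeClass (singularEdge γ))
    (fun _ _ h => edgeClass_eq_of_homotopic h) γ

lemma pathClass_mk {x y : X} (γ : Path x y) :
    pathClass (.mk γ) = edgeClass (singularEdge γ) := rfl

lemma pathClass_trans {x y z : X} (a : Path.Homotopic.Quotient x y)
    (b : Path.Homotopic.Quotient y z) : pathClass (a.trans b) = pathClass a + pathClass b := by
  induction a, b using Path.Homotopic.Quotient.ind₂ with
  | _ a b => exact edgeClass_trans a b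

lemma pathClass_refl (x : X) : pathClass (.refl x) = 0 := edgeClass_refl x

/-- The map sending a loop to its class. -/
def loopClass (x : X) : FundamentalGroup X x →*
    Multiplicative ((singularChains X).opcycles 1) where
  toFun γ := Multiplicative.ofAdd (pathClass γ)
  map_one' := pathClass_refl x
  map_mul' a b := by
    change Multiplicative.ofAdd (pathClass (Path.Homotopic.Quotient.trans b a)) = _
    -- The product of the fundamental group is concatenation in reversed order, which does not
    -- matter in a commutative target.
    rw [pathClass_trans, add_comm]
    rfl

lemma singularEdge_injective {x y x' y' : X} {a : Path x y} {b : Path x' y'}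
    (h : singularEdge a = singularEdge b) (t : unitInterval) : a t = b t := by
  have := (TopCat.toSSetObjEquiv (TopCat.of X) (.op ⦋1⦌)).symm.injective h
  simpa using DFunLike.congr_fun this (stdSimplexHomeomorphUnitInterval.symm t)

/-! ### Infinite cyclic fundamental group implies infinite cyclic first homology. -/

section degree

variable [PathConnectedSpace X] {x₀ : X} (E : FundamentalGroup X x₀ ≃* Multiplicative ℤ)

/-- The loop obtained by joining the ends of a path to the base point. -/
def closeUp (x₀ : X) {x y : X} (γ : Path.Homotopic.Quotient x y) : FundamentalGroup X x₀ :=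
  ((Path.Homotopic.Quotient.mk (PathConnectedSpace.somePath x₀ x)).trans γ).trans
    (Path.Homotopic.Quotient.mk (PathConnectedSpace.somePath x₀ y)).symm

lemma closeUp_trans {x y z : X} (a : Path.Homotopic.Quotient x y)
    (b : Path.Homotopic.Quotient y z) :
    closeUp x₀ (a.trans b) = closeUp x₀ b * closeUp x₀ a := by
  rw [FundamentalGroup.mul_def]
  simp only [closeUp, Path.Homotopic.Quotient.trans_assoc]
  congr 2
  rw [← Path.Homotopic.Quotient.trans_assoc _ _ (b.trans _),
    Path.Homotopic.Quotient.symm_trans, Path.Homotopic.Quotient.refl_trans]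

/-- The degree of a path. -/
def pathDegree {x y : X} (γ : Path.Homotopic.Quotient x y) : ℤ :=
  Multiplicative.toAdd (E (closeUp x₀ γ))

lemma pathDegree_trans {x y z : X} (a : Path.Homotopic.Quotient x y)
    (b : Path.Homotopic.Quotient y z) : pathDegree E (a.trans b) = pathDegree E a + pathDegree E b := by
  rw [pathDegree, closeUp_trans, map_mul, toAdd_mul, add_comm]
  rfl

/-- On loops, the degree is the given isomorphism. -/
lemma pathDegree_loop (γ : FundamentalGroup X x₀) : pathDegree E γ = Multiplicative.toAdd (E γ) := by
  let c : FundamentalGroup X x₀ := Path.Homotopic.Quotient.mk (PathConnectedSpace.somePath x₀ x₀)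
  have : closeUp x₀ γ = c⁻¹ * (γ * c) := rfl
  rw [pathDegree]
  congr 1
  -- The chosen path from `x₀` to itself need not be constant, so closing up conjugates the loop; in
  -- `ℤ` conjugation is invisible.
  rw [this, map_mul, map_mul, map_inv, mul_comm, mul_inv_cancel_right]

/-- The closed-up loop is a power of the generator, the exponent being the degree. Its class differs
from that of `γ` by the two auxiliary paths to the ends. This is `opcycles_eq` on a single edge. -/
lemma pathClass_eq {x y : X} (γ : Path.Homotopic.Quotient x y) :
    pathClass γ = pathDegree E γ • pathClass (E.symm (Multiplicative.ofAdd 1)) +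
      (pathClass (.mk (PathConnectedSpace.somePath x₀ y)) -
        pathClass (.mk (PathConnectedSpace.somePath x₀ x))) := by
  have h1 : pathClass (closeUp x₀ γ) =
      pathClass (.mk (PathConnectedSpace.somePath x₀ x)) + pathClass γ -
        pathClass (.mk (PathConnectedSpace.somePath x₀ y)) := by
    rw [eq_sub_iff_add_eq, ← pathClass_trans, ← pathClass_trans, closeUp,
      Path.Homotopic.Quotient.trans_assoc, Path.Homotopic.Quotient.symm_trans,
      Path.Homotopic.Quotient.trans_refl]
  have h2 : pathClass (closeUp x₀ γ) =
      pathDegree E γ • pathClass (E.symm (Multiplicative.ofAdd 1)) := by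
    have : closeUp x₀ γ = (E.symm (Multiplicative.ofAdd 1)) ^ pathDegree E γ := by
      rw [← map_zpow, ← ofAdd_zsmul, pathDegree]
      simp
    rw [this]
    exact congrArg Multiplicative.toAdd (map_zpow (loopClass x₀) _ _)
  rw [← h2, h1]
  abel

/-- The degree of a singular edge. -/
def edgeDegree (s : (TopCat.toSSet.obj (TopCat.of X)) _⦋1⦌) : ℤ :=
  pathDegree E (.mk (singularEdge_surjective s).choose_spec.choose_spec.choose)

/-- `edgeDegree` uses a chosen representing path, but an edge determines its path pointwise,
endpoints included, so the choice is harmless. -/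
lemma edgeDegree_singularEdge {x y : X} (γ : Path x y) :
    edgeDegree E (singularEdge γ) = pathDegree E (.mk γ) := by
  have h := singularEdge_injective
    (singularEdge_surjective (singularEdge γ)).choose_spec.choose_spec.choose_spec
  unfold edgeDegree
  generalize (singularEdge_surjective (singularEdge γ)).choose_spec.choose_spec.choose = γ' at h ⊢
  generalize (singularEdge_surjective (singularEdge γ)).choose_spec.choose = y' at *
  generalize (singularEdge_surjective (singularEdge γ)).choose = x' at *
  obtain rfl : x' = x := by simpa using h 0
  obtain rfl : y' = y := by simpa using h 1
  rw [Path.ext (funext h)]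

/-- The degree of `1`-chains. -/
def chainDegree : (singularChains X).X 1 ⟶ ModuleCat.of ℤ ℤ :=
  Cofan.IsColimit.desc ((TopCat.toSSet.obj (TopCat.of X)).isColimitChainComplexXCofan
    (ModuleCat.of ℤ ℤ) 1) fun s => ModuleCat.ofHom (LinearMap.toSpanSingleton ℤ ℤ (edgeDegree E s))

lemma ι_chainDegree (s : (TopCat.toSSet.obj (TopCat.of X)) _⦋1⦌) :
    (TopCat.toSSet.obj (TopCat.of X)).ιChainComplex s ≫ chainDegree E =
      ModuleCat.ofHom (LinearMap.toSpanSingleton ℤ ℤ (edgeDegree E s)) :=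
  Cofan.IsColimit.fac ((TopCat.toSSet.obj (TopCat.of X)).isColimitChainComplexXCofan
    (ModuleCat.of ℤ ℤ) 1) _ s

lemma chainDegree_ι_apply (s : (TopCat.toSSet.obj (TopCat.of X)) _⦋1⦌) :
    (chainDegree E).hom (((TopCat.toSSet.obj (TopCat.of X)).ιChainComplex
      (R := ModuleCat.of ℤ ℤ) s).hom (1 : ℤ)) = edgeDegree E s :=
  (congr($(ι_chainDegree E s).hom (1 : ℤ))).trans (one_smul ℤ _)

/-- The boundary of a triangle consists of paths `a`, `b`, `c` with `a.trans b` homotopic to `c`,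
and the degree is additive on homotopy classes. -/
lemma d_chainDegree : (singularChains X).d 2 1 ≫ chainDegree E = 0 := by
  apply SSet.chainComplex_hom_ext
  intro s
  obtain ⟨f, rfl⟩ := singularSimplex_surjective s
  obtain ⟨x, y, z, a, b, c, h0, h1, h2, h⟩ := exists_paths_of_triangle f
  have hd := congrArg (pathDegree E) (Path.Homotopic.Quotient.eq.mpr h)
  rw [Path.Homotopic.Quotient.mk_trans, pathDegree_trans] at hd
  rw [← Category.assoc, SSet.ιChainComplex_d]
  ext
  simp [Fin.sum_univ_three, δ_singularSimplex, h0, h1, h2]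
  refine (congrArg₂ (· + ·) (congrArg₂ (· + ·) (chainDegree_ι_apply E _)
    (congrArg Neg.neg (chainDegree_ι_apply E _))) (chainDegree_ι_apply E _)).trans ?_
  simp [edgeDegree_singularEdge, ← hd]

/-- The degree of `1`-chains modulo boundaries. -/
def opcyclesDegree : (singularChains X).opcycles 1 ⟶ ModuleCat.of ℤ ℤ :=
  (singularChains X).descOpcycles (chainDegree E) 2 (by simp) (d_chainDegree E)

lemma opcyclesDegree_edgeClass {x y : X} (γ : Path x y) :
    (opcyclesDegree E).hom (edgeClass (singularEdge γ)) = pathDegree E (.mk γ) := by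
  rw [← edgeDegree_singularEdge, ← chainDegree_ι_apply]
  exact congr($((singularChains X).p_descOpcycles (chainDegree E) 2 (by simp)
    (d_chainDegree E)).hom _)

/-- The map sending a vertex to the class of a path from the base point to it. -/
def pathToVertex (x₀ : X) : (singularChains X).X 0 ⟶ (singularChains X).opcycles 1 :=
  Cofan.IsColimit.desc ((TopCat.toSSet.obj (TopCat.of X)).isColimitChainComplexXCofan
    (ModuleCat.of ℤ ℤ) 0) fun s => ModuleCat.ofHom (LinearMap.toSpanSingleton ℤ _
      (pathClass (.mk (PathConnectedSpace.somePath x₀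
        (TopCat.toSSetObjEquiv (TopCat.of X) (.op ⦋0⦌) s default)))))

lemma pathToVertex_vertexChain (x : X) : (pathToVertex x₀).hom (vertexChain x) =
    pathClass (.mk (PathConnectedSpace.somePath x₀ x)) := by
  have : (TopCat.toSSet.obj (TopCat.of X)).ιChainComplex (singularVertex x) ≫ pathToVertex x₀ =
      ModuleCat.ofHom (LinearMap.toSpanSingleton ℤ _
        (pathClass (.mk (PathConnectedSpace.somePath x₀ x)))) :=
    Cofan.IsColimit.fac ((TopCat.toSSet.obj (TopCat.of X)).isColimitChainComplexXCofan
      (ModuleCat.of ℤ ℤ) 0) _ (singularVertex x)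
  exact (congr($(this).hom (1 : ℤ))).trans (LinearMap.toSpanSingleton_apply_one _ _ _)

/-- Every chain modulo boundaries is determined by its degree and its boundary. Both sides are
linear in `z`, so edges suffice, where it is `pathClass_eq`. On homology the last term vanishes,
which makes the degree injective there. -/
lemma opcycles_eq (z : (singularChains X).opcycles 1) :
    z = (opcyclesDegree E).hom z • pathClass (E.symm (Multiplicative.ofAdd 1)) +
      (pathToVertex x₀).hom (((singularChains X).fromOpcycles 1 0).hom z) := by
  let φ : (singularChains X).opcycles 1 →ₗ[ℤ] (singularChains X).opcycles 1 :=
    LinearMap.toSpanSingleton ℤ _ (pathClass (E.symm (Multiplicative.ofAdd 1))) ∘ₗ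
      (opcyclesDegree E).hom +
    (pathToVertex x₀).hom ∘ₗ ((singularChains X).fromOpcycles 1 0).hom
  have hφ (z : (singularChains X).opcycles 1) : φ z =
      (opcyclesDegree E).hom z • pathClass (E.symm (Multiplicative.ofAdd 1)) +
      (pathToVertex x₀).hom (((singularChains X).fromOpcycles 1 0).hom z) :=
    congrArg₂ (· + ·) (int_smul_eq_zsmul ((singularChains X).opcycles 1).isModule
      ((opcyclesDegree E).hom z : ℤ) (pathClass (E.symm (Multiplicative.ofAdd 1)))) rfl
  have : 𝟙 ((singularChains X).opcycles 1) = ModuleCat.ofHom φ := by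
    rw [← cancel_epi ((singularChains X).pOpcycles 1)]
    apply SSet.chainComplex_hom_ext
    intro s
    obtain ⟨x, y, γ, rfl⟩ := singularEdge_surjective s
    ext
    change edgeClass (singularEdge γ) = φ (edgeClass (singularEdge γ))
    rw [hφ, opcyclesDegree_edgeClass, fromOpcycles_edgeClass, map_sub, pathToVertex_vertexChain,
      pathToVertex_vertexChain, ← pathClass_mk, ← pathClass_eq]
  exact congr($(this).hom z).trans (hφ z)

/-- If the fundamental group of a path connected space is infinite cyclic, then so is its first
homology group. -/
theorem nonempty_H_one_iso (E : FundamentalGroup X x₀ ≃* Multiplicative ℤ) :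
    Nonempty (H 1 X ≅ ModuleCat.of ℤ ℤ) := by
  let φ : (singularChains X).homology 1 ⟶ ModuleCat.of ℤ ℤ :=
    (singularChains X).homologyι 1 ≫ opcyclesDegree E
  have hι (z : (singularChains X).homology 1) : ((singularChains X).fromOpcycles 1 0).hom
      (((singularChains X).homologyι 1).hom z) = 0 := by
    have : (singularChains X).homologyι 1 ≫ (singularChains X).fromOpcycles 1 0 = 0 := by simp
    exact congr($(this).hom z)
  have hinj : Function.Injective φ.hom := by
    rw [injective_iff_map_eq_zero]
    intro z hz
    have h := opcycles_eq E (((singularChains X).homologyι 1).hom z)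
    rw [hι, map_zero, add_zero, show (opcyclesDegree E).hom (((singularChains X).homologyι 1).hom z) = 0 from hz, zero_smul] at h
    exact (injective_iff_map_eq_zero _).mp ((ModuleCat.mono_iff_injective _).mp
      (inferInstanceAs (Mono ((singularChains X).homologyι 1)))) z h
  have hsurj : Function.Surjective φ.hom := by
    have hexact : (ShortComplex.mk ((singularChains X).homologyι 1)
        ((singularChains X).fromOpcycles 1 0) (by simp)).Exact :=
      ShortComplex.exact_of_f_is_kernel _ ((singularChains X).homologyIsKernel 1 0 (by simp))
    -- A loop representing the generator is a cycle of degree `1`; its multiples give surjectivity.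
    obtain ⟨γ, hγ⟩ := Path.Homotopic.Quotient.mk_surjective (E.symm (Multiplicative.ofAdd 1))
    obtain ⟨z, hz⟩ := (ShortComplex.moduleCat_exact_iff _).mp hexact (edgeClass (singularEdge γ))
      ((fromOpcycles_edgeClass γ).trans (sub_self _))
    have h1 : φ.hom z = (1 : ℤ) := by
      change (opcyclesDegree E).hom (((singularChains X).homologyι 1).hom z) = 1
      rw [show ((singularChains X).homologyι 1).hom z = edgeClass (singularEdge γ) from hz,
        opcyclesDegree_edgeClass, hγ, pathDegree_loop]
      simp
    intro n
    refine ⟨(n : ℤ) • z, ?_⟩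
    rw [map_zsmul, h1]
    exact mul_one (n : ℤ)
  exact ⟨(LinearEquiv.ofBijective φ.hom ⟨hinj, hsurj⟩).toModuleIso⟩

end degree

end
end ProjVar

/-! ### Paths and open covers: an elementary form of van Kampen's theorem. -/

namespace ProjVar
noncomputable section

open CategoryTheory

section PathInduction

variable {X : Type} [TopologicalSpace X]

/-- A property of homotopy classes of paths that is stable under concatenation and holds for all
paths inside the members of an open cover holds for all homotopy classes of paths. -/
theorem pathClass_induction {ι : Type*} {U : ι → Set X} (hU : ∀ i, IsOpen (U i))
    (hcover : ∀ x, ∃ i, x ∈ U i)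
    {P : ∀ {x y : X}, Path.Homotopic.Quotient x y → Prop}
    (hlocal : ∀ (i : ι) {x y : X} (γ : Path x y), (∀ t, γ t ∈ U i) → P (.mk γ))
    (htrans : ∀ {x y z : X} (a : Path.Homotopic.Quotient x y) (b : Path.Homotopic.Quotient y z),
      P a → P b → P (a.trans b))
    {x y : X} (γ : Path.Homotopic.Quotient x y) : P γ := by
  induction γ using Path.Homotopic.Quotient.ind with
  | _ γ =>
  obtain ⟨t, ht0, htm, ⟨n, hn⟩, ht⟩ := exists_monotone_Icc_subset_open_cover_unitInterval
    (fun i => (hU i).preimage γ.continuous)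
    (fun s _ => Set.mem_iUnion.mpr (hcover (γ s)))
  have hstep (k : ℕ) : P (.mk (γ.subpath (t k) (t (k + 1)))) := by
    obtain ⟨i, hi⟩ := ht k
    refine hlocal i _ fun s => ?_
    have hs : γ.subpath (t k) (t (k + 1)) s ∈ γ '' Set.Icc (t k) (t (k + 1)) := by
      rw [← Path.range_subpath_of_le _ _ _ (htm k.le_succ)]
      exact ⟨s, rfl⟩
    obtain ⟨u, hu, hus⟩ := hs
    rw [← hus]
    exact hi hu
  -- By the Lebesgue number lemma each subinterval maps into one member of the cover; the pieces are
  -- concatenated one at a time.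
  have hall (k : ℕ) : P (.mk (γ.subpath (t 0) (t (k + 1)))) := by
    induction k with
    | zero => exact hstep 0
    | succ k ih =>
      have := htrans _ _ ih (hstep (k + 1))
      rwa [← Path.Homotopic.Quotient.mk_trans, Path.Homotopic.Quotient.eq.mpr
        ⟨Path.Homotopy.subpathTransSubpath γ _ _ _⟩] at this
  have h1 := hall n
  rw [ht0, hn (n + 1) n.le_succ, Path.subpath_zero_one] at h1
  -- The full subpath runs between `γ 0` and `γ 1`, which equal `x` and `y` only propositionally.
  have hcast : ∀ {x' y' : X} (hx : x' = x) (hy : y' = y), P (.mk (γ.cast hx hy)) → P (.mk γ) := by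
    rintro _ _ rfl rfl h
    exact h
  exact hcast _ _ h1

/-- Two paths with the same ends that run in a retract of a simply connected space are
homotopic. -/
lemma homotopic_of_retract {Y : Type} [TopologicalSpace Y] [SimplyConnectedSpace Y] {U : Set X}
    {s : X → Y} (hs : ContinuousOn s U) (r : C(Y, X)) (hr : ∀ x ∈ U, r (s x) = x) {x y : X}
    {p q : Path x y} (hp : ∀ t, p t ∈ U) (hq : ∀ t, q t ∈ U) : p.Homotopic q := by
  have hx : x ∈ U := by simpa using hp 0
  have hy : y ∈ U := by simpa using hp 1
  let lift (p : Path x y) (hp : ∀ t, p t ∈ U) : Path (s x) (s y) :=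
    { toFun t := s (p t)
      continuous_toFun := hs.comp_continuous p.continuous hp
      source' := by simp
      target' := by simp }
  -- The homotopy lives in `Y` and is mapped back by `r`. It may leave `U`, so `U` itself need not
  -- be simply connected.
  have h := ((SimplyConnectedSpace.paths_homotopic (lift p hp) (lift q hq)).map r).pathCast
    (hr x hx).symm (hr y hy).symm
  convert h using 1
  · ext t
    exact (hr _ (hp t)).symm
  · ext t
    exact (hr _ (hq t)).symm

/-- A space covered by open sets that contain a common point, have path connected pairwise
intersections and in which paths with the same ends are homotopic is simply connected. -/
theorem simplyConnectedSpace_of_cover {ι : Type*} {U : ι → Set X} (hU : ∀ i, IsOpen (U i))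
    (hcover : ∀ x, ∃ i, x ∈ U i) (x₀ : X) (hx₀ : ∀ i, x₀ ∈ U i)
    (hpath : ∀ i {x y : X} {p q : Path x y}, (∀ t, p t ∈ U i) → (∀ t, q t ∈ U i) →
      p.Homotopic q)
    (hinter : ∀ i j, IsPathConnected (U i ∩ U j)) : SimplyConnectedSpace X := by
  have hex (i j : ι) {x : X} (hi : x ∈ U i) (hj : x ∈ U j) :
      ∃ c : Path x₀ x, ∀ t, c t ∈ U i ∩ U j := by
    obtain ⟨c, hc⟩ := (hinter i j).joinedIn x₀ ⟨hx₀ i, hx₀ j⟩ x ⟨hi, hj⟩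
    exact ⟨c, hc⟩
  choose idx hidx using hcover
  choose c hc using fun x => hex (idx x) (idx x) (hidx x) (hidx x)
  -- The class of the path from `x₀` to `x` is the same for every member of the cover in which it
  -- runs: a path in the intersection of two members compares them.
  have hc' (i : ι) {x : X} (hx : x ∈ U i) (c' : Path x₀ x) (h : ∀ t, c' t ∈ U i) :
      Path.Homotopic.Quotient.mk c' = .mk (c x) := by
    obtain ⟨d, hd⟩ := hex i (idx x) hx (hidx x)
    rw [Path.Homotopic.Quotient.eq.mpr (hpath i h fun t => (hd t).1)]
    exact Path.Homotopic.Quotient.eq.mpr (hpath (idx x) (fun t => (hd t).2) fun t => (hc x t).1)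
  -- The standard classes `c x` absorb any path. Hence each path class from `x` to `y` is the
  -- inverse of `c x` followed by `c y`.
  have key : ∀ {x y : X} (γ : Path.Homotopic.Quotient x y),
      (Path.Homotopic.Quotient.mk (c x)).trans γ = .mk (c y) := by
    intro x y γ
    refine pathClass_induction (P := fun {x y} γ =>
      (Path.Homotopic.Quotient.mk (c x)).trans γ = .mk (c y)) hU (fun x => ⟨idx x, hidx x⟩) ?_ ?_ γ
    · intro i x y γ hγ
      have hx : x ∈ U i := by simpa using hγ 0
      have hy : y ∈ U i := by simpa using hγ 1
      obtain ⟨d, hd⟩ := hex i i hx hx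
      rw [← hc' i hx d fun t => (hd t).1, ← Path.Homotopic.Quotient.mk_trans]
      refine hc' i hy _ fun t => ?_
      rw [Path.trans_apply]
      split_ifs
      · exact (hd _).1
      · exact hγ _
    · intro x y z a b ha hb
      rw [← Path.Homotopic.Quotient.trans_assoc, ha, hb]
  have hjoined (x : X) : Joined x₀ x := ⟨c x⟩
  rw [simply_connected_iff_paths_homotopic]
  refine ⟨⟨⟨x₀⟩, fun x y => (hjoined x).symm.trans (hjoined y)⟩, fun x y => ⟨fun a b => ?_⟩⟩
  rw [← Path.Homotopic.Quotient.refl_trans a, ← Path.Homotopic.Quotient.refl_trans b,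
    ← Path.Homotopic.Quotient.symm_trans (.mk (c x)), Path.Homotopic.Quotient.trans_assoc,
    Path.Homotopic.Quotient.trans_assoc, key, key]

end PathInduction

/-! ### Projective space: Hausdorff, compact, simply connected. -/

section ProjectiveSpace

variable {ι κ : Type}

/-- The saturation of an open set is the union of its multiples by nonzero scalars, hence open. -/
lemma isOpenQuotientMap_mk : IsOpenQuotientMap
    (Projectivization.mk' ℂ : {v : ι → ℂ // v ≠ 0} → PSpace ι) where
  surjective := Quotient.mk''_surjective
  continuous := continuous_coinduced_rng
  isOpenMap U hU := by
    rw [isOpen_coinduced]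
    have : (Projectivization.mk' ℂ : {v : ι → ℂ // v ≠ 0} → PSpace ι) ⁻¹'
        ((Projectivization.mk' ℂ) '' U) =
        ⋃ c : ℂˣ, (fun v : {v : ι → ℂ // v ≠ 0} =>
          (⟨(c : ℂ) • v.1, smul_ne_zero c.ne_zero v.2⟩ : {v : ι → ℂ // v ≠ 0})) ⁻¹' U := by
      ext v
      simp only [Set.mem_preimage, Set.mem_image, Set.mem_iUnion]
      constructor
      · rintro ⟨w, hw, h⟩
        obtain ⟨a, ha⟩ := (Projectivization.mk_eq_mk_iff ℂ w.1 v.1 w.2 v.2).mp h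
        refine ⟨a, ?_⟩
        convert hw
        exact ha
      · rintro ⟨c, hc⟩
        exact ⟨_, hc, (Projectivization.mk_eq_mk_iff ℂ _ v.1 _ v.2).mpr ⟨c, rfl⟩⟩
    rw [this]
    refine isOpen_iUnion fun c => hU.preimage ?_
    fun_prop

lemma continuous_mk {Y : Type*} [TopologicalSpace Y] {f : Y → ι → ℂ} (hf : Continuous f)
    (h : ∀ y, f y ≠ 0) : Continuous fun y => (Projectivization.mk ℂ (f y) (h y) : PSpace ι) :=
  isOpenQuotientMap_mk.continuous.comp (hf.subtype_mk h)

lemma exists_rep_mk {v : ι → ℂ} (hv : v ≠ 0) :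
    ∃ c : ℂ, c ≠ 0 ∧ (Projectivization.mk ℂ v hv).rep = c • v := by
  obtain ⟨a, ha⟩ := Projectivization.exists_smul_eq_mk_rep ℂ v hv
  exact ⟨a, a.ne_zero, ha.symm⟩

lemma mk_eq_mk {v w : ι → ℂ} (hv : v ≠ 0) (hw : w ≠ 0) {c : ℂ} (h : v = c • w) :
    (Projectivization.mk ℂ v hv : PSpace ι) = Projectivization.mk ℂ w hw :=
  (Projectivization.mk_eq_mk_iff' ℂ v w hv hw).mpr ⟨c, h.symm⟩

/-- The matrix `v v^* / |v|^2`, a complete invariant of a point of projective space. -/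
def projector [Fintype ι] (v : ι → ℂ) (i j : ι) : ℂ :=
  v i * starRingEnd ℂ (v j) / ∑ k, v k * starRingEnd ℂ (v k)

lemma sum_mul_conj_ne_zero [Fintype ι] {v : ι → ℂ} (hv : v ≠ 0) :
    ∑ k, v k * starRingEnd ℂ (v k) ≠ 0 := by
  simp_rw [Complex.mul_conj]
  rw [← Complex.ofReal_sum, Complex.ofReal_ne_zero]
  obtain ⟨i, hi⟩ := Function.ne_iff.mp hv
  exact (Finset.sum_pos' (fun k _ => Complex.normSq_nonneg _)
    ⟨i, Finset.mem_univ i, Complex.normSq_pos.mpr hi⟩).ne'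

lemma projector_smul [Fintype ι] {c : ℂ} (hc : c ≠ 0) (v : ι → ℂ) :
    projector (c • v) = projector v := by
  ext i j
  have : ∑ k, (c • v) k * starRingEnd ℂ ((c • v) k) =
      (c * starRingEnd ℂ c) * ∑ k, v k * starRingEnd ℂ (v k) := by
    rw [Finset.mul_sum]
    exact Finset.sum_congr rfl fun k _ => by simp; ring
  have hc' : starRingEnd ℂ c ≠ 0 := by simpa
  rw [projector, this, projector, Pi.smul_apply, Pi.smul_apply, smul_eq_mul, smul_eq_mul, map_mul,
    show c * v i * (starRingEnd ℂ c * starRingEnd ℂ (v j)) =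
      (c * starRingEnd ℂ c) * (v i * starRingEnd ℂ (v j)) by ring,
    mul_div_mul_left _ _ (mul_ne_zero hc hc')]

instance [Fintype ι] : T2Space (PSpace ι) := by
  have hmk (v : ι → ℂ) (hv : v ≠ 0) :
      projector (Projectivization.mk ℂ v hv).rep = projector v := by
    obtain ⟨c, hc, h⟩ := exists_rep_mk hv
    rw [h, projector_smul hc]
  refine T2Space.of_injective_continuous (f := fun x : PSpace ι => projector x.rep) ?_ ?_
  · intro x y h
    obtain ⟨j, hj⟩ := Function.ne_iff.mp y.rep_nonzero
    rw [← x.mk_rep, ← y.mk_rep]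
    have h1 := sum_mul_conj_ne_zero x.rep_nonzero
    have h2 := sum_mul_conj_ne_zero y.rep_nonzero
    have hj' : starRingEnd ℂ (y.rep j) ≠ 0 := by simpa using hj
    -- Column `j` of the projector of a vector is a multiple of that vector, nonzero when its `j`-th
    -- coordinate is. The constant comes from equating column `j` for `x` and for `y`.
    refine (mk_eq_mk _ _ (c := starRingEnd ℂ (x.rep j) / (∑ k, x.rep k * starRingEnd ℂ (x.rep k))
      * (∑ k, y.rep k * starRingEnd ℂ (y.rep k)) / starRingEnd ℂ (y.rep j)) ?_).symm
    ext i
    have := congrFun (congrFun h i) j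
    simp only [projector] at this
    rw [Pi.smul_apply, smul_eq_mul]
    rw [div_eq_div_iff h1 h2] at this
    rw [div_mul_eq_mul_div, eq_div_iff hj', div_mul_eq_mul_div, div_mul_eq_mul_div, eq_div_iff h1]
    linear_combination -this
  · rw [← isOpenQuotientMap_mk.continuous_comp_iff]
    have : (fun x : PSpace ι => projector x.rep) ∘ (Projectivization.mk' ℂ) =
        fun v : {v : ι → ℂ // v ≠ 0} => projector v.1 := by
      ext1 v
      exact hmk v.1 v.2
    rw [this]
    refine continuous_pi fun i => continuous_pi fun j => ?_
    have hc (k : ι) : Continuous fun v : {v : ι → ℂ // v ≠ 0} => v.1 k :=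
      (continuous_apply k).comp continuous_subtype_val
    exact Continuous.div ((hc i).mul (Complex.continuous_conj.comp (hc j)))
      (continuous_finsetSum _ fun k _ => (hc k).mul (Complex.continuous_conj.comp (hc k)))
      fun v => sum_mul_conj_ne_zero v.2

instance [Fintype ι] : CompactSpace (PSpace ι) := by
  have : CompactSpace (Metric.sphere (0 : ι → ℂ) 1) :=
    isCompact_iff_compactSpace.mp (isCompact_sphere _ _)
  have hne (v : Metric.sphere (0 : ι → ℂ) 1) : v.1 ≠ 0 := by
    rintro h
    simpa [h] using v.2
  refine Function.Surjective.compactSpace (continuous_mk continuous_subtype_val hne) ?_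
  intro x
  have hx : ‖x.rep‖ ≠ 0 := norm_ne_zero_iff.mpr x.rep_nonzero
  refine ⟨⟨((‖x.rep‖⁻¹ : ℝ) : ℂ) • x.rep, by simp [norm_smul, hx]⟩, ?_⟩
  conv_rhs => rw [← x.mk_rep]
  exact mk_eq_mk _ _ rfl

/-- The standard affine chart of projective space. -/
def chart (i : ι) : Set (PSpace ι) := {x | x.rep i ≠ 0}

lemma mk_mem_chart {i : ι} {v : ι → ℂ} (hv : v ≠ 0) :
    Projectivization.mk ℂ v hv ∈ chart i ↔ v i ≠ 0 := by
  obtain ⟨c, hc, h⟩ := exists_rep_mk hv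
  simp [chart, h, hc]

lemma isOpen_chart (i : ι) : IsOpen (chart i) := by
  rw [← isOpenQuotientMap_mk.isQuotientMap.isOpen_preimage]
  have : (Projectivization.mk' ℂ) ⁻¹' (chart i) = {v : {v : ι → ℂ // v ≠ 0} | v.1 i ≠ 0} := by
    ext v
    exact mk_mem_chart v.2
  rw [this]
  exact isOpen_ne_fun ((continuous_apply i).comp continuous_subtype_val) continuous_const

lemma exists_mem_chart (x : PSpace ι) : ∃ i, x ∈ chart i :=
  Function.ne_iff.mp x.rep_nonzero

/-- Affine coordinates on a chart. -/
def chartCoord (i : ι) (x : PSpace ι) (j : ι) : ℂ := x.rep j / x.rep i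

lemma chartCoord_mk (i : ι) {v : ι → ℂ} (hv : v ≠ 0) (j : ι) :
    chartCoord i (Projectivization.mk ℂ v hv) j = v j / v i := by
  obtain ⟨c, hc, h⟩ := exists_rep_mk hv
  simp [chartCoord, h, mul_div_mul_left _ _ hc]

lemma continuousOn_chartCoord (i : ι) : ContinuousOn (chartCoord i) (chart i) := by
  rw [isOpenQuotientMap_mk.isQuotientMap.continuousOn_isOpen_iff (isOpen_chart i)]
  have : chartCoord i ∘ (Projectivization.mk' ℂ) =
      fun v : {v : ι → ℂ // v ≠ 0} => fun j => v.1 j / v.1 i := by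
    ext v j
    exact chartCoord_mk i v.2 j
  rw [this]
  refine continuousOn_pi.mpr fun j => ContinuousOn.div ?_ ?_ fun v hv => (mk_mem_chart v.2).mp hv
  · exact ((continuous_apply j).comp continuous_subtype_val).continuousOn
  · exact ((continuous_apply i).comp continuous_subtype_val).continuousOn

-- A chart embeds into `ι → ℂ` by affine coordinates. Overwriting coordinate `i` by `1` gives a map
-- back that is defined on the whole vector space, so `homotopic_of_retract` applies.
open Classical in
lemma homotopic_of_mem_chart (i : ι) {x y : PSpace ι} {p q : Path x y}
    (hp : ∀ t, p t ∈ chart i) (hq : ∀ t, q t ∈ chart i) : p.Homotopic q := by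
  have : ContractibleSpace (ι → ℂ) := RealTopologicalVectorSpace.contractibleSpace
  let r : C(ι → ℂ, PSpace ι) := ⟨fun v => Projectivization.mk ℂ (Function.update v i 1)
    (Function.ne_iff.mpr ⟨i, by simp⟩), continuous_mk (by fun_prop) _⟩
  refine homotopic_of_retract (continuousOn_chartCoord i) r (fun x hx => ?_) hp hq
  conv_rhs => rw [← x.mk_rep]
  refine mk_eq_mk _ _ (c := (x.rep i)⁻¹) ?_
  ext j
  by_cases hj : j = i
  · subst hj
    simp [inv_mul_cancel₀ (show x.rep j ≠ 0 from hx)]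
  · simp [hj, chartCoord, div_eq_inv_mul]

-- Exponentiating the coordinates `i` and `j` makes the intersection a continuous image of the
-- vector space `ι → ℂ`; the case `i = j` is included.
open Classical in
lemma isPathConnected_chart_inter (i j : ι) : IsPathConnected (chart i ∩ chart j) := by
  have hne (v : ι → ℂ) : (fun k => if k = i ∨ k = j then Complex.exp (v k) else v k) ≠ 0 :=
    Function.ne_iff.mpr ⟨i, by simp⟩
  have : chart i ∩ chart j =
      Set.range fun v : ι → ℂ => (Projectivization.mk ℂ _ (hne v) : PSpace ι) := by
    ext x
    constructor
    · rintro ⟨hi, hj⟩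
      refine ⟨fun k => if k = i ∨ k = j then Complex.log (x.rep k) else x.rep k, ?_⟩
      conv_rhs => rw [← x.mk_rep]
      refine mk_eq_mk _ _ (c := 1) ?_
      ext k
      by_cases hk : k = i ∨ k = j
      · have : x.rep k ≠ 0 := by rcases hk with rfl | rfl <;> assumption
        simp [hk, Complex.exp_log this]
      · simp [hk]
    · rintro ⟨v, rfl⟩
      constructor <;> simp [mk_mem_chart]
  rw [this]
  refine isPathConnected_range (continuous_mk (continuous_pi fun k => ?_) _)
  by_cases hk : k = i ∨ k = j
  · simp only [hk, if_true]
    fun_prop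
  · simp only [hk, if_false]
    fun_prop

instance [Nonempty ι] : SimplyConnectedSpace (PSpace ι) :=
  simplyConnectedSpace_of_cover isOpen_chart exists_mem_chart
    (Projectivization.mk ℂ (fun _ => 1) (Function.ne_iff.mpr ⟨Classical.arbitrary ι, by simp⟩))
    (fun _ => by simp [mk_mem_chart]) homotopic_of_mem_chart isPathConnected_chart_inter

end ProjectiveSpace

end
end ProjVar

/-! ### The fundamental group of a sphere with two points identified. -/

namespace ProjVar
noncomputable section

open CategoryTheory

/-- `X` is the projective line with the points `[1 : 0]` and `[0 : 1]` identified. -/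
structure IsPinching {X : Type} [TopologicalSpace X] (σ : PSpace (Fin 2) → X) : Prop where
  continuous : Continuous σ
  surjective : Function.Surjective σ
  eq_iff : ∀ u v, σ u = σ v ↔ u = v ∨
    ((u = pointOneZero ∨ u = pointZeroOne) ∧ (v = pointOneZero ∨ v = pointZeroOne))

lemma vec_one_ne_zero (z : ℂ) : ![z, 1] ≠ 0 := Function.ne_iff.mpr ⟨1, by simp⟩

lemma one_vec_ne_zero (z : ℂ) : ![1, z] ≠ 0 := Function.ne_iff.mpr ⟨0, by simp⟩

/-- The disc `|x_i| > |x_j|` in the projective line. -/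
def disc (i j : Fin 2) : Set (PSpace (Fin 2)) := {u | ‖u.rep j‖ < ‖u.rep i‖}

lemma mk_mem_disc {i j : Fin 2} {v : Fin 2 → ℂ} (hv : v ≠ 0) :
    Projectivization.mk ℂ v hv ∈ disc i j ↔ ‖v j‖ < ‖v i‖ := by
  obtain ⟨c, hc, h⟩ := exists_rep_mk hv
  simp [disc, h, norm_pos_iff.mpr hc]

lemma isOpen_disc (i j : Fin 2) : IsOpen (disc i j) := by
  rw [← isOpenQuotientMap_mk.isQuotientMap.isOpen_preimage]
  have : (Projectivization.mk' ℂ) ⁻¹' (disc i j) =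
      {v : {v : Fin 2 → ℂ // v ≠ 0} | ‖v.1 j‖ < ‖v.1 i‖} := by
    ext v
    exact mk_mem_disc v.2
  rw [this]
  exact isOpen_lt ((continuous_apply j).comp continuous_subtype_val).norm
    ((continuous_apply i).comp continuous_subtype_val).norm

lemma disc_subset_chart (i j : Fin 2) : disc i j ⊆ chart i := fun _ hu =>
  norm_pos_iff.mp ((norm_nonneg _).trans_lt hu)

lemma pointZeroOne_mem_disc : pointZeroOne ∈ disc 1 0 := by
  simp [pointZeroOne, mk_mem_disc]

lemma pointOneZero_mem_disc : pointOneZero ∈ disc 0 1 := by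
  simp [pointOneZero, mk_mem_disc]

lemma mk_chartCoord_one {u : PSpace (Fin 2)} (hu : u ∈ chart 1) :
    Projectivization.mk ℂ ![u.rep 0 / u.rep 1, 1] (vec_one_ne_zero _) = u := by
  conv_rhs => rw [← u.mk_rep]
  have : u.rep 1 ≠ 0 := hu
  refine mk_eq_mk _ _ (c := (u.rep 1)⁻¹) ?_
  ext i
  fin_cases i <;> simp [this, div_eq_inv_mul]

lemma mk_chartCoord_zero {u : PSpace (Fin 2)} (hu : u ∈ chart 0) :
    Projectivization.mk ℂ ![1, u.rep 1 / u.rep 0] (one_vec_ne_zero _) = u := by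
  conv_rhs => rw [← u.mk_rep]
  have : u.rep 0 ≠ 0 := hu
  refine mk_eq_mk _ _ (c := (u.rep 0)⁻¹) ?_
  ext i
  fin_cases i <;> simp [this, div_eq_inv_mul]

lemma isPathConnected_disc_one : IsPathConnected (disc 1 0) := by
  have : disc 1 0 = (fun z : ℂ => (Projectivization.mk ℂ ![z, 1] (vec_one_ne_zero z) :
      PSpace (Fin 2))) '' Metric.ball 0 1 := by
    ext u
    constructor
    · intro hu
      refine ⟨u.rep 0 / u.rep 1, ?_, mk_chartCoord_one (disc_subset_chart _ _ hu)⟩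
      have h1 : 0 < ‖u.rep 1‖ := norm_pos_iff.mpr (disc_subset_chart _ _ hu)
      rw [mem_ball_zero_iff, norm_div, div_lt_one h1]
      exact hu
    · rintro ⟨z, hz, rfl⟩
      simpa [mk_mem_disc] using hz
  rw [this]
  exact ((convex_ball (0 : ℂ) 1).isPathConnected ⟨0, by simp⟩).image
    (continuous_mk (by fun_prop) _)

lemma isPathConnected_disc_zero : IsPathConnected (disc 0 1) := by
  have : disc 0 1 = (fun z : ℂ => (Projectivization.mk ℂ ![1, z] (one_vec_ne_zero z) :
      PSpace (Fin 2))) '' Metric.ball 0 1 := by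
    ext u
    constructor
    · intro hu
      refine ⟨u.rep 1 / u.rep 0, ?_, mk_chartCoord_zero (disc_subset_chart _ _ hu)⟩
      have h1 : 0 < ‖u.rep 0‖ := norm_pos_iff.mpr (disc_subset_chart _ _ hu)
      rw [mem_ball_zero_iff, norm_div, div_lt_one h1]
      exact hu
    · rintro ⟨z, hz, rfl⟩
      simpa [mk_mem_disc] using hz
  rw [this]
  exact ((convex_ball (0 : ℂ) 1).isPathConnected ⟨0, by simp⟩).image
    (continuous_mk (by fun_prop) _)

/-- Every point of a disc is joined to one of the two special points inside the discs. -/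
lemma exists_path_in_discs {u : PSpace (Fin 2)} (hu : u ∈ disc 1 0 ∪ disc 0 1) :
    ∃ (e : PSpace (Fin 2)) (c : Path u e), (e = pointOneZero ∨ e = pointZeroOne) ∧
      ∀ t, c t ∈ disc 1 0 ∪ disc 0 1 := by
  rcases hu with hu | hu
  · obtain ⟨c, hc⟩ := isPathConnected_disc_one.joinedIn u hu _ pointZeroOne_mem_disc
    exact ⟨_, c, .inr rfl, fun t => .inl (hc t)⟩
  · obtain ⟨c, hc⟩ := isPathConnected_disc_zero.joinedIn u hu _ pointOneZero_mem_disc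
    exact ⟨_, c, .inl rfl, fun t => .inr (hc t)⟩

open Classical in
/-- The coordinates of the two discs, put on the two axes of the plane. -/
def discCoord (u : PSpace (Fin 2)) : ℂ × ℂ :=
  if u ∈ disc 1 0 then (chartCoord 1 u 0, 0)
  else if u ∈ disc 0 1 then (0, chartCoord 0 u 1) else 0

lemma discCoord_one {u : PSpace (Fin 2)} (hu : u ∈ disc 1 0) :
    discCoord u = (chartCoord 1 u 0, 0) := by
  simp [discCoord, hu]

lemma discCoord_zero {u : PSpace (Fin 2)} (hu : u ∈ disc 0 1) :
    discCoord u = (0, chartCoord 0 u 1) := by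
  have : u ∉ disc 1 0 := fun h => lt_asymm (show ‖u.rep 0‖ < ‖u.rep 1‖ from h) hu
  simp [discCoord, hu, this]

lemma discCoord_mul (u : PSpace (Fin 2)) : (discCoord u).1 * (discCoord u).2 = 0 := by
  unfold discCoord
  split_ifs <;> simp

lemma continuousOn_discCoord : ContinuousOn discCoord (disc 1 0 ∪ disc 0 1) := by
  refine ContinuousOn.union_of_isOpen ?_ ?_ (isOpen_disc _ _) (isOpen_disc _ _)
  · refine ContinuousOn.congr ?_ fun u hu => discCoord_one hu
    exact ((continuousOn_pi.mp (continuousOn_chartCoord 1) 0).mono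
      (disc_subset_chart _ _)).prodMk continuousOn_const
  · refine ContinuousOn.congr ?_ fun u hu => discCoord_zero hu
    exact continuousOn_const.prodMk ((continuousOn_pi.mp (continuousOn_chartCoord 0) 1).mono
      (disc_subset_chart _ _))

/-- The union of the two axes of the plane. -/
def axes : Set (ℂ × ℂ) := {q | q.1 * q.2 = 0}

instance : ContractibleSpace axes := by
  refine StarConvex.contractibleSpace (x := 0) ?_ ⟨0, by simp [axes]⟩
  rw [starConvex_zero_iff]
  intro q hq t _ _
  simp only [axes, Set.mem_ofPred_eq, Prod.smul_fst, Prod.smul_snd, smul_mul_smul_comm]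
  rw [show q.1 * q.2 = 0 from hq, smul_zero]

/-- The height function on the projective line, as a sphere with poles the special points. -/
def height (u : PSpace (Fin 2)) : ℝ := ‖u.rep 0‖ ^ 2 / (‖u.rep 0‖ ^ 2 + ‖u.rep 1‖ ^ 2)

lemma height_mk {v : Fin 2 → ℂ} (hv : v ≠ 0) :
    height (Projectivization.mk ℂ v hv) = ‖v 0‖ ^ 2 / (‖v 0‖ ^ 2 + ‖v 1‖ ^ 2) := by
  obtain ⟨c, hc, h⟩ := exists_rep_mk hv
  have hc' : ‖c‖ ^ 2 ≠ 0 := by simpa using hc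
  simp only [height, h, Pi.smul_apply, smul_eq_mul, norm_mul, mul_pow, ← mul_add]
  rw [mul_div_mul_left _ _ hc']

lemma continuous_height : Continuous height := by
  rw [isOpenQuotientMap_mk.isQuotientMap.continuous_iff]
  have : height ∘ Projectivization.mk' ℂ = fun v : {v : Fin 2 → ℂ // v ≠ 0} =>
      ‖v.1 0‖ ^ 2 / (‖v.1 0‖ ^ 2 + ‖v.1 1‖ ^ 2) := funext fun v => height_mk v.2
  rw [this]
  have hc : ∀ i, Continuous fun v : {v : Fin 2 → ℂ // v ≠ 0} => ‖v.1 i‖ ^ 2 := fun i =>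
    ((continuous_apply i).comp continuous_subtype_val).norm.pow 2
  refine (hc 0).div ((hc 0).add (hc 1)) fun v h => v.2 ?_
  have h0 : ‖v.1 0‖ ^ 2 = 0 := by nlinarith [sq_nonneg ‖v.1 0‖, sq_nonneg ‖v.1 1‖]
  have h1 : ‖v.1 1‖ ^ 2 = 0 := by nlinarith [sq_nonneg ‖v.1 0‖, sq_nonneg ‖v.1 1‖]
  ext i
  fin_cases i
  · simpa using h0
  · simpa using h1

lemma height_pointOneZero : height pointOneZero = 1 := by
  rw [pointOneZero, height_mk]
  simp

lemma height_pointZeroOne : height pointZeroOne = 0 := by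
  rw [pointZeroOne, height_mk]
  simp

lemma coe_height_special {e : PSpace (Fin 2)} (he : e = pointOneZero ∨ e = pointZeroOne) :
    (height e : AddCircle (1 : ℝ)) = 0 := by
  rcases he with rfl | rfl
  · rw [height_pointOneZero]
    exact AddCircle.coe_period 1
  · rw [height_pointZeroOne]
    rfl

namespace IsPinching

variable {X : Type} [TopologicalSpace X] {σ : PSpace (Fin 2) → X} (hσ : IsPinching σ)

include hσ

lemma apply_pointZeroOne : σ pointZeroOne = σ pointOneZero :=
  (hσ.eq_iff _ _).mpr (.inr ⟨.inr rfl, .inl rfl⟩)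

lemma apply_eq_of {e : PSpace (Fin 2)} (he : e = pointOneZero ∨ e = pointZeroOne) :
    σ e = σ pointOneZero := by
  rcases he with rfl | rfl
  · rfl
  · exact hσ.apply_pointZeroOne

lemma isQuotientMap [T2Space X] : Topology.IsQuotientMap σ :=
  hσ.continuous.isClosedMap.isQuotientMap hσ.continuous hσ.surjective

open Classical in
/-- The map from the axes extending the coordinates of the discs. -/
def axesMap : C(axes, X) where
  toFun q := if q.1.2 = 0 then σ (Projectivization.mk ℂ ![q.1.1, 1] (vec_one_ne_zero _))
    else σ (Projectivization.mk ℂ ![1, q.1.2] (one_vec_ne_zero _))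
  continuous_toFun := by
    have h1 : IsClosed {q : axes | q.1.2 = 0} :=
      isClosed_eq (continuous_snd.comp continuous_subtype_val) continuous_const
    have h2 : IsClosed {q : axes | q.1.1 = 0} :=
      isClosed_eq (continuous_fst.comp continuous_subtype_val) continuous_const
    rw [← continuousOn_univ]
    have : (Set.univ : Set axes) = {q : axes | q.1.2 = 0} ∪ {q : axes | q.1.1 = 0} := by
      ext q
      have := mul_eq_zero.mp (show q.1.1 * q.1.2 = 0 from q.2)
      simpa using this.symm
    rw [this]
    -- The two axes are closed and meet at the origin, where the formulas agree because `σ`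
    -- identifies `[0:1]` and `[1:0]`.
    refine ContinuousOn.union_of_isClosed ?_ ?_ h1 h2
    · refine ContinuousOn.congr (f := fun q : axes =>
        σ (Projectivization.mk ℂ ![q.1.1, 1] (vec_one_ne_zero _))) ?_ fun q hq => if_pos hq
      exact (hσ.continuous.comp (continuous_mk (by fun_prop) _)).continuousOn
    · refine ContinuousOn.congr (f := fun q : axes =>
        σ (Projectivization.mk ℂ ![1, q.1.2] (one_vec_ne_zero _))) ?_ fun q hq => ?_
      · exact (hσ.continuous.comp (continuous_mk (by fun_prop) _)).continuousOn
      · split_ifs with h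
        · have hq' : q.1.1 = 0 := hq
          simp only [h, hq']
          exact hσ.apply_pointZeroOne
        · rfl

lemma axesMap_zero_right (z : ℂ) : hσ.axesMap ⟨(z, 0), by simp [axes]⟩ =
    σ (Projectivization.mk ℂ ![z, 1] (vec_one_ne_zero _)) := if_pos rfl

lemma axesMap_zero_left (z : ℂ) : hσ.axesMap ⟨(0, z), by simp [axes]⟩ =
    σ (Projectivization.mk ℂ ![1, z] (one_vec_ne_zero _)) := by
  by_cases hz : z = 0
  · subst hz
    rw [hσ.axesMap_zero_right]
    exact hσ.apply_pointZeroOne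
  · exact if_neg hz

/-- Both special points have coordinate `0`, so `discCoord` is constant on the fibres of `σ` and
descends to `X`. -/
lemma discCoord_surjInv (u : PSpace (Fin 2)) :
    discCoord (Function.surjInv hσ.surjective (σ u)) = discCoord u := by
  have h : ∀ e : PSpace (Fin 2), (e = pointOneZero ∨ e = pointZeroOne) → discCoord e = 0 := by
    rintro _ (rfl | rfl)
    · rw [discCoord_zero pointOneZero_mem_disc, pointOneZero, chartCoord_mk]
      simp
    · rw [discCoord_one pointZeroOne_mem_disc, pointZeroOne, chartCoord_mk]
      simp
  rcases (hσ.eq_iff _ _).mp (Function.surjInv_eq hσ.surjective (σ u)) with h' | ⟨h1, h2⟩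
  · rw [h']
  · rw [h _ h1, h _ h2]

/-- The union of the discs is saturated since it contains both identified points. Its image is
therefore an open neighbourhood of the node. -/
lemma preimage_image_discs : σ ⁻¹' (σ '' (disc 1 0 ∪ disc 0 1)) = disc 1 0 ∪ disc 0 1 := by
  refine subset_antisymm ?_ (Set.subset_preimage_image _ _)
  rintro u ⟨v, hv, h⟩
  rcases (hσ.eq_iff _ _).mp h with rfl | ⟨-, rfl | rfl⟩
  · exact hv
  · exact .inr pointOneZero_mem_disc
  · exact .inl pointZeroOne_mem_disc

lemma isOpen_image_discs [T2Space X] : IsOpen (σ '' (disc 1 0 ∪ disc 0 1)) := by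
  rw [← hσ.isQuotientMap.isOpen_preimage, hσ.preimage_image_discs]
  exact (isOpen_disc _ _).union (isOpen_disc _ _)

/-- Paths near the node with the same ends are homotopic. -/
lemma homotopic_of_mem_image_discs [T2Space X] {x y : X} {p q : Path x y}
    (hp : ∀ t, p t ∈ σ '' (disc 1 0 ∪ disc 0 1)) (hq : ∀ t, q t ∈ σ '' (disc 1 0 ∪ disc 0 1)) :
    p.Homotopic q := by
  let s : X → axes := fun x => ⟨discCoord (Function.surjInv hσ.surjective x), discCoord_mul _⟩
  have hs : ContinuousOn s (σ '' (disc 1 0 ∪ disc 0 1)) := by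
    rw [Topology.IsInducing.subtypeVal.continuousOn_iff,
      hσ.isQuotientMap.continuousOn_isOpen_iff hσ.isOpen_image_discs, hσ.preimage_image_discs]
    exact continuousOn_discCoord.congr fun u _ => hσ.discCoord_surjInv u
  refine homotopic_of_retract hs hσ.axesMap ?_ hp hq
  rintro _ ⟨u, hu, rfl⟩
  have hsu : s (σ u) = ⟨discCoord u, discCoord_mul u⟩ := Subtype.ext (hσ.discCoord_surjInv u)
  rw [hsu]
  rcases hu with hu | hu
  · simp_rw [discCoord_one hu, hσ.axesMap_zero_right]
    congr 1
    exact mk_chartCoord_one (disc_subset_chart _ _ hu)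
  · simp_rw [discCoord_zero hu, hσ.axesMap_zero_left]
    congr 1
    exact mk_chartCoord_zero (disc_subset_chart _ _ hu)

/-- The class of the image of a path in the projective line. -/
def imageClass (u v : PSpace (Fin 2)) : Path.Homotopic.Quotient (σ u) (σ v) :=
  .mk ((PathConnectedSpace.somePath u v).map hσ.continuous)

/-- Simple connectedness of `P^1` makes the class independent of the path chosen upstairs. -/
lemma imageClass_eq {u v : PSpace (Fin 2)} (c : Path u v) :
    hσ.imageClass u v = .mk (c.map hσ.continuous) :=
  Path.Homotopic.Quotient.eq.mpr
    ((SimplyConnectedSpace.paths_homotopic _ c).map ⟨σ, hσ.continuous⟩)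

lemma imageClass_trans (u v w : PSpace (Fin 2)) :
    (hσ.imageClass u v).trans (hσ.imageClass v w) = hσ.imageClass u w := by
  rw [hσ.imageClass_eq ((PathConnectedSpace.somePath u v).trans
    (PathConnectedSpace.somePath v w)), Path.map_trans, Path.Homotopic.Quotient.mk_trans]
  rfl

lemma imageClass_self (u : PSpace (Fin 2)) : hσ.imageClass u u = .refl _ := by
  rw [hσ.imageClass_eq (Path.refl u)]
  rfl

/-- The loop at the node obtained by joining the two special points of the projective line. -/
def nodeLoop : FundamentalGroup X (σ pointOneZero) :=
  (hσ.imageClass pointOneZero pointZeroOne).cast rfl hσ.apply_pointZeroOne.symm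

/-- The class of the image of a path starting at the node. -/
def fromNode (u : PSpace (Fin 2)) {x : X} (h : σ u = x) :
    Path.Homotopic.Quotient (σ pointOneZero) x :=
  (hσ.imageClass pointOneZero u).cast rfl h.symm

lemma fromNode_special {e : PSpace (Fin 2)} (he : e = pointOneZero ∨ e = pointZeroOne) :
    ∃ n : ℤ, hσ.fromNode e (hσ.apply_eq_of he) = (hσ.nodeLoop ^ n : FundamentalGroup X _) := by
  rcases he with rfl | rfl
  · refine ⟨0, ?_⟩
    rw [zpow_zero]
    exact hσ.imageClass_self _
  · exact ⟨1, (zpow_one (hσ.nodeLoop : FundamentalGroup X _)).symm⟩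

lemma exists_fromNode_eq {e e' : PSpace (Fin 2)} (he : e = pointOneZero ∨ e = pointZeroOne)
    (he' : e' = pointOneZero ∨ e' = pointZeroOne) {y : X} (h : σ e = y) (h' : σ e' = y) :
    ∃ n : ℤ, hσ.fromNode e h =
      Path.Homotopic.Quotient.trans (hσ.nodeLoop ^ n : FundamentalGroup X _)
        (hσ.fromNode e' h') := by
  obtain rfl : y = σ pointOneZero := h ▸ hσ.apply_eq_of he
  obtain ⟨i, hi⟩ := hσ.fromNode_special he
  obtain ⟨j, hj⟩ := hσ.fromNode_special he'
  refine ⟨i - j, ?_⟩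
  rw [hi, hj]
  change (hσ.nodeLoop ^ i : FundamentalGroup X _) =
    (hσ.nodeLoop ^ j : FundamentalGroup X _) * hσ.nodeLoop ^ (i - j)
  rw [← zpow_add, add_sub_cancel]

/-- The exponents found for consecutive pieces of a path add up; this is the concatenation step of
`exists_trans_eq`. -/
lemma trans_nodeLoop_zpow (m n : ℤ) {x : X}
    (c : Path.Homotopic.Quotient (σ pointOneZero) x) :
    Path.Homotopic.Quotient.trans (hσ.nodeLoop ^ m : FundamentalGroup X _)
      (Path.Homotopic.Quotient.trans (hσ.nodeLoop ^ n : FundamentalGroup X _) c) =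
    Path.Homotopic.Quotient.trans (hσ.nodeLoop ^ (m + n) : FundamentalGroup X _) c := by
  rw [← Path.Homotopic.Quotient.trans_assoc, add_comm, zpow_add]
  rfl

lemma fromNode_trans (u v : PSpace (Fin 2)) :
    (hσ.fromNode u rfl).trans (hσ.imageClass u v) = hσ.fromNode v rfl :=
  hσ.imageClass_trans _ _ _

/-- Up to the loop at the node, every path comes from the projective line. -/
theorem exists_trans_eq [T2Space X] {x y : X} (γ : Path.Homotopic.Quotient x y) :
    ∀ (u v : PSpace (Fin 2)) (hu : σ u = x) (hv : σ v = y), ∃ n : ℤ,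
      (hσ.fromNode u hu).trans γ =
        Path.Homotopic.Quotient.trans (hσ.nodeLoop ^ n : FundamentalGroup X _)
          (hσ.fromNode v hv) := by
  have hclosed : IsOpen ({σ pointOneZero}ᶜ : Set X) := isOpen_compl_singleton
  refine pathClass_induction (P := fun {x y} γ =>
    ∀ (u v : PSpace (Fin 2)) (hu : σ u = x) (hv : σ v = y), ∃ n : ℤ,
      (hσ.fromNode u hu).trans γ =
        Path.Homotopic.Quotient.trans (hσ.nodeLoop ^ n : FundamentalGroup X _)
          (hσ.fromNode v hv))
    (U := fun b : Bool => if b then {σ pointOneZero}ᶜ else σ '' (disc 1 0 ∪ disc 0 1))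
    ?_ ?_ ?_ ?_ γ
  · rintro (_ | _)
    · exact hσ.isOpen_image_discs
    · exact hclosed
  · intro x
    by_cases hx : x = σ pointOneZero
    · exact ⟨false, pointOneZero, .inr pointOneZero_mem_disc, hx.symm⟩
    · exact ⟨true, hx⟩
  · rintro (_ | _) x y γ hγ u v rfl rfl
    -- Near the node, `γ` is replaced by the image of a path from `u` to a special point followed by
    -- one from a special point to `v`. The exponent `n` accounts for the two special points
    -- possibly being different.
    · have hmem : ∀ w, σ w ∈ σ '' (disc 1 0 ∪ disc 0 1) → w ∈ disc 1 0 ∪ disc 0 1 := fun w hw => by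
        rw [← hσ.preimage_image_discs]
        exact hw
      have hu := hmem u (by simpa using hγ 0)
      have hv := hmem v (by simpa using hγ 1)
      obtain ⟨e, c, he, hc⟩ := exists_path_in_discs hu
      obtain ⟨e', c', he', hc'⟩ := exists_path_in_discs hv
      have hee : σ e = σ e' := by rw [hσ.apply_eq_of he, hσ.apply_eq_of he']
      let γ' : Path (σ u) (σ v) := (c.map hσ.continuous).trans
        ((c'.map hσ.continuous).symm.cast hee rfl)
      have hγ' : γ.Homotopic γ' := by
        refine hσ.homotopic_of_mem_image_discs hγ fun t => ?_
        rw [Path.trans_apply]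
        split_ifs
        · exact ⟨_, hc _, rfl⟩
        · exact ⟨_, hc' _, rfl⟩
      obtain ⟨n, hn⟩ := hσ.exists_fromNode_eq he he' rfl hee.symm
      refine ⟨n, ?_⟩
      have h1 : (Path.Homotopic.Quotient.mk γ : Path.Homotopic.Quotient (σ u) (σ v)) =
          .mk γ' := Path.Homotopic.Quotient.eq.mpr hγ'
      have h2 : ∀ {y : X} (h : σ e' = y), (hσ.fromNode e' h).trans
          (.mk ((c'.map hσ.continuous).symm.cast h.symm rfl)) = hσ.fromNode v rfl := by
        rintro _ rfl
        rw [← hσ.fromNode_trans e' v, hσ.imageClass_eq c'.symm]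
        rfl
      rw [h1, Path.Homotopic.Quotient.mk_trans, ← Path.Homotopic.Quotient.trans_assoc,
        ← hσ.imageClass_eq c, hσ.fromNode_trans, hn, Path.Homotopic.Quotient.trans_assoc, h2]
    -- Away from the node `σ` is injective with continuous inverse, so `γ` lifts to `P^1` and the
    -- exponent is `0`.
    · have hγ' : ∀ t, γ t ≠ σ pointOneZero := fun t => by simpa using hγ t
      have hτ : ∀ w, σ w ≠ σ pointOneZero → Function.surjInv hσ.surjective (σ w) = w := by
        intro w hw
        rcases (hσ.eq_iff _ _).mp (Function.surjInv_eq hσ.surjective (σ w)) with h | ⟨-, h⟩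
        · exact h
        · exact absurd (hσ.apply_eq_of h) hw
      have hcont : ContinuousOn (Function.surjInv hσ.surjective) {σ pointOneZero}ᶜ := by
        rw [hσ.isQuotientMap.continuousOn_isOpen_iff hclosed]
        exact continuousOn_id.congr fun w hw => hτ w hw
      let δ : Path u v :=
        { toFun := fun t => Function.surjInv hσ.surjective (γ t)
          continuous_toFun := hcont.comp_continuous γ.continuous fun t => hγ' t
          source' := by simpa using hτ u (by simpa using hγ' 0)
          target' := by simpa using hτ v (by simpa using hγ' 1) }
      have hδ : γ = δ.map hσ.continuous := by
        ext t
        exact (Function.surjInv_eq hσ.surjective (γ t)).symm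
      refine ⟨0, ?_⟩
      rw [hδ, ← hσ.imageClass_eq, hσ.fromNode_trans, zpow_zero]
      exact (Path.Homotopic.Quotient.refl_trans _).symm
  · intro x y z a b ha hb u w hu hw
    obtain ⟨v, hv⟩ := hσ.surjective y
    obtain ⟨m, hm⟩ := ha u v hu hv
    obtain ⟨n, hn⟩ := hb v w hv hw
    refine ⟨m + n, ?_⟩
    rw [← Path.Homotopic.Quotient.trans_assoc, hm, Path.Homotopic.Quotient.trans_assoc, hn,
      hσ.trans_nodeLoop_zpow]

lemma exists_eq_nodeLoop_zpow [T2Space X] (γ : FundamentalGroup X (σ pointOneZero)) :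
    ∃ n : ℤ, γ = hσ.nodeLoop ^ n := by
  obtain ⟨n, hn⟩ := hσ.exists_trans_eq γ pointOneZero pointOneZero rfl rfl
  refine ⟨n, ?_⟩
  have h : hσ.fromNode pointOneZero rfl = .refl _ := hσ.imageClass_self _
  rwa [h, Path.Homotopic.Quotient.refl_trans, Path.Homotopic.Quotient.trans_refl] at hn

/-- The heights `1` and `0` of the identified points agree modulo 1, so the height becomes a map
from the quotient `X` to the circle. -/
lemma exists_height [T2Space X] :
    ∃ F : C(X, AddCircle (1 : ℝ)), ∀ u, F (σ u) = (height u : AddCircle (1 : ℝ)) := by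
  have hc : Continuous fun u => (height u : AddCircle (1 : ℝ)) :=
    (AddCircle.continuous_mk' 1).comp continuous_height
  let G : C(PSpace (Fin 2), AddCircle (1 : ℝ)) := ⟨_, hc⟩
  have hq : Topology.IsQuotientMap (⟨σ, hσ.continuous⟩ : C(_, X)) := hσ.isQuotientMap
  have hG : Function.FactorsThrough G (⟨σ, hσ.continuous⟩ : C(_, X)) := fun u v h => by
    rcases (hσ.eq_iff _ _).mp h with rfl | ⟨h1, h2⟩
    · rfl
    · exact (coe_height_special h1).trans (coe_height_special h2).symm
  exact ⟨hq.lift G hG, fun u => DFunLike.congr_fun (hq.lift_comp G hG) u⟩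

/-- The image of `nodeLoop` in the circle lifts to the real height, which runs from `1` to `0`. Its
monodromy is translation by `-1`, of infinite order in the deck group of `ℝ → ℝ/ℤ`. -/
lemma nodeLoop_zpow_eq_one [T2Space X] {n : ℤ}
    (h : (hσ.nodeLoop ^ n : FundamentalGroup X _) = 1) : n = 0 := by
  obtain ⟨F, hF⟩ := hσ.exists_height
  have hcov := AddCircle.isAddQuotientCoveringMap_coe (1 : ℝ)
  let e : ((↑) : ℝ → AddCircle (1 : ℝ)) ⁻¹' {F (σ pointOneZero)} :=
    ⟨height pointOneZero, (hF _).symm⟩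
  let e' : ((↑) : ℝ → AddCircle (1 : ℝ)) ⁻¹' {F (σ pointOneZero)} :=
    ⟨height pointZeroOne, by
      rw [Set.mem_preimage, Set.mem_singleton_iff, ← hF, hσ.apply_pointZeroOne]⟩
  let φ := (hcov.fundamentalGroupToMulOpposite e).comp (FundamentalGroup.map F (σ pointOneZero))
  have hmon : hcov.isCoveringMap.monodromy
      (FundamentalGroup.map F (σ pointOneZero) hσ.nodeLoop) e = e' := by
    refine hcov.isCoveringMap.monodromy_eq_of_map_eq (ex := e) (ey := e') (.mk
      ((PathConnectedSpace.somePath pointOneZero pointZeroOne).map continuous_height)) ?_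
    change Path.Homotopic.Quotient.mk _ = Path.Homotopic.Quotient.mk _
    congr 1
    ext t
    exact (hF _).symm
  have hφ := (hcov.fundamentalGroupToMulOpposite_apply_eq_Iff (e := e)).mp
    (rfl : hcov.fundamentalGroupToMulOpposite e
      (FundamentalGroup.map F (σ pointOneZero) hσ.nodeLoop) = φ hσ.nodeLoop)
  rw [hmon] at hφ
  have hn : φ hσ.nodeLoop ^ n = 1 := by rw [← map_zpow, h, map_one]
  set g := φ hσ.nodeLoop
  have hg : ((Multiplicative.toAdd g.unop : AddSubgroup.zmultiples (1 : ℝ)) : ℝ) +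
      height pointOneZero = height pointZeroOne := hφ
  rw [height_pointOneZero, height_pointZeroOne] at hg
  have hn' : n • Multiplicative.toAdd g.unop = 0 := by
    rw [← toAdd_zpow, ← MulOpposite.unop_zpow, hn]
    rfl
  have hn'' := congrArg (Subtype.val : AddSubgroup.zmultiples (1 : ℝ) → ℝ) hn'
  rw [AddSubgroup.coe_zsmul, eq_neg_of_add_eq_zero_left hg] at hn''
  simpa using hn''

/-- The fundamental group of a pinched sphere is infinite cyclic. -/
theorem nonempty_fundamentalGroup_mulEquiv [T2Space X] :
    Nonempty (FundamentalGroup X (σ pointOneZero) ≃* Multiplicative ℤ) := by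
  let f : Multiplicative ℤ →* FundamentalGroup X (σ pointOneZero) := zpowersHom _ hσ.nodeLoop
  have hf : ∀ n, f n = (hσ.nodeLoop ^ n.toAdd : FundamentalGroup X _) := fun n => zpowersHom_apply (α := FundamentalGroup X (σ pointOneZero)) _ n
  refine ⟨(MulEquiv.ofBijective f ⟨?_, fun γ => ?_⟩).symm⟩
  · rw [injective_iff_map_eq_one]
    intro n hn
    exact hσ.nodeLoop_zpow_eq_one ((hf n).symm.trans hn)
  · obtain ⟨n, hn⟩ := hσ.exists_eq_nodeLoop_zpow γ
    exact ⟨.ofAdd n, (hf _).trans hn.symm⟩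

end IsPinching
end
end ProjVar

/-! ### Homogeneous polynomials, the Zariski topology, irreducibility and dimension from a cone
parametrization. -/

namespace ProjVar
noncomputable section

open CategoryTheory MvPolynomial

section Homogeneous

variable {R S : Type*} [CommSemiring R] [CommSemiring S] {ι : Type*}

lemma eval₂_smul_of_isHomogeneous {F : MvPolynomial ι R} {d : ℕ} (hF : F.IsHomogeneous d)
    (f : R →+* S) (c : S) (v : ι → S) : eval₂ f (c • v) F = c ^ d * eval₂ f v F := by
  rw [eval₂_eq, eval₂_eq, Finset.mul_sum]
  refine Finset.sum_congr rfl fun m hm => ?_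
  have hd : ∑ i ∈ m.support, m i = d := by
    have := hF (mem_support_iff.mp hm)
    rwa [Finsupp.weight_apply, Finsupp.sum, Finset.sum_congr rfl fun i _ => by
      rw [Pi.one_apply, smul_eq_mul, mul_one]] at this
  simp only [Pi.smul_apply, smul_eq_mul, mul_pow, Finset.prod_mul_distrib,
    Finset.prod_pow_eq_pow_sum, hd]
  ring

lemma eval_smul_of_isHomogeneous {F : MvPolynomial ι R} {d : ℕ} (hF : F.IsHomogeneous d)
    (c : R) (v : ι → R) : eval (c • v) F = c ^ d * eval v F :=
  eval₂_smul_of_isHomogeneous hF (RingHom.id R) c v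

lemma eval_aeval {R : Type*} [CommSemiring R] {ι τ : Type*} (a : τ → R)
    (Φ : ι → MvPolynomial τ R) (F : MvPolynomial ι R) :
    eval a (aeval Φ F) = eval (fun i => eval a (Φ i)) F := by
  have : (eval a).comp (aeval Φ : MvPolynomial ι R →ₐ[R] MvPolynomial τ R).toRingHom =
      eval fun i => eval a (Φ i) := by
    ext <;> simp
  exact RingHom.congr_fun this F

end Homogeneous

section Zariski

variable {ι : Type}

lemma mk_mem_zeroLocus {F : MvPolynomial ι ℂ} {d : ℕ} (hF : F.IsHomogeneous d) {v : ι → ℂ}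
    (hv : v ≠ 0) : Projectivization.mk ℂ v hv ∈ zeroLocus F ↔ eval v F = 0 := by
  obtain ⟨c, hc, h⟩ := exists_rep_mk hv
  simp [zeroLocus, h, eval_smul_of_isHomogeneous hF, hc]

lemma isClosed_zeroLocus {F : MvPolynomial ι ℂ} {d : ℕ} (hF : F.IsHomogeneous d) :
    IsClosed[zariski ι] (zeroLocus F) := by
  let := zariski ι
  rw [← isOpen_compl_iff]
  exact TopologicalSpace.isOpen_generateFrom_of_mem ⟨F, d, hF, rfl⟩

lemma isTopologicalBasis_zariski : @TopologicalSpace.IsTopologicalBasis (PSpace ι) (zariski ι)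
    {U | ∃ (F : MvPolynomial ι ℂ) (d : ℕ), F.IsHomogeneous d ∧ U = (zeroLocus F)ᶜ} := by
  let := zariski ι
  refine TopologicalSpace.isTopologicalBasis_of_subbasis_of_finiteInter rfl ⟨?_, ?_⟩
  · refine ⟨1, 0, isHomogeneous_one _ _, ?_⟩
    ext x
    simp [zeroLocus]
  · rintro _ ⟨F, d, hF, rfl⟩ _ ⟨G, e, hG, rfl⟩
    refine ⟨F * G, d + e, hF.mul hG, ?_⟩
    ext x
    simp [zeroLocus]

/-- A polynomial parametrization of the affine cone over `X`. -/
def IsConeParam {τ : Type} (X : Set (PSpace ι)) (Φ : ι → MvPolynomial τ ℂ) : Prop :=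
  affineCone X = Set.range fun (a : τ → ℂ) i => eval a (Φ i)

lemma mem_affineCone_rep {X : Set (PSpace ι)} {x : PSpace ι} (hx : x ∈ X) :
    x.rep ∈ affineCone X := fun _ => by rwa [x.mk_rep]

variable {τ : Type} {X : Set (PSpace ι)} {Φ : ι → MvPolynomial τ ℂ}

/-- Basic open sets meeting `X` pull back to nonzero polynomials in the parameters. Their product is
nonzero in the polynomial ring, hence nonzero at some parameter value. -/
lemma IsConeParam.isIrreducible (h : IsConeParam X Φ) (hX : X.Nonempty) :
    @IsIrreducible (PSpace ι) (zariski ι) X := by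
  let := zariski ι
  refine ⟨hX, fun U V hU hV ⟨x, hxX, hxU⟩ ⟨y, hyX, hyV⟩ => ?_⟩
  have key : ∀ (z : PSpace ι), z ∈ X → ∀ F : MvPolynomial ι ℂ, z ∉ zeroLocus F →
      aeval Φ F ≠ 0 := by
    intro z hz F hzF h0
    obtain ⟨a, ha⟩ := h.subset (mem_affineCone_rep hz)
    refine hzF ?_
    rw [zeroLocus, Set.mem_ofPred_eq, ← ha]
    dsimp only
    rw [← eval_aeval, h0, map_zero]
  obtain ⟨_, ⟨F, d, hF, rfl⟩, hxF, hFU⟩ :=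
    isTopologicalBasis_zariski.exists_subset_of_mem_open hxU hU
  obtain ⟨_, ⟨G, e, hG, rfl⟩, hyG, hGV⟩ :=
    isTopologicalBasis_zariski.exists_subset_of_mem_open hyV hV
  obtain ⟨i, hi⟩ := Function.ne_iff.mp x.rep_nonzero
  -- The extra factor, a coordinate, guarantees that the cone point found is not the origin and so
  -- defines a point of projective space.
  have hne : aeval Φ (F * G * MvPolynomial.X i) ≠ 0 := by
    rw [map_mul, map_mul]
    refine mul_ne_zero (mul_ne_zero (key x hxX F hxF) (key y hyX G hyG)) (key x hxX _ ?_)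
    simpa [zeroLocus] using hi
  obtain ⟨a, ha⟩ : ∃ a, eval a (aeval Φ (F * G * MvPolynomial.X i)) ≠ 0 := by
    by_contra! hcon
    exact hne (funext fun a => by rw [hcon, map_zero])
  rw [eval_aeval, map_mul, map_mul, eval_X] at ha
  have hv : (fun i => eval a (Φ i)) ≠ 0 := fun h0 => right_ne_zero_of_mul ha (congrFun h0 i)
  refine ⟨Projectivization.mk ℂ _ hv, h.superset ⟨a, rfl⟩ hv, hFU ?_, hGV ?_⟩
  · rw [Set.mem_compl_iff, mk_mem_zeroLocus hF]
    exact left_ne_zero_of_mul (left_ne_zero_of_mul ha)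
  · rw [Set.mem_compl_iff, mk_mem_zeroLocus hG]
    exact right_ne_zero_of_mul (left_ne_zero_of_mul ha)

/-- A polynomial vanishes on the cone exactly when its pullback is the zero function, and over `ℂ` a
polynomial is determined by its values. Thus the coordinate ring is the range of `aeval Φ`. -/
lemma IsConeParam.vanishingIdeal_eq (h : IsConeParam X Φ) :
    vanishingIdeal ℂ (affineCone X) = RingHom.ker (aeval (R := ℂ) Φ) := by
  ext F
  rw [mem_vanishingIdeal_iff, RingHom.mem_ker, h]
  constructor
  · intro hF
    refine funext fun a => ?_
    rw [eval_aeval, ← aeval_eq_eval, hF _ ⟨a, rfl⟩, map_zero]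
  · rintro hF _ ⟨a, rfl⟩
    rw [aeval_eq_eval]
    exact (eval_aeval a Φ F).symm.trans (by rw [hF, map_zero])

lemma trdeg_subalgebra_eq {τ : Type} [Fintype τ] (B : Subalgebra ℂ (MvPolynomial τ ℂ))
    (halg : ∀ i, IsAlgebraic B (MvPolynomial.X i : MvPolynomial τ ℂ)) :
    Algebra.trdeg ℂ B = Fintype.card τ := by
  have : Algebra.IsAlgebraic B (MvPolynomial τ ℂ) := by
    refine ⟨fun q => ?_⟩
    induction q using MvPolynomial.induction_on with
    | C a => exact isAlgebraic_algebraMap (algebraMap ℂ B a)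
    | add p q hp hq => exact hp.add hq
    | mul_X p i hp => exact hp.mul (halg i)
  have : FaithfulSMul ℂ B := (faithfulSMul_iff_algebraMap_injective _ _).mpr
    (algebraMap ℂ B).injective
  have hdeg := trdeg_add_eq ℂ B (A := MvPolynomial τ ℂ)
  rw [trdeg_eq_zero (R := B), add_zero, MvPolynomial.trdeg_of_isDomain] at hdeg
  rw [hdeg, Cardinal.mk_fintype, Cardinal.lift_id]

/-- The dimension of a variety whose affine cone is parametrized by polynomials over which the
coordinates are algebraic. -/
lemma IsConeParam.hasDimension [Fintype τ] (h : IsConeParam X Φ) {n : ℕ}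
    (hn : Fintype.card τ = n + 1)
    (halg : ∀ i, IsAlgebraic (aeval (R := ℂ) Φ).range (MvPolynomial.X i : MvPolynomial τ ℂ)) :
    HasDimension X n := by
  rw [HasDimension, ← hn, ← trdeg_subalgebra_eq _ halg]
  refine AlgEquiv.trdeg_eq ((Ideal.quotientEquivAlgOfEq ℂ h.vanishingIdeal_eq).trans ?_)
  exact Ideal.quotientKerEquivRange (aeval (R := ℂ) Φ)

end Zariski

end
end ProjVar

/-! ### The model nodal cubic and its parametrization. -/

namespace ProjVar
noncomputable section

open CategoryTheory MvPolynomial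

lemma mk_eq_special_iff {w : Fin 2 → ℂ} (hw : w ≠ 0) :
    (Projectivization.mk ℂ w hw = pointOneZero ∨ Projectivization.mk ℂ w hw = pointZeroOne) ↔
      w 0 * w 1 = 0 := by
  rw [pointOneZero, pointZeroOne, Projectivization.mk_eq_mk_iff', Projectivization.mk_eq_mk_iff',
    mul_eq_zero, or_comm]
  refine or_congr ⟨?_, fun h => ⟨w 1, ?_⟩⟩ ⟨?_, fun h => ⟨w 0, ?_⟩⟩
  · rintro ⟨a, rfl⟩
    simp
  · ext i
    fin_cases i <;> simp [h]
  · rintro ⟨a, rfl⟩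
    simp
  · ext i
    fin_cases i <;> simp [h]

lemma scaleVec_ne_zero (t : ℂˣ) {w : Fin 2 → ℂ} (hw : w ≠ 0) : ![(t : ℂ) * w 0, w 1] ≠ 0 := by
  intro h
  refine hw (funext fun i => ?_)
  have h0 := congrFun h 0
  have h1 := congrFun h 1
  fin_cases i
  · simpa using h0
  · simpa using h1

lemma scale_mk (t : ℂˣ) {w : Fin 2 → ℂ} (hw : w ≠ 0) :
    scale t (Projectivization.mk ℂ w hw) =
      Projectivization.mk ℂ ![(t : ℂ) * w 0, w 1] (scaleVec_ne_zero t hw) := by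
  rw [scale, Projectivization.map_mk]
  congr 1
  ext i
  fin_cases i <;> simp [Matrix.mulVec_diagonal]

lemma scale_eq_self_iff (x : PSpace (Fin 2)) :
    (∀ t, scale t x = x) ↔ x = pointOneZero ∨ x = pointZeroOne := by
  induction x using Projectivization.ind with
  | h w hw =>
    rw [mk_eq_special_iff]
    constructor
    · intro h
      have h2 := h (Units.mk0 2 two_ne_zero)
      rw [scale_mk, Projectivization.mk_eq_mk_iff'] at h2
      obtain ⟨a, ha⟩ := h2
      have h0 := congrFun ha 0
      have h1 := congrFun ha 1
      simp only [Pi.smul_apply, smul_eq_mul, Units.val_mk0, Matrix.cons_val_zero,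
        Matrix.cons_val_one] at h0 h1
      linear_combination w 0 * h1 - w 1 * h0
    · intro h t
      rw [scale_mk]
      rcases mul_eq_zero.mp h with h | h
      · refine mk_eq_mk _ _ (c := 1) ?_
        ext i
        fin_cases i <;> simp [h]
      · refine mk_eq_mk _ _ (c := t) ?_
        ext i
        fin_cases i <;> simp [h]

lemma scale_one (x : PSpace (Fin 2)) : scale 1 x = x := by
  induction x using Projectivization.ind with
  | h w hw =>
    rw [scale_mk]
    refine mk_eq_mk _ _ (c := 1) ?_
    ext i
    fin_cases i <;> simp

lemma scale_mul (s t : ℂˣ) (x : PSpace (Fin 2)) : scale (s * t) x = scale s (scale t x) := by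
  induction x using Projectivization.ind with
  | h w hw =>
    rw [scale_mk, scale_mk, scale_mk]
    refine mk_eq_mk _ _ (c := 1) ?_
    ext i
    fin_cases i <;> simp [mul_assoc]

lemma scale_special (t : ℂˣ) {x : PSpace (Fin 2)} (hx : x = pointOneZero ∨ x = pointZeroOne) :
    scale t x = x := (scale_eq_self_iff x).mpr hx t

/-- The parametrization of the nodal cubic `x y z = x ^ 3 + y ^ 3`. -/
def nodalParam (w : Fin 2 → ℂ) : Fin 3 → ℂ :=
  ![w 0 ^ 2 * w 1, w 0 * w 1 ^ 2, w 0 ^ 3 + w 1 ^ 3]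

lemma nodalParam_ne_zero {w : Fin 2 → ℂ} (hw : w ≠ 0) : nodalParam w ≠ 0 := by
  intro h
  have h0 : w 0 ^ 2 * w 1 = 0 := congrFun h 0
  have h2 : w 0 ^ 3 + w 1 ^ 3 = 0 := congrFun h 2
  refine hw (funext fun i => ?_)
  rcases mul_eq_zero.mp h0 with h0 | h0
  · have h0 : w 0 = 0 := by simpa using h0
    have h1 : w 1 = 0 := by simpa [h0] using h2
    fin_cases i <;> assumption
  · have h1 : w 0 = 0 := by simpa [h0] using h2
    fin_cases i <;> assumption

lemma nodalParam_smul (c : ℂ) (w : Fin 2 → ℂ) :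
    nodalParam (c • w) = c ^ 3 • nodalParam w := by
  ext i
  fin_cases i <;> simp [nodalParam] <;> ring

lemma nodalParam_relation (w : Fin 2 → ℂ) :
    nodalParam w 0 * nodalParam w 1 * nodalParam w 2 - nodalParam w 0 ^ 3 - nodalParam w 1 ^ 3
      = 0 := by
  simp [nodalParam]
  ring

/-- The parameter is the slope `s = y 0 / y 1` of the line through the node. At the node itself `s =
0` serves, so the affine part `[s:1]` of `P^1` already covers the curve. -/
lemma exists_eq_smul_nodalParam {y : Fin 3 → ℂ} (hy : y 0 * y 1 * y 2 - y 0 ^ 3 - y 1 ^ 3 = 0) :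
    ∃ k s : ℂ, y = k • nodalParam ![s, 1] := by
  by_cases h0 : y 0 = 0
  · have h1 : y 1 = 0 := by simpa [h0] using hy
    refine ⟨y 2, 0, ?_⟩
    ext i
    fin_cases i <;> simp [nodalParam, h0, h1]
  · have h1 : y 1 ≠ 0 := fun h => h0 (by simpa [h] using hy)
    refine ⟨y 1 ^ 2 / y 0, y 0 / y 1, ?_⟩
    ext i
    fin_cases i
    · simp [nodalParam]
      field_simp
    · simp [nodalParam]
      field_simp
    · simp [nodalParam]
      field_simp
      linear_combination hy

lemma exists_eq_nodalParam {y : Fin 3 → ℂ} (hy : y 0 * y 1 * y 2 - y 0 ^ 3 - y 1 ^ 3 = 0) :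
    ∃ w, y = nodalParam w := by
  obtain ⟨k, s, rfl⟩ := exists_eq_smul_nodalParam hy
  -- The parametrization has degree 3, so a cube root of the scalar is absorbed into the parameter.
  obtain ⟨r, hr⟩ := IsAlgClosed.exists_pow_nat_eq k (n := 3) (by norm_num)
  exact ⟨r • ![s, 1], by rw [nodalParam_smul, hr]⟩

/-- Two points of the projective line with the same image are equal or both special. -/
lemma mk_eq_or_of_nodalParam_eq {w w' : Fin 2 → ℂ} (hw : w ≠ 0) (hw' : w' ≠ 0) {k : ℂ}
    (h : nodalParam w = k • nodalParam w') :
    Projectivization.mk ℂ w hw = Projectivization.mk ℂ w' hw' ∨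
      (w 0 * w 1 = 0 ∧ w' 0 * w' 1 = 0) := by
  have hk : k ≠ 0 := by
    rintro rfl
    exact nodalParam_ne_zero hw (by rw [h, zero_smul])
  have h0 : w 0 ^ 2 * w 1 = k * (w' 0 ^ 2 * w' 1) := congrFun h 0
  have h1 : w 0 * w 1 ^ 2 = k * (w' 0 * w' 1 ^ 2) := congrFun h 1
  by_cases hp : w 0 * w 1 = 0
  · refine .inr ⟨hp, ?_⟩
    have h0' : w' 0 ^ 2 * w' 1 = 0 := by
      refine (mul_eq_zero.mp ?_).resolve_left hk
      rw [← h0]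
      linear_combination w 0 * hp
    simpa using h0'
  · left
    have hw0 := left_ne_zero_of_mul hp
    have hw1 := right_ne_zero_of_mul hp
    have hw0' : w' 0 ≠ 0 := fun h => by simp [h, hw0, hw1] at h0
    have hw1' : w' 1 ≠ 0 := fun h => by simp [h, hw0, hw1] at h0
    have hc : w 0 * w' 1 = w 1 * w' 0 := by
      have : (w 0 * w 1 * (k * (w' 0 * w' 1))) * (w 0 * w' 1 - w 1 * w' 0) = 0 := by
        linear_combination (k * w' 0 * w' 1 ^ 2) * h0 - (k * w' 0 ^ 2 * w' 1) * h1
      exact sub_eq_zero.mp ((mul_eq_zero.mp this).resolve_left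
        (mul_ne_zero hp (mul_ne_zero hk (mul_ne_zero hw0' hw1'))))
    refine mk_eq_mk _ _ (c := w 1 / w' 1) ?_
    ext i
    fin_cases i
    · simp
      field_simp
      exact hc
    · simp [hw1']

/-- `F` is the nodal cubic form `c (x y z - x ^ 3 - y ^ 3)` in the coordinates given by `A`. -/
structure IsNodalForm (F : MvPolynomial (Fin 3) ℂ) (A : (Fin 3 → ℂ) ≃ₗ[ℂ] (Fin 3 → ℂ)) (c : ℂ) :
    Prop where
  homogeneous : F.IsHomogeneous 3
  ne_zero : c ≠ 0
  eval_eq : ∀ y, eval (A y) F = c * (y 0 * y 1 * y 2 - y 0 ^ 3 - y 1 ^ 3)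

/-- The normalization of a nodal cubic. -/
def nodalMap (A : (Fin 3 → ℂ) ≃ₗ[ℂ] (Fin 3 → ℂ)) (u : PSpace (Fin 2)) : PSpace (Fin 3) :=
  Projectivization.mk ℂ (A (nodalParam u.rep))
    (A.map_ne_zero_iff.mpr (nodalParam_ne_zero u.rep_nonzero))

lemma nodalMap_mk (A : (Fin 3 → ℂ) ≃ₗ[ℂ] (Fin 3 → ℂ)) {w : Fin 2 → ℂ} (hw : w ≠ 0) :
    nodalMap A (Projectivization.mk ℂ w hw) = Projectivization.mk ℂ (A (nodalParam w))
      (A.map_ne_zero_iff.mpr (nodalParam_ne_zero hw)) := by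
  obtain ⟨c, hc, h⟩ := exists_rep_mk hw
  refine mk_eq_mk _ _ (c := c ^ 3) ?_
  rw [h, nodalParam_smul, map_smul]

lemma nodalMap_eq_iff (A : (Fin 3 → ℂ) ≃ₗ[ℂ] (Fin 3 → ℂ)) (u v : PSpace (Fin 2)) :
    nodalMap A u = nodalMap A v ↔ u = v ∨
      ((u = pointOneZero ∨ u = pointZeroOne) ∧ (v = pointOneZero ∨ v = pointZeroOne)) := by
  induction u using Projectivization.ind with
  | h w hw =>
    induction v using Projectivization.ind with
    | h w' hw' =>
      rw [mk_eq_special_iff, mk_eq_special_iff, nodalMap_mk, nodalMap_mk]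
      constructor
      · rw [Projectivization.mk_eq_mk_iff']
        rintro ⟨k, hk⟩
        rw [← map_smul] at hk
        exact mk_eq_or_of_nodalParam_eq hw hw' (A.injective hk).symm
      · rintro (h | ⟨h, h'⟩)
        · rw [← nodalMap_mk A hw, ← nodalMap_mk A hw', h]
        · have key : ∀ x : Fin 2 → ℂ, x 0 * x 1 = 0 →
              nodalParam x = (x 0 ^ 3 + x 1 ^ 3) • ![0, 0, 1] := by
            intro x hx
            ext i
            fin_cases i
            · simpa [nodalParam] using hx
            · simpa [nodalParam] using hx
            · simp [nodalParam]
          have hne : w' 0 ^ 3 + w' 1 ^ 3 ≠ 0 := fun h0 =>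
            nodalParam_ne_zero hw' (by rw [key w' h', h0, zero_smul])
          refine mk_eq_mk _ _ (c := (w 0 ^ 3 + w 1 ^ 3) / (w' 0 ^ 3 + w' 1 ^ 3)) ?_
          rw [← map_smul, key w h, key w' h', smul_smul, div_mul_cancel₀ _ hne]

lemma continuous_nodalMap (A : (Fin 3 → ℂ) ≃ₗ[ℂ] (Fin 3 → ℂ)) : Continuous (nodalMap A) := by
  rw [isOpenQuotientMap_mk.isQuotientMap.continuous_iff]
  have : nodalMap A ∘ Projectivization.mk' ℂ = fun w : {w : Fin 2 → ℂ // w ≠ 0} =>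
      Projectivization.mk ℂ (A (nodalParam w.1))
        (A.map_ne_zero_iff.mpr (nodalParam_ne_zero w.2)) := funext fun w => nodalMap_mk A w.2
  rw [this]
  refine continuous_mk ?_ _
  refine A.toLinearMap.continuous_of_finiteDimensional.comp (continuous_pi fun i => ?_)
  have h : ∀ i, Continuous fun w : {w : Fin 2 → ℂ // w ≠ 0} => w.1 i := fun i =>
    (continuous_apply i).comp continuous_subtype_val
  fin_cases i
  · exact ((h 0).pow 2).mul (h 1)
  · exact (h 0).mul ((h 1).pow 2)
  · exact ((h 0).pow 3).add ((h 1).pow 3)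

end
end ProjVar

/-! ### The normalization and the algebraic action on a nodal cubic. -/

namespace ProjVar
noncomputable section

open CategoryTheory MvPolynomial

section LinComb

variable {R : Type} [CommRing R] [Algebra ℂ R] {τ : Type}

/-- The combinations of polynomials with the coefficients of the matrix of a linear map. -/
def linComb (A : (Fin 3 → ℂ) →ₗ[ℂ] (Fin 3 → ℂ)) (Q : Fin 3 → MvPolynomial τ R) (i : Fin 3) :
    MvPolynomial τ R :=
  ∑ k, C (algebraMap ℂ R (A (fun j => if k = j then 1 else 0) i)) * Q k

lemma eval₂_linComb (A : (Fin 3 → ℂ) →ₗ[ℂ] (Fin 3 → ℂ)) (Q : Fin 3 → MvPolynomial τ R)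
    {f : R →+* ℂ} (hf : ∀ a, f (algebraMap ℂ R a) = a) (v : τ → ℂ) :
    (fun i => eval₂ f v (linComb A Q i)) = A fun k => eval₂ f v (Q k) := by
  ext i
  rw [LinearMap.pi_apply_eq_sum_univ A, linComb, eval₂_sum, Finset.sum_apply]
  refine Finset.sum_congr rfl fun k _ => ?_
  rw [eval₂_mul, eval₂_C, hf, Pi.smul_apply, smul_eq_mul, mul_comm]

lemma eval_linComb (A : (Fin 3 → ℂ) →ₗ[ℂ] (Fin 3 → ℂ)) (Q : Fin 3 → MvPolynomial τ ℂ)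
    (v : τ → ℂ) : (fun i => eval v (linComb A Q i)) = A fun k => eval v (Q k) :=
  eval₂_linComb A Q (f := RingHom.id ℂ) (fun _ => rfl) v

lemma evalAt_linComb (A : (Fin 3 → ℂ) →ₗ[ℂ] (Fin 3 → ℂ))
    (Q : Fin 3 → MvPolynomial τ (Polynomial ℂ)) (t : ℂ) (v : τ → ℂ) :
    (fun i => evalAt t v (linComb A Q i)) = A fun k => evalAt t v (Q k) :=
  eval₂_linComb A Q (fun _ => Polynomial.eval_C) v

lemma isHomogeneous_linComb (A : (Fin 3 → ℂ) →ₗ[ℂ] (Fin 3 → ℂ)) {Q : Fin 3 → MvPolynomial τ R}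
    {d : ℕ} (hQ : ∀ k, (Q k).IsHomogeneous d) (i : Fin 3) : (linComb A Q i).IsHomogeneous d := by
  refine IsHomogeneous.sum _ _ _ fun k _ => ?_
  simpa using (isHomogeneous_C τ _).mul (hQ k)

/-- Polynomials in new coordinates. -/
def changeCoord (A : (Fin 3 → ℂ) ≃ₗ[ℂ] (Fin 3 → ℂ))
    (Q : Fin 3 → MvPolynomial (Fin 3) (Polynomial ℂ)) (i : Fin 3) :
    MvPolynomial (Fin 3) (Polynomial ℂ) :=
  linComb A.toLinearMap (fun k => aeval (linComb A.symm.toLinearMap X) (Q k)) i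

lemma isHomogeneous_changeCoord (A : (Fin 3 → ℂ) ≃ₗ[ℂ] (Fin 3 → ℂ))
    {Q : Fin 3 → MvPolynomial (Fin 3) (Polynomial ℂ)} {d : ℕ} (hQ : ∀ k, (Q k).IsHomogeneous d)
    (i : Fin 3) : (changeCoord A Q i).IsHomogeneous d := by
  refine isHomogeneous_linComb _ (fun k => ?_) i
  have := (hQ k).aeval (linComb (R := Polynomial ℂ) A.symm.toLinearMap X)
    (isHomogeneous_linComb _ fun k => isHomogeneous_X _ k)
  rwa [one_mul] at this

lemma evalAt_changeCoord (A : (Fin 3 → ℂ) ≃ₗ[ℂ] (Fin 3 → ℂ))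
    (Q : Fin 3 → MvPolynomial (Fin 3) (Polynomial ℂ)) (t : ℂ) (y : Fin 3 → ℂ) :
    (fun i => evalAt t (A y) (changeCoord A Q i)) = A fun k => evalAt t y (Q k) := by
  refine (evalAt_linComb _ _ t _).trans (congrArg A (_root_.funext fun k => ?_))
  have h1 : (fun i => evalAt t (A y) (linComb A.symm.toLinearMap X i)) = y := by
    rw [evalAt_linComb]
    simp [evalAt]
  have h2 : (eval₂Hom (Polynomial.evalRingHom t) (A y)).comp
      (aeval (R := Polynomial ℂ) (linComb A.symm.toLinearMap X)).toRingHom =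
      eval₂Hom (Polynomial.evalRingHom t) y := by
    refine ringHom_ext (fun a => by simp) fun j => ?_
    simpa [evalAt] using congrFun h1 j
  exact RingHom.congr_fun h2 (Q k)

end LinComb

lemma isRegularOn_nodalMap (A : (Fin 3 → ℂ) ≃ₗ[ℂ] (Fin 3 → ℂ)) : IsRegularOn (nodalMap A) Set.univ := by
  let Q : Fin 3 → MvPolynomial (Fin 2) ℂ := ![X 0 ^ 2 * X 1, X 0 * X 1 ^ 2, X 0 ^ 3 + X 1 ^ 3]
  have hQ : ∀ v, (fun i => eval v (linComb A.toLinearMap Q i)) = A (nodalParam v) := by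
    intro v
    rw [eval_linComb]
    refine congrArg A (_root_.funext fun k => ?_)
    fin_cases k <;> simp [Q, nodalParam]
  refine fun x _ => ⟨3, linComb A.toLinearMap Q, isHomogeneous_linComb _ ?_, ?_, fun y _ h => ?_⟩
  · intro k
    fin_cases k
    · exact ((isHomogeneous_X ℂ (0 : Fin 2)).pow 2).mul (isHomogeneous_X ℂ 1)
    · exact (isHomogeneous_X ℂ (0 : Fin 2)).mul ((isHomogeneous_X ℂ 1).pow 2)
    · exact ((isHomogeneous_X ℂ (0 : Fin 2)).pow 3).add ((isHomogeneous_X ℂ 1).pow 3)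
  · rw [hQ]
    exact A.map_ne_zero_iff.mpr (nodalParam_ne_zero x.rep_nonzero)
  · refine mk_eq_mk _ _ (c := 1) ?_
    rw [hQ, one_smul]

lemma isHomogeneous_two {R : Type} [CommRing R] (a b : R) (i j k l : Fin 3) :
    (C a * (X i * X j) + C b * (X k * X l) : MvPolynomial (Fin 3) R).IsHomogeneous 2 := by
  refine IsHomogeneous.add ?_ ?_ <;>
    simpa using (isHomogeneous_C _ _).mul ((isHomogeneous_X R _).mul (isHomogeneous_X R _))

lemma isHomogeneous_three {R : Type} [CommRing R] (a b : R) (i j k l m n : Fin 3) :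
    (C a * (X i * X j * X k) + C b * (X l * X m * X n) :
      MvPolynomial (Fin 3) R).IsHomogeneous 3 := by
  refine IsHomogeneous.add ?_ ?_ <;>
    simpa using (isHomogeneous_C _ _).mul (((isHomogeneous_X R _).mul (isHomogeneous_X R _)).mul
      (isHomogeneous_X R _))

/-- The formulas for the action in the neighbourhood of the node. -/
def actFormulaNode : Fin 3 → MvPolynomial (Fin 3) (Polynomial ℂ) :=
  ![C (Polynomial.X ^ 2) * (X 0 * X 2) +
      C (Polynomial.X ^ 2 * (Polynomial.X ^ 3 - 1)) * (X 1 * X 1),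
    C (Polynomial.X ^ 4) * (X 1 * X 2) +
      C (Polynomial.X * (1 - Polynomial.X ^ 3)) * (X 0 * X 0),
    C (Polynomial.X ^ 3) * (X 2 * X 2) + C ((Polynomial.X ^ 3 - 1) ^ 2) * (X 0 * X 1)]

/-- The formulas for the action away from the node. -/
def actFormulaAway : Fin 3 → MvPolynomial (Fin 3) (Polynomial ℂ) :=
  -- The summands with coefficient `0` only give the entries the shape expected by
  -- `isHomogeneous_three`.
  ![C (Polynomial.X ^ 2) * (X 0 * X 0 * X 1) + C 0 * (X 0 * X 0 * X 1),
    C Polynomial.X * (X 0 * X 1 * X 1) + C 0 * (X 0 * X 1 * X 1),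
    C (Polynomial.X ^ 3) * (X 0 * X 0 * X 0) + C 1 * (X 1 * X 1 * X 1)]

/-- A sextic form in `w` is a quadric in `nodalParam w` exactly when its coefficients at `w 0 ^ 6`
and `w 1 ^ 6` agree. The factor `w 0 ^ 3 + t ^ 3 * w 1 ^ 3` achieves this for all three coordinates
of the moved point, and for `t ≠ 0` it vanishes at neither preimage of the node. -/
lemma evalAt_actFormulaNode (t : ℂ) (w : Fin 2 → ℂ) :
    (fun k => evalAt t (nodalParam w) (actFormulaNode k)) =
      (w 0 ^ 3 + t ^ 3 * w 1 ^ 3) • nodalParam ![t * w 0, w 1] := by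
  ext k
  fin_cases k <;> simp [evalAt, actFormulaNode, nodalParam, eval₂_add, eval₂_mul] <;> ring

/-- The factor `(w 0 * w 1) ^ 3` vanishes only over the node, so these formulas serve at every other
point. -/
lemma evalAt_actFormulaAway (t : ℂ) (w : Fin 2 → ℂ) :
    (fun k => evalAt t (nodalParam w) (actFormulaAway k)) =
      (w 0 * w 1) ^ 3 • nodalParam ![t * w 0, w 1] := by
  ext k
  fin_cases k <;> simp [evalAt, actFormulaAway, nodalParam, eval₂_add, eval₂_mul] <;> ring

lemma nodalMap_eq_node_iff (A : (Fin 3 → ℂ) ≃ₗ[ℂ] (Fin 3 → ℂ)) (u : PSpace (Fin 2)) :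
    nodalMap A u = nodalMap A pointOneZero ↔ u = pointOneZero ∨ u = pointZeroOne := by
  rw [nodalMap_eq_iff]
  constructor
  · rintro (h | ⟨h, -⟩)
    · exact .inl h
    · exact h
  · exact fun h => .inr ⟨h, .inl rfl⟩

namespace IsNodalForm

variable {F : MvPolynomial (Fin 3) ℂ} {A : (Fin 3 → ℂ) ≃ₗ[ℂ] (Fin 3 → ℂ)} {c : ℂ}
  (hF : IsNodalForm F A c)

include hF

lemma eval_eq_zero_iff (y : Fin 3 → ℂ) :
    eval (A y) F = 0 ↔ y 0 * y 1 * y 2 - y 0 ^ 3 - y 1 ^ 3 = 0 := by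
  rw [hF.eval_eq, mul_eq_zero, or_iff_right hF.ne_zero]

lemma nodalMap_mem (u : PSpace (Fin 2)) : nodalMap A u ∈ zeroLocus F := by
  rw [nodalMap, mk_mem_zeroLocus hF.homogeneous, hF.eval_eq_zero_iff]
  exact nodalParam_relation _

lemma exists_rep_eq {x : PSpace (Fin 3)} (hx : x ∈ zeroLocus F) :
    ∃ (w : Fin 2 → ℂ) (hw : w ≠ 0), x.rep = A (nodalParam w) ∧
      x = nodalMap A (Projectivization.mk ℂ w hw) := by
  have hx' : eval (A (A.symm x.rep)) F = 0 := by rwa [A.apply_symm_apply]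
  obtain ⟨w, hw⟩ := exists_eq_nodalParam ((hF.eval_eq_zero_iff _).mp hx')
  have hrep : x.rep = A (nodalParam w) := by rw [← hw, A.apply_symm_apply]
  have hw0 : w ≠ 0 := by
    rintro rfl
    refine x.rep_nonzero (hrep.trans ?_)
    rw [show (0 : Fin 2 → ℂ) = (0 : ℂ) • 0 by simp, nodalParam_smul]
    simp
  refine ⟨w, hw0, hrep, ?_⟩
  rw [nodalMap_mk]
  conv_lhs => rw [← x.mk_rep]
  exact mk_eq_mk _ _ (c := 1) (by rw [hrep, one_smul])

lemma range_nodalMap : Set.range (nodalMap A) = zeroLocus F := by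
  refine subset_antisymm ?_ fun x hx => ?_
  · rintro _ ⟨u, rfl⟩
    exact hF.nodalMap_mem u
  · obtain ⟨w, hw, -, rfl⟩ := hF.exists_rep_eq hx
    exact ⟨_, rfl⟩

/-- The normalization as a map onto the curve. -/
def toCurve (u : PSpace (Fin 2)) : zeroLocus F := ⟨nodalMap A u, hF.nodalMap_mem u⟩

lemma toCurve_eq_iff (u v : PSpace (Fin 2)) :
    hF.toCurve u = hF.toCurve v ↔ u = v ∨
      ((u = pointOneZero ∨ u = pointZeroOne) ∧ (v = pointOneZero ∨ v = pointZeroOne)) :=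
  Subtype.ext_iff.trans (nodalMap_eq_iff A u v)

lemma isPinching : IsPinching hF.toCurve where
  continuous := (continuous_nodalMap A).subtype_mk _
  surjective := by
    rintro ⟨x, hx⟩
    obtain ⟨w, hw, -, rfl⟩ := hF.exists_rep_eq hx
    exact ⟨_, rfl⟩
  eq_iff := hF.toCurve_eq_iff

-- In the coordinates given by `A`, the inverse is projection from the node, `[x²y : xy²] = [x :
-- y]`. It is defined where the first coordinate is nonzero; the default value elsewhere plays no
-- role.
open Classical in
lemma isNormalization : IsNormalization (zeroLocus F) (nodalMap A) where
  regular := isRegularOn_nodalMap A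
  range_eq := hF.range_nodalMap
  finite_fibers y := by
    by_cases hy : ∃ u, nodalMap A u = y
    · obtain ⟨u, rfl⟩ := hy
      refine (Set.toFinite {u, pointOneZero, pointZeroOne}).subset fun v hv => ?_
      rcases (nodalMap_eq_iff A v u).mp hv with h | ⟨h | h, -⟩ <;> simp [h]
    · convert Set.finite_empty
      exact Set.eq_empty_of_forall_notMem fun u hu => hy ⟨u, hu⟩
  birational := by
    let L : Fin 3 → MvPolynomial (Fin 3) ℂ := linComb A.symm.toLinearMap X
    have hL : ∀ v, (fun i => eval v (L i)) = A.symm v := fun v => by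
      rw [eval_linComb]
      simp
    have hL1 : ∀ i, (L i).IsHomogeneous 1 :=
      isHomogeneous_linComb _ fun k => isHomogeneous_X _ k
    let P : Fin 2 → MvPolynomial (Fin 3) ℂ := ![L 0, L 1]
    let g : PSpace (Fin 3) → PSpace (Fin 2) := fun y =>
      if h : (fun k => eval y.rep (P k)) ≠ 0 then Projectivization.mk ℂ _ h else pointOneZero
    have hg : ∀ u, nodalMap A u ∈ (zeroLocus (L 0))ᶜ → g (nodalMap A u) = u := by
      intro u hu
      obtain ⟨w, hw, hrep, hu'⟩ := hF.exists_rep_eq (hF.nodalMap_mem u)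
      have hev : ∀ i, eval (nodalMap A u).rep (L i) = nodalParam w i := fun i => by
        rw [congrFun (hL _) i, hrep, A.symm_apply_apply]
      have hw0 : w 0 ^ 2 * w 1 ≠ 0 := fun h0 => hu ((hev 0).trans h0)
      have hu1 : u = Projectivization.mk ℂ w hw := by
        rcases (nodalMap_eq_iff A _ _).mp hu' with h | ⟨-, h⟩
        · exact h
        · refine absurd ((mk_eq_special_iff hw).mp h) fun h => hw0 ?_
          linear_combination w 0 * h
      have hP : (fun k => eval (nodalMap A u).rep (P k)) = (w 0 * w 1) • w := by
        ext k
        fin_cases k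
        · exact (hev 0).trans (by simp [nodalParam]; ring)
        · exact (hev 1).trans (by simp [nodalParam]; ring)
      have hne : (fun k => eval (nodalMap A u).rep (P k)) ≠ 0 := by
        rw [hP]
        refine smul_ne_zero (fun h => hw0 ?_) hw
        linear_combination w 0 * h
      change dite _ _ _ = _
      rw [dif_pos hne]
      conv_rhs => rw [hu1]
      exact mk_eq_mk _ _ hP
    have hgσ : ∀ y ∈ zeroLocus F ∩ (zeroLocus (L 0))ᶜ, nodalMap A (g y) = y := by
      rintro y ⟨hy, hy0⟩
      rw [← hF.range_nodalMap] at hy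
      obtain ⟨u, rfl⟩ := hy
      rw [hg u hy0]
    refine ⟨(zeroLocus (L 0))ᶜ, g, ?_, ?_, ?_, hgσ, hg⟩
    · let := zariski (Fin 3)
      exact (isClosed_zeroLocus (hL1 0)).isOpen_compl
    · refine ⟨nodalMap A (Projectivization.mk ℂ ![1, 1] (vec_one_ne_zero 1)),
        hF.nodalMap_mem _, ?_⟩
      rw [nodalMap_mk, Set.mem_compl_iff, mk_mem_zeroLocus (hL1 0), congrFun (hL _) 0,
        A.symm_apply_apply]
      simp [nodalParam]
    · refine fun y hy => ⟨1, P, fun k => ?_, ?_, fun z _ h => dif_pos h⟩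
      · fin_cases k
        · exact hL1 0
        · exact hL1 1
      · exact fun h0 => hy.2 (congrFun h0 0)

/-- The action on the curve induced by the standard action on the projective line. -/
def actOn (t : ℂˣ) (x : zeroLocus F) : zeroLocus F :=
  hF.toCurve (scale t (Function.surjInv hF.isPinching.surjective x))

/-- `actOn` uses a chosen preimage. The choice is ambiguous only over the node, whose two preimages
are both fixed by `scale t`. -/
lemma actOn_toCurve (t : ℂˣ) (u : PSpace (Fin 2)) :
    hF.actOn t (hF.toCurve u) = hF.toCurve (scale t u) := by
  rw [actOn, hF.toCurve_eq_iff]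
  rcases (hF.toCurve_eq_iff _ _).mp
    (Function.surjInv_eq hF.isPinching.surjective (hF.toCurve u)) with h | ⟨h, h'⟩
  · rw [h]
    exact .inl rfl
  · rw [scale_special t h, scale_special t h']
    exact .inr ⟨h, h'⟩

lemma actOn_eq_of_formula {Q : Fin 3 → MvPolynomial (Fin 3) (Polynomial ℂ)}
    {m : ℂ → (Fin 2 → ℂ) → ℂ}
    (hQ : ∀ t w, (fun k => evalAt t (nodalParam w) (Q k)) = m t w • nodalParam ![t * w 0, w 1])
    (t : ℂˣ) (x : zeroLocus F)
    (h : (fun i => evalAt (t : ℂ) x.1.rep (changeCoord A Q i)) ≠ 0) :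
    (hF.actOn t x : PSpace (Fin 3)) = Projectivization.mk ℂ _ h := by
  obtain ⟨w, hw, hrep, hx⟩ := hF.exists_rep_eq x.2
  obtain rfl : x = hF.toCurve (Projectivization.mk ℂ w hw) := Subtype.ext hx
  rw [hF.actOn_toCurve, scale_mk]
  change nodalMap A _ = _
  rw [nodalMap_mk]
  symm
  refine mk_eq_mk _ _ (c := m t w) ?_
  rw [hrep, evalAt_changeCoord, hQ, map_smul]

/-- The `ℂ^*`-action on a nodal cubic. -/
def action : CStarAction (zeroLocus F) where
  act := hF.actOn
  one_act x := by
    obtain ⟨u, rfl⟩ := hF.isPinching.surjective x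
    rw [hF.actOn_toCurve, scale_one]
  mul_act s t x := by
    obtain ⟨u, rfl⟩ := hF.isPinching.surjective x
    rw [hF.actOn_toCurve, hF.actOn_toCurve, hF.actOn_toCurve, scale_mul]
  regular t₀ x₀ := by
    obtain ⟨w, hw, hrep, -⟩ := hF.exists_rep_eq x₀.2
    have hne : nodalParam ![(t₀ : ℂ) * w 0, w 1] ≠ 0 :=
      nodalParam_ne_zero (scaleVec_ne_zero t₀ hw)
    -- This separates the node from the other points, each case using the formulas whose common
    -- factor does not vanish there.
    by_cases h : w 0 * w 1 = 0
    · refine ⟨2, changeCoord A actFormulaNode, isHomogeneous_changeCoord A fun k => ?_, ?_,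
        hF.actOn_eq_of_formula evalAt_actFormulaNode⟩
      · fin_cases k <;> exact isHomogeneous_two ..
      · rw [hrep, evalAt_changeCoord, evalAt_actFormulaNode]
        refine A.map_ne_zero_iff.mpr (smul_ne_zero (fun h0 => hw (_root_.funext fun i => ?_)) hne)
        rcases mul_eq_zero.mp h with h | h
        · have h1 : w 1 = 0 := by simpa [h] using h0
          fin_cases i <;> assumption
        · have h1 : w 0 = 0 := by simpa [h] using h0
          fin_cases i <;> assumption
    · refine ⟨3, changeCoord A actFormulaAway, isHomogeneous_changeCoord A fun k => ?_, ?_,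
        hF.actOn_eq_of_formula evalAt_actFormulaAway⟩
      · fin_cases k <;> exact isHomogeneous_three ..
      · rw [hrep, evalAt_changeCoord, evalAt_actFormulaAway]
        exact A.map_ne_zero_iff.mpr (smul_ne_zero (pow_ne_zero 3 h) hne)

lemma action_nodalMap (t : ℂˣ) (u : PSpace (Fin 2)) (hu : nodalMap A u ∈ zeroLocus F) :
    (hF.action.act t ⟨nodalMap A u, hu⟩ : PSpace (Fin 3)) = nodalMap A (scale t u) :=
  congrArg Subtype.val (hF.actOn_toCurve t u)

lemma fixedPoints_action : hF.action.fixedPoints = {hF.toCurve pointOneZero} := by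
  ext x
  obtain ⟨u, rfl⟩ := hF.isPinching.surjective x
  rw [Set.mem_singleton_iff, Subtype.ext_iff]
  change (∀ t, hF.actOn t (hF.toCurve u) = hF.toCurve u) ↔ nodalMap A u = nodalMap A pointOneZero
  rw [nodalMap_eq_node_iff]
  simp only [hF.actOn_toCurve, hF.toCurve_eq_iff]
  constructor
  · intro h
    by_contra hu
    exact hu ((scale_eq_self_iff u).mp fun t => (h t).resolve_right fun h' => hu h'.2)
  · exact fun hu t => .inl (scale_special t hu)

end IsNodalForm

end
end ProjVar

/-! ### Segre products and product actions. -/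

namespace ProjVar
noncomputable section

open CategoryTheory MvPolynomial

section Segre

variable {ι κ : Type}

lemma tensor_ne_zero {v : ι → ℂ} {w : κ → ℂ} (hv : v ≠ 0) (hw : w ≠ 0) :
    (fun ij : ι × κ => v ij.1 * w ij.2) ≠ 0 := by
  obtain ⟨i, hi⟩ := Function.ne_iff.mp hv
  obtain ⟨j, hj⟩ := Function.ne_iff.mp hw
  exact Function.ne_iff.mpr ⟨(i, j), mul_ne_zero hi hj⟩

lemma segre_mk {v : ι → ℂ} {w : κ → ℂ} (hv : v ≠ 0) (hw : w ≠ 0) :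
    segre (Projectivization.mk ℂ v hv) (Projectivization.mk ℂ w hw) =
      Projectivization.mk ℂ (fun ij => v ij.1 * w ij.2) (tensor_ne_zero hv hw) := by
  obtain ⟨c, hc, h⟩ := exists_rep_mk hv
  obtain ⟨c', hc', h'⟩ := exists_rep_mk hw
  refine mk_eq_mk _ _ (c := c * c') ?_
  ext ij
  simp only [h, h', Pi.smul_apply, smul_eq_mul]
  ring

lemma segre_injective2 : Function.Injective2 (segre : PSpace ι → PSpace κ → PSpace (ι × κ)) := by
  intro x x' y y' h
  rw [segre, segre, Projectivization.mk_eq_mk_iff'] at h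
  obtain ⟨c, hc⟩ := h
  have hc' : ∀ i j, c * (x'.rep i * y'.rep j) = x.rep i * y.rep j := fun i j => congrFun hc (i, j)
  obtain ⟨i, hi⟩ := Function.ne_iff.mp x.rep_nonzero
  obtain ⟨j, hj⟩ := Function.ne_iff.mp y.rep_nonzero
  rw [Pi.zero_apply] at hi hj
  constructor
  · rw [← x.mk_rep, ← x'.mk_rep]
    refine mk_eq_mk _ _ (c := c * y'.rep j / y.rep j) ?_
    ext i'
    rw [Pi.smul_apply, smul_eq_mul, eq_comm, div_mul_eq_mul_div, div_eq_iff hj, ← hc']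
    ring
  · rw [← y.mk_rep, ← y'.mk_rep]
    refine mk_eq_mk _ _ (c := c * x'.rep i / x.rep i) ?_
    ext j'
    rw [Pi.smul_apply, smul_eq_mul, eq_comm, div_mul_eq_mul_div, div_eq_iff hi, mul_comm (y.rep j'),
      ← hc']
    ring

lemma continuous_segre : Continuous fun q : PSpace ι × PSpace κ => segre q.1 q.2 := by
  rw [(isOpenQuotientMap_mk.prodMap isOpenQuotientMap_mk).isQuotientMap.continuous_iff]
  have : (fun q : PSpace ι × PSpace κ => segre q.1 q.2) ∘
      Prod.map (Projectivization.mk' ℂ) (Projectivization.mk' ℂ) =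
      fun q : {v : ι → ℂ // v ≠ 0} × {w : κ → ℂ // w ≠ 0} =>
        Projectivization.mk ℂ (fun ij : ι × κ => q.1.1 ij.1 * q.2.1 ij.2)
          (tensor_ne_zero q.1.2 q.2.2) := _root_.funext fun q => segre_mk q.1.2 q.2.2
  rw [this]
  refine continuous_mk (continuous_pi fun ij => ?_) _
  exact ((continuous_apply ij.1).comp (continuous_subtype_val.comp continuous_fst)).mul
    ((continuous_apply ij.2).comp (continuous_subtype_val.comp continuous_snd))

lemma exists_rep_segre (x : PSpace ι) (y : PSpace κ) :
    ∃ c : ℂ, c ≠ 0 ∧ ∀ i j, (segre x y).rep (i, j) = c * (x.rep i * y.rep j) := by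
  obtain ⟨c, hc, h⟩ := exists_rep_mk (tensor_ne_zero x.rep_nonzero y.rep_nonzero)
  exact ⟨c, hc, fun i j => congrFun h (i, j)⟩

/-- The product of a hypersurface with a projective space is Zariski closed. -/
lemma isClosed_segreProduct {F : MvPolynomial ι ℂ} {d : ℕ} (hF : F.IsHomogeneous d) :
    IsClosed[zariski (ι × κ)] (segreProduct (zeroLocus F) (Set.univ : Set (PSpace κ))) := by
  let := zariski (ι × κ)
  have heq : segreProduct (zeroLocus F) (Set.univ : Set (PSpace κ)) =
      -- The product consists of the rank one matrices (vanishing 2×2 minors) whose columns satisfy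
      -- `F`.
      (⋂ (i : ι) (j : κ) (i' : ι) (j' : κ),
        zeroLocus (X (i, j) * X (i', j') - X (i, j') * X (i', j))) ∩
      ⋂ j : κ, zeroLocus (rename (fun i => (i, j)) F) := by
    ext z
    constructor
    · rintro ⟨x, hx, y, -, rfl⟩
      obtain ⟨c, hc, h⟩ := exists_rep_segre x y
      refine ⟨?_, ?_⟩
      · simp only [Set.mem_iInter, zeroLocus, Set.mem_ofPred_eq, map_sub, map_mul, eval_X, h]
        intros
        ring
      · simp only [Set.mem_iInter, zeroLocus, Set.mem_ofPred_eq, eval_rename]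
        intro j
        have : (segre x y).rep ∘ (fun i => (i, j)) = (c * y.rep j) • x.rep := by
          ext i
          simp only [Function.comp_apply, h, Pi.smul_apply, smul_eq_mul]
          ring
        rw [this, eval_smul_of_isHomogeneous hF, show eval x.rep F = 0 from hx, mul_zero]
    · rintro ⟨h1, h2⟩
      simp only [Set.mem_iInter, zeroLocus, Set.mem_ofPred_eq, map_sub, map_mul, eval_X,
        eval_rename] at h1 h2
      -- Through a nonzero entry `(i, j)`, column `j` and row `i` give the two factors; by the
      -- minors their tensor product is that entry times the matrix.
      obtain ⟨⟨i, j⟩, hij⟩ := Function.ne_iff.mp z.rep_nonzero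
      have hv : (fun i' => z.rep (i', j)) ≠ 0 := Function.ne_iff.mpr ⟨i, hij⟩
      have hw : (fun j' => z.rep (i, j')) ≠ 0 := Function.ne_iff.mpr ⟨j, hij⟩
      refine ⟨Projectivization.mk ℂ _ hv, (mk_mem_zeroLocus hF hv).mpr (h2 j),
        Projectivization.mk ℂ _ hw, trivial, ?_⟩
      rw [segre_mk]
      conv_rhs => rw [← z.mk_rep]
      refine mk_eq_mk _ _ (c := z.rep (i, j)) ?_
      ext ⟨i', j'⟩
      simp only [Pi.smul_apply, smul_eq_mul]
      linear_combination -h1 i j i' j'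
  rw [heq]
  refine IsClosed.inter (isClosed_iInter fun i => isClosed_iInter fun j => isClosed_iInter fun i' =>
    isClosed_iInter fun j' => isClosed_zeroLocus (d := 1 + 1) ?_)
    (isClosed_iInter fun j => isClosed_zeroLocus hF.rename_isHomogeneous)
  exact ((isHomogeneous_X _ _).mul (isHomogeneous_X _ _)).sub
    ((isHomogeneous_X _ _).mul (isHomogeneous_X _ _))

/-- The Segre embedding as a parametrization of the product. -/
def segreEquiv (X : Set (PSpace ι)) (κ : Type) :
    X × PSpace κ ≃ segreProduct X (Set.univ : Set (PSpace κ)) :=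
  Equiv.ofBijective (fun q => ⟨segre q.1.1 q.2, Set.mem_image2_of_mem q.1.2 trivial⟩) <| by
    constructor
    · rintro ⟨x, y⟩ ⟨x', y'⟩ h
      obtain ⟨h1, h2⟩ := segre_injective2 (congrArg Subtype.val h)
      exact Prod.ext (Subtype.ext h1) h2
    · rintro ⟨_, x, hx, y, -, rfl⟩
      exact ⟨(⟨x, hx⟩, y), rfl⟩

lemma segreEquiv_apply (X : Set (PSpace ι)) (x : X) (y : PSpace κ) :
    (segreEquiv X κ (x, y) : PSpace (ι × κ)) = segre x.1 y := rfl

/-- The product in the sense of projective varieties is the product of topological spaces. -/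
def segreHomeomorph [Fintype ι] [Fintype κ] (X : Set (PSpace ι)) [CompactSpace X] :
    X × PSpace κ ≃ₜ segreProduct X (Set.univ : Set (PSpace κ)) :=
  Continuous.homeoOfEquivCompactToT2 (f := segreEquiv X κ) <| Continuous.subtype_mk
    (continuous_segre.comp ((continuous_subtype_val.comp continuous_fst).prodMk continuous_snd)) _

end Segre

section Rotation

variable {n : ℕ}

lemma rotateVec_ne_zero (t : ℂˣ) {v : Fin n → ℂ} (hv : v ≠ 0) :
    (fun j : Fin n => (t : ℂ) ^ (j : ℕ) * v j) ≠ 0 := by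
  obtain ⟨j, hj⟩ := Function.ne_iff.mp hv
  exact Function.ne_iff.mpr ⟨j, mul_ne_zero (pow_ne_zero _ t.ne_zero) hj⟩

/-- The action of `ℂ^*` on a projective space with weights `0, 1, 2, …`. -/
def rotate (t : ℂˣ) (x : PSpace (Fin n)) : PSpace (Fin n) :=
  Projectivization.mk ℂ _ (rotateVec_ne_zero t x.rep_nonzero)

lemma rotate_mk (t : ℂˣ) {v : Fin n → ℂ} (hv : v ≠ 0) : rotate t (Projectivization.mk ℂ v hv) =
    Projectivization.mk ℂ _ (rotateVec_ne_zero t hv) := by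
  obtain ⟨c, hc, h⟩ := exists_rep_mk hv
  refine mk_eq_mk _ _ (c := c) ?_
  ext j
  simp only [h, Pi.smul_apply, smul_eq_mul]
  ring

lemma rotate_one (x : PSpace (Fin n)) : rotate 1 x = x := by
  induction x using Projectivization.ind with
  | h v hv =>
    rw [rotate_mk]
    refine mk_eq_mk _ _ (c := 1) ?_
    ext j
    simp

lemma rotate_mul (s t : ℂˣ) (x : PSpace (Fin n)) : rotate (s * t) x = rotate s (rotate t x) := by
  induction x using Projectivization.ind with
  | h v hv =>
    rw [rotate_mk, rotate_mk, rotate_mk]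
    refine mk_eq_mk _ _ (c := 1) ?_
    ext j
    simp only [Units.val_mul, one_smul]
    ring

lemma single_one_ne_zero (j : Fin n) : (Pi.single j 1 : Fin n → ℂ) ≠ 0 :=
  Function.ne_iff.mpr ⟨j, by simp⟩

lemma exists_eq_of_rotate_eq {x : PSpace (Fin n)} (hx : ∀ t, rotate t x = x) :
    ∃ j, x = Projectivization.mk ℂ (Pi.single j 1) (single_one_ne_zero j) := by
  induction x using Projectivization.ind with
  | h v hv =>
    -- The element `2` alone suffices: the eigenvalues `2 ^ j` are distinct, so an eigenvector is a
    -- multiple of a coordinate vector.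
    have h2 := hx (Units.mk0 2 two_ne_zero)
    rw [rotate_mk, Projectivization.mk_eq_mk_iff'] at h2
    obtain ⟨a, ha⟩ := h2
    have ha' : ∀ j, a * v j = 2 ^ (j : ℕ) * v j := fun j => congrFun ha j
    obtain ⟨j, hj⟩ := Function.ne_iff.mp hv
    rw [Pi.zero_apply] at hj
    refine ⟨j, mk_eq_mk _ _ (c := v j) ?_⟩
    ext k
    by_cases hk : k = j
    · subst hk
      simp
    · have hne : ((2 : ℂ) ^ (k : ℕ)) ≠ 2 ^ (j : ℕ) := by
        intro h
        refine hk (Fin.ext (Nat.pow_right_injective le_rfl ?_))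
        dsimp only
        exact_mod_cast h
      have haj : a = 2 ^ (j : ℕ) := mul_right_cancel₀ hj (ha' j)
      have : ((2 : ℂ) ^ (k : ℕ) - 2 ^ (j : ℕ)) * v k = 0 := by
        rw [sub_mul, ← ha', haj, sub_self]
      simpa [hk] using (mul_eq_zero.mp this).resolve_left (sub_ne_zero.mpr hne)

lemma evalAt_monomial {ι : Type} (t : ℂ) (v : ι → ℂ) (i : ι) (k : ℕ) :
    evalAt t v (C (Polynomial.X ^ k) * X i) = t ^ k * v i := by
  rw [evalAt, eval₂_mul, eval₂_C, eval₂_X, Polynomial.coe_evalRingHom, Polynomial.eval_X_pow]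

variable (n) in
/-- The action of `ℂ^*` on a projective space with weights `0, 1, 2, …`. -/
def rotation : CStarAction (Set.univ : Set (PSpace (Fin n))) where
  act t x := ⟨rotate t x.1, trivial⟩
  one_act x := Subtype.ext (rotate_one _)
  mul_act s t x := Subtype.ext (rotate_mul _ _ _)
  regular t₀ x₀ := by
    refine ⟨1, fun j => C (Polynomial.X ^ (j : ℕ)) * X j, fun j => ?_, ?_, fun t x h => ?_⟩
    · simpa using (isHomogeneous_C (Fin n) (Polynomial.X ^ (j : ℕ) : Polynomial ℂ)).mul
        (isHomogeneous_X _ j)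
    · simp only [evalAt_monomial]
      exact rotateVec_ne_zero t₀ x₀.1.rep_nonzero
    · refine mk_eq_mk _ _ (c := 1) ?_
      ext j
      rw [one_smul]
      exact (evalAt_monomial _ _ _ _).symm

lemma finite_fixedPoints_rotation : (rotation n).fixedPoints.Finite := by
  refine (Set.finite_range fun j : Fin n => (⟨Projectivization.mk ℂ (Pi.single j 1)
    (single_one_ne_zero j), trivial⟩ : (Set.univ : Set (PSpace (Fin n))))).subset ?_
  intro x hx
  obtain ⟨j, hj⟩ := exists_eq_of_rotate_eq fun t => congrArg Subtype.val (hx t)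
  exact ⟨j, Subtype.ext hj.symm⟩

end Rotation

lemma hasIsolatedFixedPoints_of_finite {ι : Type} [Fintype ι] {X : Set (PSpace ι)}
    (a : CStarAction X) (ha : a.fixedPoints.Finite) : a.HasIsolatedFixedPoints := by
  intro x _
  refine ⟨(a.fixedPoints \ {x})ᶜ, (ha.subset Set.sdiff_subset).isClosed.isOpen_compl, by simp, ?_⟩
  intro y hy hfix
  by_contra hne
  exact hy ⟨hfix, hne⟩

section Product

variable {ι : Type} {X : Set (PSpace ι)} (a : CStarAction X) (n : ℕ)

/-- The product of an action with the action of `ℂ^*` on a projective space. -/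
def prodAction : CStarAction (segreProduct X (Set.univ : Set (PSpace (Fin n)))) where
  act t z := segreEquiv X (Fin n)
    (a.act t ((segreEquiv X (Fin n)).symm z).1, rotate t ((segreEquiv X (Fin n)).symm z).2)
  one_act z := by
    rw [a.one_act, rotate_one, Prod.mk.eta, Equiv.apply_symm_apply]
  mul_act s t z := by
    rw [Equiv.symm_apply_apply, a.mul_act, rotate_mul]
  regular t₀ z₀ := by
    obtain ⟨⟨x₀, y₀⟩, rfl⟩ := (segreEquiv X (Fin n)).surjective z₀
    obtain ⟨d, P, hP, hne, hact⟩ := a.regular t₀ x₀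
    obtain ⟨i₀, hi₀⟩ := Function.ne_iff.mp x₀.1.rep_nonzero
    obtain ⟨j₀, hj₀⟩ := Function.ne_iff.mp y₀.rep_nonzero
    -- On Segre coordinates, column `j₀` is a multiple of `x` and row `i₀` a multiple of `y`. So `P`
    -- is applied to the column and the weights to the row; the factors `y.rep j₀` and `x.rep i₀`
    -- are nonzero at the base point.
    let Q : ι × Fin n → MvPolynomial (ι × Fin n) (Polynomial ℂ) := fun ij =>
      rename (fun i => (i, j₀)) (P ij.1) * (C (Polynomial.X ^ (ij.2 : ℕ)) * MvPolynomial.X (i₀, ij.2))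
    have hQ : ∀ (t : ℂ) (x : X) (y : PSpace (Fin n)), ∃ k : ℂ, k ≠ 0 ∧
        (fun ij => evalAt t (segreEquiv X (Fin n) (x, y)).1.rep (Q ij)) =
          ((k * y.rep j₀) ^ d * (k * x.1.rep i₀)) • fun ij =>
            evalAt t x.1.rep (P ij.1) * (t ^ (ij.2 : ℕ) * y.rep ij.2) := by
      intro t x y
      obtain ⟨k, hk, h⟩ := exists_rep_segre x.1 y
      refine ⟨k, hk, ?_⟩
      ext ⟨i, j⟩
      have h1 : (segre x.1 y).rep ∘ (fun i => (i, j₀)) = (k * y.rep j₀) • x.1.rep := by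
        ext i
        simp only [Function.comp_apply, h, Pi.smul_apply, smul_eq_mul]
        ring
      have h2 : evalAt t (segre x.1 y).rep (rename (fun i => (i, j₀)) (P i)) =
          (k * y.rep j₀) ^ d * evalAt t x.1.rep (P i) := by
        rw [evalAt, eval₂_rename, h1, eval₂_smul_of_isHomogeneous (hP i), evalAt]
      have h3 : evalAt t (segre x.1 y).rep (Q (i, j)) =
          evalAt t (segre x.1 y).rep (rename (fun i => (i, j₀)) (P i)) *
            evalAt t (segre x.1 y).rep (C (Polynomial.X ^ (j : ℕ)) *
              MvPolynomial.X (i₀, j)) := eval₂_mul _ _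
      rw [segreEquiv_apply, h3, h2, evalAt_monomial, h, Pi.smul_apply, smul_eq_mul]
      ring
    refine ⟨d + 1, Q, fun ij => ?_, ?_, fun t z h => ?_⟩
    · refine (hP ij.1).rename_isHomogeneous.mul ?_
      simpa using (isHomogeneous_C (ι × Fin n) (Polynomial.X ^ (ij.2 : ℕ) : Polynomial ℂ)).mul
        (isHomogeneous_X _ (i₀, ij.2))
    · obtain ⟨k, hk, h⟩ := hQ t₀ x₀ y₀
      rw [h]
      exact smul_ne_zero (mul_ne_zero (pow_ne_zero _ (mul_ne_zero hk hj₀)) (mul_ne_zero hk hi₀))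
        (tensor_ne_zero hne (rotateVec_ne_zero t₀ y₀.rep_nonzero))
    · obtain ⟨⟨x, y⟩, rfl⟩ := (segreEquiv X (Fin n)).surjective z
      obtain ⟨k, -, hk⟩ := hQ t x y
      have hx : (fun i => evalAt (t : ℂ) x.1.rep (P i)) ≠ 0 := by
        intro h0
        refine h ?_
        rw [hk]
        ext ij
        simp [congrFun h0 ij.1]
      rw [Equiv.symm_apply_apply, segreEquiv_apply, hact t x hx, rotate, segre_mk]
      symm
      exact mk_eq_mk _ _ hk

lemma prodAction_act (t : ℂˣ) (x : X) (y : PSpace (Fin n)) :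
    (prodAction a n).act t (segreEquiv X (Fin n) (x, y)) =
      segreEquiv X (Fin n) (a.act t x, rotate t y) := by
  change segreEquiv X (Fin n) _ = _
  rw [Equiv.symm_apply_apply]

lemma prodAction_isProductOf : (prodAction a n).IsProductOf a (rotation n) := fun t x y =>
  congrArg Subtype.val (prodAction_act a n t x y.1)

lemma finite_fixedPoints_prodAction (ha : a.fixedPoints.Finite) :
    (prodAction a n).fixedPoints.Finite := by
  refine ((ha.prod (finite_fixedPoints_rotation (n := n))).image
    fun q => segreEquiv X (Fin n) (q.1, q.2.1)).subset fun z hz => ?_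
  obtain ⟨⟨x, y⟩, rfl⟩ := (segreEquiv X (Fin n)).surjective z
  have h : ∀ t, a.act t x = x ∧ rotate t y = y := fun t => by
    have := hz t
    rw [prodAction_act] at this
    exact Prod.ext_iff.mp ((segreEquiv X (Fin n)).injective this)
  exact ⟨(x, ⟨y, trivial⟩), ⟨fun t => (h t).1, fun t => Subtype.ext (h t).2⟩, rfl⟩

end Product

end
end ProjVar

/-! ### Fundamental group and affine cone of the product with projective space. -/

namespace ProjVar
noncomputable section

open CategoryTheory MvPolynomial

/-- A simply connected factor does not contribute to the fundamental group. -/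
lemma nonempty_fundamentalGroup_prod_mulEquiv {X P S : Type} [TopologicalSpace X]
    [TopologicalSpace P] [TopologicalSpace S] [SimplyConnectedSpace P] (h : X × P ≃ₜ S)
    (x : X) (y : P) : Nonempty (FundamentalGroup S (h (x, y)) ≃* FundamentalGroup X x) := by
  let f : C(X, S) := ⟨fun x' => h (x', y), by fun_prop⟩
  let g : C(S, X) := ⟨fun s => (h.symm s).1, by fun_prop⟩
  have hg : g (f x) = x := congrArg Prod.fst (h.symm_apply_apply (x, y))
  refine ⟨(MulEquiv.ofBijective (FundamentalGroup.map f x) ⟨?_, ?_⟩).symm⟩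
  · refine Function.LeftInverse.injective (g := FundamentalGroup.mapOfEq g hg) fun γ => ?_
    induction γ using Quotient.inductionOn with
    | h p =>
      refine (FundamentalGroup.mapOfEq_apply g hg _).trans ?_
      change (.mk _ : Path.Homotopic.Quotient x x) = .mk _
      congr 1
      ext t
      exact congrArg Prod.fst (h.symm_apply_apply (p t, y))
  · intro γ
    induction γ using Quotient.inductionOn with
    | h p =>
      let q : Path (x, y) (x, y) :=
        { toFun := fun t => h.symm (p t)
          continuous_toFun := by fun_prop
          source' := by rw [p.source]; exact h.symm_apply_apply _
          target' := by rw [p.target]; exact h.symm_apply_apply _ }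
      let q₁ : Path x x := q.map continuous_fst
      let q₂ : Path y y := q.map continuous_snd
      refine ⟨Path.Homotopic.Quotient.mk q₁, ?_⟩
      change Path.Homotopic.Quotient.mk _ = Path.Homotopic.Quotient.mk _
      rw [Path.Homotopic.Quotient.eq]
      -- The second component of the loop is contracted in the simply connected factor.
      have h1 : (q₁.prod (Path.refl y)).Homotopic (q₁.prod q₂) :=
        ⟨Path.Homotopic.prodHomotopy (Path.Homotopy.refl _)
          (SimplyConnectedSpace.paths_homotopic (Path.refl y) q₂).some⟩
      have h2 := h1.map ⟨h, h.continuous⟩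
      have h3 : (q₁.prod q₂).map h.continuous = p := by
        ext t
        exact h.apply_symm_apply (p t)
      exact h3 ▸ h2

lemma betti_one_eq_one {X : Type} [TopologicalSpace X]
    (h : Nonempty (H 1 X ≅ ModuleCat.of ℤ ℤ)) : betti 1 X = 1 := by
  obtain ⟨e⟩ := h
  rw [betti, e.toLinearEquiv.rank_eq]
  exact Module.rank_self ℤ

section ConeParam

variable (A : (Fin 3 → ℂ) ≃ₗ[ℂ] (Fin 3 → ℂ)) (κ : Type)

/-- The parametrization of an affine chart of a nodal cubic. -/
def affineParam (τ : Type) (s : τ) : Fin 3 → MvPolynomial τ ℂ := ![X s ^ 2, X s, X s ^ 3 + 1]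

/-- The parametrization of the affine cone over the product of a nodal cubic and a projective
space. -/
def coneParam (ij : Fin 3 × κ) : MvPolynomial (Option κ) ℂ :=
  linComb A.toLinearMap (affineParam (Option κ) none) ij.1 * X (some ij.2)

variable {κ}

lemma eval_coneParam (a : Option κ → ℂ) (i : Fin 3) (j : κ) :
    eval a (coneParam A κ (i, j)) = A (nodalParam ![a none, 1]) i * a (some j) := by
  have h : (fun k => eval a (affineParam (Option κ) none k)) = nodalParam ![a none, 1] := by
    ext k
    fin_cases k <;> simp [affineParam, nodalParam]
  have h' := congrFun (eval_linComb A.toLinearMap (affineParam (Option κ) none) a) i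
  rw [h] at h'
  rw [coneParam, map_mul, eval_X]
  exact congrArg (· * _) h'

/-- Applying the inverse of `A` recovers the products of the model parametrization with `X (some j)`
from the transformed generators. -/
lemma affineParam_mul_mem {B : Subalgebra ℂ (MvPolynomial (Option κ) ℂ)} {j : κ}
    (hB : ∀ i, coneParam A κ (i, j) ∈ B) (k : Fin 3) :
    affineParam (Option κ) none k * X (some j) ∈ B := by
  have h : affineParam (Option κ) none k * X (some j) =
      linComb A.symm.toLinearMap (fun i => coneParam A κ (i, j)) k := by
    have h1 : affineParam (Option κ) none =
        linComb A.symm.toLinearMap (linComb A.toLinearMap (affineParam (Option κ) none)) := by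
      ext1 k
      refine MvPolynomial.funext fun a => ?_
      have h2 := congrFun (eval_linComb A.symm.toLinearMap
        (linComb A.toLinearMap (affineParam (Option κ) none)) a) k
      rw [eval_linComb] at h2
      rw [h2]
      exact (congrFun (A.symm_apply_apply fun k => eval a (affineParam (Option κ) none k)) k).symm
    conv_lhs => rw [h1]
    simp only [coneParam]
    rw [linComb, linComb, Finset.sum_mul]
    exact Finset.sum_congr rfl fun i _ => mul_assoc _ _ _
  rw [h]
  exact B.sum_mem fun i _ => B.mul_mem (B.algebraMap_mem _) (hB i)

lemma isAlgebraic_of_mul_eq {R S : Type*} [CommRing R] [IsDomain R] [CommRing S] [Algebra R S]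
    {a b : R} (ha : a ≠ 0) {x : S} (h : algebraMap R S a * x = algebraMap R S b) :
    IsAlgebraic R x := by
  refine ⟨Polynomial.C a * Polynomial.X - Polynomial.C b, fun h0 => ha ?_, by simp [h]⟩
  simpa using congrArg (fun p => Polynomial.coeff p 1) h0

/-- With `s` and `w_j` the parameters, `B` contains `s w_j` and `s² w_j`. Then `s = s² w_j / (s
w_j)` and `w_j = (s w_j)² / (s² w_j)` satisfy linear equations over `B`. -/
lemma isAlgebraic_X [Nonempty κ] {B : Subalgebra ℂ (MvPolynomial (Option κ) ℂ)}
    (hB : ∀ ij, coneParam A κ ij ∈ B) (i : Option κ) :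
    IsAlgebraic B (X i : MvPolynomial (Option κ) ℂ) := by
  have h0 : ∀ j, (X none : MvPolynomial (Option κ) ℂ) ^ 2 * X (some j) ∈ B := fun j =>
    affineParam_mul_mem A (fun i => hB (i, j)) 0
  have h1 : ∀ j, (X none : MvPolynomial (Option κ) ℂ) * X (some j) ∈ B := fun j =>
    affineParam_mul_mem A (fun i => hB (i, j)) 1
  rcases i with _ | j
  · obtain ⟨j⟩ := ‹Nonempty κ›
    refine isAlgebraic_of_mul_eq (a := (⟨_, h1 j⟩ : B)) (b := ⟨_, h0 j⟩)
      (fun h => mul_ne_zero (X_ne_zero _) (X_ne_zero _) (congrArg Subtype.val h)) ?_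
    change X none * X (some j) * X none = X none ^ 2 * X (some j)
    ring
  · refine isAlgebraic_of_mul_eq (a := (⟨_, h0 j⟩ : B)) (b := ⟨_, h1 j⟩ ^ 2)
      (fun h => mul_ne_zero (pow_ne_zero 2 (X_ne_zero _)) (X_ne_zero _)
        (congrArg Subtype.val h)) ?_
    change X none ^ 2 * X (some j) * X (some j) = (X none * X (some j)) ^ 2
    ring

end ConeParam

namespace IsNodalForm

variable {F : MvPolynomial (Fin 3) ℂ} {A : (Fin 3 → ℂ) ≃ₗ[ℂ] (Fin 3 → ℂ)} {c : ℂ}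
  (hF : IsNodalForm F A c)

include hF

lemma exists_rep_eq_smul {x : PSpace (Fin 3)} (hx : x ∈ zeroLocus F) :
    ∃ k s : ℂ, x.rep = k • A (nodalParam ![s, 1]) := by
  have hx' : eval (A (A.symm x.rep)) F = 0 := by rwa [A.apply_symm_apply]
  obtain ⟨k, s, h⟩ := exists_eq_smul_nodalParam ((hF.eval_eq_zero_iff _).mp hx')
  exact ⟨k, s, by rw [← map_smul, ← h, A.apply_symm_apply]⟩

/-- The chart `[s:1]` of `P^1` reaches every point of the curve, because the missing `[1:0]` has the
same image as `[0:1]`. The remaining parameters run over the cone of the projective space and absorb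
all scalars. -/
lemma isConeParam_segreProduct (κ : Type) :
    IsConeParam (segreProduct (zeroLocus F) (Set.univ : Set (PSpace κ))) (coneParam A κ) := by
  ext M
  constructor
  · intro hM
    by_cases h0 : M = 0
    · refine ⟨0, ?_⟩
      ext ⟨i, j⟩
      exact (eval_coneParam A 0 i j).trans (by simp [h0])
    · obtain ⟨x, hx, y, -, h⟩ := hM h0
      obtain ⟨k, s, hks⟩ := hF.exists_rep_eq_smul hx
      rw [segre, eq_comm, Projectivization.mk_eq_mk_iff'] at h
      obtain ⟨c', rfl⟩ := h
      refine ⟨fun o => o.elim s fun j => c' * k * y.rep j, ?_⟩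
      ext ⟨i, j⟩
      simp only [eval_coneParam, hks, Option.elim_none, Option.elim_some, Pi.smul_apply,
        smul_eq_mul]
      ring
  · rintro ⟨a, rfl⟩ h
    have hw : (fun j => a (some j)) ≠ 0 := by
      intro h0
      refine h ?_
      ext ⟨i, j⟩
      refine (eval_coneParam A a i j).trans ?_
      rw [congrFun h0 j, Pi.zero_apply, Pi.zero_apply, mul_zero]
    refine ⟨_, hF.nodalMap_mem (Projectivization.mk ℂ ![a none, 1] (vec_one_ne_zero _)),
      Projectivization.mk ℂ _ hw, trivial, ?_⟩
    rw [nodalMap_mk, segre_mk]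
    refine mk_eq_mk _ _ (c := 1) ?_
    ext ⟨i, j⟩
    rw [one_smul]
    exact (eval_coneParam A a i j).symm

lemma isConeParam : IsConeParam (zeroLocus F) fun i => coneParam A Unit (i, ()) := by
  ext v
  constructor
  · intro hv
    by_cases h0 : v = 0
    · refine ⟨0, ?_⟩
      ext i
      exact (eval_coneParam A 0 i ()).trans (by simp [h0])
    · have hx := hv h0
      obtain ⟨k, s, hks⟩ := hF.exists_rep_eq_smul hx
      obtain ⟨c', hc', h⟩ := exists_rep_mk h0
      refine ⟨fun o => o.elim s fun _ => c'⁻¹ * k, ?_⟩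
      ext i
      have hi := congrFun (h.symm.trans hks) i
      simp only [Pi.smul_apply, smul_eq_mul] at hi
      simp only [eval_coneParam, Option.elim_none, Option.elim_some]
      field_simp
      linear_combination -hi
  · rintro ⟨a, rfl⟩ h
    refine (mk_mem_zeroLocus hF.homogeneous h).mpr ?_
    have h2 : (fun i => eval a (coneParam A Unit (i, ()))) =
        a (some ()) • A (nodalParam ![a none, 1]) := by
      ext i
      rw [eval_coneParam, Pi.smul_apply, smul_eq_mul, mul_comm]
    beta_reduce
    rw [h2, eval_smul_of_isHomogeneous hF.homogeneous,
      (hF.eval_eq_zero_iff _).mpr (nodalParam_relation _), mul_zero]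

lemma nonempty_zeroLocus : (zeroLocus F).Nonempty := ⟨_, hF.nodalMap_mem pointOneZero⟩

lemma isProjectiveVariety : IsProjectiveVariety (zeroLocus F) where
  isClosed := isClosed_zeroLocus hF.homogeneous
  irreducible := hF.isConeParam.isIrreducible hF.nonempty_zeroLocus

lemma hasDimension : HasDimension (zeroLocus F) 1 :=
  hF.isConeParam.hasDimension rfl
    (isAlgebraic_X A fun ij => ⟨X ij.1, aeval_X _ _⟩)

lemma isProjectiveVariety_prod {n : ℕ} (hn : 1 ≤ n) :
    IsProjectiveVariety (segreProduct (zeroLocus F) (Set.univ : Set (PSpace (Fin n)))) where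
  isClosed := isClosed_segreProduct hF.homogeneous
  irreducible := (hF.isConeParam_segreProduct (Fin n)).isIrreducible <|
    hF.nonempty_zeroLocus.image2 ⟨Projectivization.mk ℂ _ (single_one_ne_zero ⟨0, hn⟩), trivial⟩

lemma hasDimension_prod {n : ℕ} (hn : 1 ≤ n) :
    HasDimension (segreProduct (zeroLocus F) (Set.univ : Set (PSpace (Fin n)))) n := by
  have : Nonempty (Fin n) := ⟨⟨0, hn⟩⟩
  exact (hF.isConeParam_segreProduct (Fin n)).hasDimension (by simp)
    (isAlgebraic_X A fun ij => ⟨X ij, aeval_X _ _⟩)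

lemma nonempty_fundamentalGroup_mulEquiv :
    Nonempty (FundamentalGroup (zeroLocus F) (hF.toCurve pointOneZero) ≃* Multiplicative ℤ) :=
  hF.isPinching.nonempty_fundamentalGroup_mulEquiv

lemma pathConnectedSpace : PathConnectedSpace (zeroLocus F) :=
  hF.isPinching.surjective.pathConnectedSpace hF.isPinching.continuous

lemma compactSpace : CompactSpace (zeroLocus F) :=
  hF.isPinching.surjective.compactSpace hF.isPinching.continuous

lemma nonempty_H_one_iso : Nonempty (H 1 (zeroLocus F) ≅ ModuleCat.of ℤ ℤ) := by
  have := hF.pathConnectedSpace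
  obtain ⟨E⟩ := hF.nonempty_fundamentalGroup_mulEquiv
  exact ProjVar.nonempty_H_one_iso E

lemma nonempty_H_one_prod_iso {n : ℕ} (hn : 1 ≤ n) :
    Nonempty (H 1 (segreProduct (zeroLocus F) (Set.univ : Set (PSpace (Fin n)))) ≅
      ModuleCat.of ℤ ℤ) := by
  have := hF.pathConnectedSpace
  have := hF.compactSpace
  have : Nonempty (Fin n) := ⟨⟨0, hn⟩⟩
  let h := segreHomeomorph (κ := Fin n) (zeroLocus F)
  have : PathConnectedSpace (segreProduct (zeroLocus F) (Set.univ : Set (PSpace (Fin n)))) :=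
    h.surjective.pathConnectedSpace h.continuous
  obtain ⟨E⟩ := hF.nonempty_fundamentalGroup_mulEquiv
  obtain ⟨E'⟩ := nonempty_fundamentalGroup_prod_mulEquiv h (hF.toCurve pointOneZero)
    (Projectivization.mk ℂ _ (single_one_ne_zero ⟨0, hn⟩))
  exact ProjVar.nonempty_H_one_iso (E'.trans E)

end IsNodalForm

end
end ProjVar

/-! ### Normal form of an irreducible nodal cubic. -/

namespace ProjVar
noncomputable section

open CategoryTheory MvPolynomial

/-- The Hessian matrix of a ternary form at a point. -/
def hessian (F : MvPolynomial (Fin 3) ℂ) (v : Fin 3 → ℂ) : Matrix (Fin 3) (Fin 3) ℂ :=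
  Matrix.of fun i j => eval v (pderiv i (pderiv j F))

/-- Both sides are polynomial identities that can be checked on each of the ten cubic monomials;
linearity then gives `eval_smul_add`. -/
lemma eval_smul_add_monomial (m : Fin 3 →₀ ℕ) (hm : m 0 + m 1 + m 2 = 3) (c a : ℂ)
    (v w : Fin 3 → ℂ) :
    eval (a • v + w) (monomial m c) = a ^ 3 * eval v (monomial m c) +
      a ^ 2 * ∑ i, w i * eval v (pderiv i (monomial m c)) +
      a * (w ⬝ᵥ (hessian (monomial m c) v).mulVec w / 2) + eval w (monomial m c) := by
  rw [monomial_eq, Finsupp.prod_fintype _ _ (by simp), Fin.prod_univ_three]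
  have h2 : ∀ i, pderiv i (2 : MvPolynomial (Fin 3) ℂ) = 0 := fun i =>
    (pderiv i).map_natCast 2
  have h3 : ∀ i, pderiv i (3 : MvPolynomial (Fin 3) ℂ) = 0 := fun i =>
    (pderiv i).map_natCast 3
  generalize m 0 = i at *
  generalize m 1 = j at *
  generalize m 2 = k at *
  obtain ⟨hi, hj⟩ : i ≤ 3 ∧ j ≤ 3 := by omega
  obtain rfl : k = 3 - i - j := by omega
  interval_cases i <;> interval_cases j <;> first | omega | skip
  all_goals
    simp [Fin.sum_univ_three, dotProduct, Matrix.mulVec, hessian, pderiv_X, Pi.single_apply, h2, h3]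
    ring

/-- The Taylor expansion of a ternary cubic form. -/
lemma eval_smul_add {F : MvPolynomial (Fin 3) ℂ} (hF : F.IsHomogeneous 3) (a : ℂ)
    (v w : Fin 3 → ℂ) :
    eval (a • v + w) F = a ^ 3 * eval v F + a ^ 2 * ∑ i, w i * eval v (pderiv i F) +
      a * (w ⬝ᵥ (hessian F v).mulVec w / 2) + eval w F := by
  have hmon : ∀ m ∈ F.support, m 0 + m 1 + m 2 = 3 := fun m hm => by
    have := hF (mem_support_iff.mp hm)
    rw [Finsupp.weight_apply, Finsupp.sum_fintype _ (fun i c => c • (1 : Fin 3 → ℕ) i) fun _ => zero_smul _ _,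
      Fin.sum_univ_three] at this
    simpa using this
  have hsum : ∀ s ⊆ F.support, eval (a • v + w) (∑ m ∈ s, monomial m (coeff m F)) =
      a ^ 3 * eval v (∑ m ∈ s, monomial m (coeff m F)) +
      a ^ 2 * ∑ i, w i * eval v (pderiv i (∑ m ∈ s, monomial m (coeff m F))) +
      a * (w ⬝ᵥ (hessian (∑ m ∈ s, monomial m (coeff m F)) v).mulVec w / 2) +
      eval w (∑ m ∈ s, monomial m (coeff m F)) := by
    intro s
    induction s using Finset.induction_on with
    | empty => simp [hessian, dotProduct, Matrix.mulVec]
    | insert m s hm ih =>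
      intro hs
      have ih := ih ((Finset.subset_insert _ _).trans hs)
      have h := eval_smul_add_monomial m (hmon m (hs (Finset.mem_insert_self _ _))) (coeff m F) a v w
      have hhess : ∀ P Q, hessian (P + Q) v = hessian P v + hessian Q v := fun P Q => by
        ext i j
        simp [hessian]
      rw [Finset.sum_insert hm]
      simp only [hhess, map_add, mul_add, Finset.sum_add_distrib, Matrix.add_mulVec,
        dotProduct_add]
      rw [ih, h]
      ring
  have := hsum F.support subset_rfl
  rwa [← F.as_sum] at this

lemma isSymm_hessian (F : MvPolynomial (Fin 3) ℂ) (v : Fin 3 → ℂ) : (hessian F v).IsSymm := by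
  -- The commutator of two partial derivatives is a derivation that kills the variables, hence zero.
  have hcomm : ∀ i j, ⁅(pderiv i : Derivation ℂ (MvPolynomial (Fin 3) ℂ) (MvPolynomial (Fin 3) ℂ)),
      (pderiv j : Derivation ℂ (MvPolynomial (Fin 3) ℂ) (MvPolynomial (Fin 3) ℂ))⁆ = 0 := by
    intro i j
    refine derivation_ext fun k => ?_
    simp [Derivation.commutator_apply, pderiv_X, Pi.single_apply, apply_ite]
  ext i j
  have h := Derivation.congr_fun (hcomm i j) F
  rw [Derivation.commutator_apply, Derivation.zero_apply, sub_eq_zero] at h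
  simp [hessian, h]

/-- A symmetric form of rank two on a three-dimensional space contains a hyperbolic plane. -/
lemma exists_hyperbolic_pair {M : Matrix (Fin 3) (Fin 3) ℂ} (hM : M.IsSymm) (hrank : M.rank = 2)
    {v : Fin 3 → ℂ} (hv : v ≠ 0) (hMv : M.mulVec v = 0) :
    ∃ u₁ u₂, Matrix.toBilin' M u₁ u₁ = 0 ∧ Matrix.toBilin' M u₂ u₂ = 0 ∧
      Matrix.toBilin' M u₁ u₂ = 1 := by
  set B := Matrix.toBilin' M with hB
  have hsymm : ∀ x y, B x y = B y x := fun x y => by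
    rw [hB, Matrix.toBilin'_apply', Matrix.toBilin'_apply', Matrix.dotProduct_mulVec,
      dotProduct_comm, ← Matrix.mulVec_transpose, hM.eq]
  have hker : ∀ w, M.mulVec w = 0 → ∃ c : ℂ, c • v = w := by
    have h1 : Module.finrank ℂ (LinearMap.ker M.mulVecLin) = 1 := by
      have := LinearMap.finrank_range_add_finrank_ker M.mulVecLin
      rw [← Matrix.rank, hrank, Module.finrank_fin_fun] at this
      omega
    intro w hw
    obtain ⟨c, hc⟩ := (finrank_eq_one_iff_of_nonzero' (⟨v, hMv⟩ : LinearMap.ker M.mulVecLin)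
      (fun h => hv (congrArg Subtype.val h))).mp h1 ⟨w, hw⟩
    exact ⟨c, congrArg Subtype.val hc⟩
  -- If every vector were isotropic, polarization would give `B = 0`, against rank two.
  obtain ⟨w₂, hw₂⟩ : ∃ w, B w w ≠ 0 := by
    by_contra! h
    have h0 : B = 0 := by
      refine LinearMap.ext fun x => LinearMap.ext fun y => ?_
      have := h (x + y)
      simp only [map_add, LinearMap.add_apply, h, hsymm y x] at this
      simpa [← two_mul] using this
    have : M = 0 := by simpa [hB] using h0
    rw [this, Matrix.rank_zero] at hrank
    omega
  obtain ⟨w₁, hw₁⟩ : ∃ w, w ∉ Submodule.span ℂ {w₂, v} := by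
    by_contra! h
    have h1 : Submodule.span ℂ {w₂, v} = ⊤ := eq_top_iff.mpr fun w _ => h w
    have h2 := finrank_span_finset_le_card (R := ℂ) {w₂, v}
    rw [Set.finrank, Finset.coe_pair, h1, finrank_top, Module.finrank_fin_fun] at h2
    have := Finset.card_le_two (a := w₂) (b := v)
    omega
  -- An isotropic vector is found on the line `w₁ + t w₂` by solving a quadratic equation. It avoids
  -- the radical `ℂ v` since `w₁` lies outside the span of `w₂` and `v`.
  obtain ⟨s, hs⟩ := IsAlgClosed.exists_eq_mul_self (discrim (B w₂ w₂) (2 * B w₁ w₂) (B w₁ w₁))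
  obtain ⟨t, ht⟩ := exists_quadratic_eq_zero hw₂ ⟨s, hs⟩
  have hu₁ : B (w₁ + t • w₂) (w₁ + t • w₂) = 0 := by
    simp only [map_add, map_smul, LinearMap.add_apply, LinearMap.smul_apply, smul_eq_mul,
      hsymm w₂ w₁]
    linear_combination ht
  set u₁ := w₁ + t • w₂
  have hMu : M.mulVec u₁ ≠ 0 := by
    intro h0
    obtain ⟨c, hc⟩ := hker _ h0
    refine hw₁ (Submodule.mem_span_pair.mpr ⟨-t, c, ?_⟩)
    rw [hc]
    simp [u₁]
  obtain ⟨i, hi⟩ := Function.ne_iff.mp hMu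
  let u := (M.mulVec u₁ i)⁻¹ • (Pi.single i 1 : Fin 3 → ℂ)
  have hu : B u₁ u = 1 := by
    rw [hsymm, hB, Matrix.toBilin'_apply', smul_dotProduct, single_one_dotProduct, smul_eq_mul,
      inv_mul_cancel₀ hi]
  -- Subtracting this multiple of `u₁` makes the second vector isotropic and keeps the pairing equal
  -- to `1`.
  refine ⟨u₁, u - (B u u / 2) • u₁, hu₁, ?_, ?_⟩
  · simp only [map_sub, map_smul, LinearMap.sub_apply, LinearMap.smul_apply, smul_eq_mul, hu₁,
      hsymm u u₁, hu]
    ring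
  · simp [hu₁, hu]

/-- A binary cubic form in the coordinates of two vectors. -/
lemma exists_eval_smul_add_smul {F : MvPolynomial (Fin 3) ℂ} (hF : F.IsHomogeneous 3)
    (u₁ u₂ : Fin 3 → ℂ) : ∃ β γ : ℂ, ∀ x y : ℂ, eval (x • u₁ + y • u₂) F =
      x ^ 3 * eval u₁ F + β * (x ^ 2 * y) + γ * (x * y ^ 2) + y ^ 3 * eval u₂ F := by
  refine ⟨∑ i, u₂ i * eval u₁ (pderiv i F), u₂ ⬝ᵥ (hessian F u₁).mulVec u₂ / 2, fun x y => ?_⟩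
  rw [eval_smul_add hF, eval_smul_of_isHomogeneous hF]
  simp only [Pi.smul_apply, smul_eq_mul, Matrix.mulVec_smul, dotProduct_smul, smul_dotProduct,
    mul_assoc, ← Finset.mul_sum]
  ring

/-- In the new coordinates both factors vanish at the origin, so neither is a unit. -/
lemma not_irreducible_of_eval {F : MvPolynomial (Fin 3) ℂ} {A : (Fin 3 → ℂ) ≃ₗ[ℂ] (Fin 3 → ℂ)}
    (k : Fin 3) (Q : MvPolynomial (Fin 3) ℂ) (hQ : eval 0 Q = 0)
    (h : ∀ y, eval (A y) F = y k * eval y Q) : ¬ Irreducible F := by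
  intro hirr
  let L : Fin 3 → MvPolynomial (Fin 3) ℂ := linComb A.symm.toLinearMap X
  have hL : ∀ v, (fun i => eval v (L i)) = A.symm v := fun v => by
    rw [eval_linComb]
    simp
  have hFL : F = L k * aeval L Q := by
    refine MvPolynomial.funext fun v => ?_
    rw [map_mul, eval_aeval, hL, congrFun (hL v) k, ← h, A.apply_symm_apply]
  rcases hirr.isUnit_or_isUnit hFL with hu | hu
  · have := hu.map (eval 0)
    rw [congrFun (hL 0) k] at this
    simp at this
  · have := hu.map (eval 0)
    rw [eval_aeval, hL, map_zero, hQ] at this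
    simp at this

/-- Every irreducible nodal cubic is projectively equivalent to `x y z = x ^ 3 + y ^ 3`. -/
theorem exists_isNodalForm {F : MvPolynomial (Fin 3) ℂ} {p : PSpace (Fin 3)}
    (hF : F.IsHomogeneous 3) (hirr : Irreducible F) (hp : IsNode F p) :
    ∃ A, IsNodalForm F A 1 ∧ nodalMap A pointOneZero = p := by
  obtain ⟨h0, h1, hrank⟩ := hp
  set v := p.rep with hv
  have hT : ∀ a w, eval (a • v + w) F =
      a * (Matrix.toBilin' (hessian F v) w w / 2) + eval w F := fun a w => by
    rw [eval_smul_add hF, show eval v F = 0 from h0, Matrix.toBilin'_apply']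
    simp [h1]
  have hsymm : ∀ x y, Matrix.toBilin' (hessian F v) x y = Matrix.toBilin' (hessian F v) y x :=
    fun x y => by
      rw [Matrix.toBilin'_apply', Matrix.toBilin'_apply', Matrix.dotProduct_mulVec,
        dotProduct_comm, ← Matrix.mulVec_transpose, (isSymm_hessian F v).eq]
  -- Expanding `F(2v + w)` directly, and as `F(v + (v + w))`, shows that the quadratic form is
  -- invariant under translation by `v`; polarization puts `v` in the radical.
  have hBv : ∀ w, Matrix.toBilin' (hessian F v) v w = 0 := by
    have h2 : ∀ w, Matrix.toBilin' (hessian F v) (v + w) (v + w) =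
        Matrix.toBilin' (hessian F v) w w := fun w => by
      have e1 := hT 2 w
      have e2 := hT 1 (v + w)
      have e3 := hT 1 w
      rw [one_smul] at e2 e3
      rw [two_smul, add_assoc, e2, e3] at e1
      linear_combination 2 * e1
    intro w
    have e1 := h2 w
    have e2 := h2 0
    simp only [map_add, LinearMap.add_apply, hsymm w v, map_zero, add_zero] at e1 e2
    linear_combination (e1 - e2) / 2
  have hMv : (hessian F v).mulVec v = 0 := by
    ext i
    have := hBv (Pi.single i 1)
    rwa [hsymm, Matrix.toBilin'_apply', single_one_dotProduct] at this
  obtain ⟨u₁, u₂, h11, h22, h12⟩ :=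
    exists_hyperbolic_pair (isSymm_hessian F v) hrank p.rep_nonzero hMv
  obtain ⟨β, γ, hβγ⟩ := exists_eval_smul_add_smul hF u₁ u₂
  have hxyz : ∀ x y z : ℂ, eval (z • v + (x • u₁ + y • u₂)) F =
      z * (x * y) + (x ^ 3 * eval u₁ F + β * (x ^ 2 * y) + γ * (x * y ^ 2) +
        y ^ 3 * eval u₂ F) := fun x y z => by
    rw [hT, hβγ]
    simp only [map_add, map_smul, LinearMap.add_apply, LinearMap.smul_apply, smul_eq_mul, h11,
      h22, h12, hsymm u₂ u₁]
    ring
  -- Shifting `u₁` and `u₂` by multiples of `v` removes the `x²y` and `xy²` terms. Independence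
  -- follows by pairing a relation with `u₁` and `u₂`.
  have hind : LinearIndependent ℂ ![u₁ - β • v, u₂ - γ • v, v] := by
    rw [Fintype.linearIndependent_iff]
    intro g hg
    rw [Fin.sum_univ_three] at hg
    have e1 := congrArg (Matrix.toBilin' (hessian F v) · u₁) hg
    have e2 := congrArg (Matrix.toBilin' (hessian F v) · u₂) hg
    simp [h11, h22, h12, hsymm u₂ u₁, hBv] at e1 e2
    have e3 : g 2 • v = 0 := by simpa [e1, e2] using hg
    have e3 := (smul_eq_zero.mp e3).resolve_right p.rep_nonzero
    intro i
    fin_cases i <;> assumption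
  let b := basisOfLinearIndependentOfCardEqFinrank hind (by simp)
  have hb : ∀ y : Fin 3 → ℂ, eval (b.equivFun.symm y) F =
      y 0 * y 1 * y 2 + eval u₁ F * y 0 ^ 3 + eval u₂ F * y 1 ^ 3 := fun y => by
    have : b.equivFun.symm y =
        (y 2 - β * y 0 - γ * y 1) • v + (y 0 • u₁ + y 1 • u₂) := by
      rw [Module.Basis.equivFun_symm_apply, Fin.sum_univ_three]
      simp only [b, coe_basisOfLinearIndependentOfCardEqFinrank, Matrix.cons_val]
      module
    rw [this, hxyz]
    ring
  -- If either cube were missing, a coordinate would divide `F`.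
  have hα : eval u₁ F ≠ 0 := by
    intro h
    refine not_irreducible_of_eval (A := b.equivFun.symm) 1
      (X 0 * X 2 + C (eval u₂ F) * X 1 ^ 2) (by simp) (fun y => ?_) hirr
    rw [hb, h]
    simp
    ring
  have hδ : eval u₂ F ≠ 0 := by
    intro h
    refine not_irreducible_of_eval (A := b.equivFun.symm) 0
      (X 1 * X 2 + C (eval u₁ F) * X 0 ^ 2) (by simp) (fun y => ?_) hirr
    rw [hb, h]
    simp
    ring
  -- Scaling by `l` and `m` makes the cube coefficients `-1`; the factor `(l * m)⁻¹` on the third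
  -- coordinate keeps the coefficient of `xyz` equal to `1`.
  obtain ⟨l, hl⟩ := IsAlgClosed.exists_pow_nat_eq (-(eval u₁ F)⁻¹) (n := 3) (by norm_num)
  obtain ⟨m, hm⟩ := IsAlgClosed.exists_pow_nat_eq (-(eval u₂ F)⁻¹) (n := 3) (by norm_num)
  have hl0 : l ≠ 0 := by
    rintro rfl
    exact hα (by simpa [eq_comm] using hl)
  have hm0 : m ≠ 0 := by
    rintro rfl
    exact hδ (by simpa [eq_comm] using hm)
  let w : Fin 3 → ℂ := ![l, m, (l * m)⁻¹]
  have hw : ∀ i, IsUnit (w i) := fun i => by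
    fin_cases i <;> simp [w, hl0, hm0]
  let b' := b.isUnitSMul hw
  have hb' : ∀ y, b'.equivFun.symm y = b.equivFun.symm fun i => y i * w i := fun y => by
    simp only [Module.Basis.equivFun_symm_apply, b', Module.Basis.isUnitSMul_apply, smul_smul]
  refine ⟨b'.equivFun.symm, ⟨hF, one_ne_zero, fun y => ?_⟩, ?_⟩
  · rw [hb', hb]
    simp only [w, Matrix.cons_val]
    rw [mul_pow, mul_pow, hl, hm]
    field_simp
    ring
  · rw [pointOneZero, nodalMap_mk]
    conv_rhs => rw [← p.mk_rep]
    refine mk_eq_mk _ _ (c := (l * m)⁻¹) ?_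
    rw [hb', Module.Basis.equivFun_symm_apply, Fin.sum_univ_three]
    simp [nodalParam, w, b, hv]

end
end ProjVar

/-! ### The explicit cubic and its normalization. -/

namespace ProjVar
noncomputable section

open CategoryTheory MvPolynomial

/-- The coordinates in which the standard nodal cubic is `x y z = x ^ 3 + y ^ 3`. -/
def standardCoord : (Fin 3 → ℂ) ≃ₗ[ℂ] (Fin 3 → ℂ) where
  -- The matrix is read off from the explicit normalization, using `(s+t)³ = s³ + t³ + 3st(s+t)`.
  toFun y := ![-4 * (y 0 + y 1), -4 * (y 0 - y 1), y 2 + 3 * (y 0 + y 1)]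
  map_add' x y := by
    ext i
    fin_cases i <;> simp <;> ring
  map_smul' a x := by
    ext i
    fin_cases i <;> simp <;> ring
  invFun x := ![-(x 0 + x 1) / 8, -(x 0 - x 1) / 8, x 2 + 3 * x 0 / 4]
  left_inv y := by
    ext i
    fin_cases i <;> simp <;> ring
  right_inv y := by
    ext i
    fin_cases i <;> simp <;> ring

lemma standardCoord_apply (y : Fin 3 → ℂ) :
    standardCoord y = ![-4 * (y 0 + y 1), -4 * (y 0 - y 1), y 2 + 3 * (y 0 + y 1)] := rfl

lemma isHomogeneous_standardCubic : standardCubic.IsHomogeneous 3 := by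
  have h := fun i : Fin 3 => isHomogeneous_X ℂ i
  exact (((h 2).mul ((h 1).pow 2)).sub ((h 0).pow 3)).sub (((h 0).pow 2).mul (h 2))

lemma isNodalForm_standardCubic : IsNodalForm standardCubic standardCoord (-64) where
  homogeneous := isHomogeneous_standardCubic
  ne_zero := by norm_num
  eval_eq y := by
    simp [standardCubic, standardCoord_apply]
    ring

/-- The form is linear in `z` with coprime coefficients `y² - x²` and `-x³`. -/
lemma irreducible_standardCubic : Irreducible standardCubic := by
  have hX : ∀ (i : Fin 3) (k : ℕ), 2 ≠ i → 2 ∉ (X i ^ k : MvPolynomial (Fin 3) ℂ).vars := by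
    intro i k hi h
    have := vars_pow _ _ h
    rw [vars_X, Finset.mem_singleton] at this
    exact hi this
  have h : Irreducible ((X 1 ^ 2 - X 0 ^ 2) * X 2 + -X 0 ^ 3 : MvPolynomial (Fin 3) ℂ) := by
    have hne : (X 1 ^ 2 - X 0 ^ 2 : MvPolynomial (Fin 3) ℂ) ≠ 0 := fun h0 => by
      simpa using congrArg (eval ![0, 1, 0]) h0
    refine irreducible_mul_X_add _ _ 2 hne (fun h => ?_) (fun h => ?_) ?_
    · rcases Finset.mem_union.mp (vars_sub_subset _ h) with h | h
      · exact hX 1 2 (by decide) h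
      · exact hX 0 2 (by decide) h
    · rw [vars_neg] at h
      exact hX 0 3 (by decide) h
    · refine IsRelPrime.neg_right (IsRelPrime.pow_right ?_)
      intro d h1 h2
      rcases (X_prime (R := ℂ) (i := (0 : Fin 3))).irreducible.dvd_iff.mp h2 with hu | ha
      · exact hu
      · have := map_dvd (eval (![0, 1, 0] : Fin 3 → ℂ)) (ha.dvd.trans h1)
        simp at this
  have heq : standardCubic = (X 1 ^ 2 - X 0 ^ 2) * X 2 + -X 0 ^ 3 := by
    rw [standardCubic]
    ring
  rwa [heq]

lemma isNode_standardCubic : IsNode standardCubic standardNode := by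
  obtain ⟨c, hc, h⟩ := exists_rep_mk (show (![0, 0, 1] : Fin 3 → ℂ) ≠ 0 by simp)
  have hrep : standardNode.rep = ![0, 0, c] := by
    refine h.trans ?_
    ext i
    fin_cases i <;> simp
  have h2 : ∀ i, pderiv i (2 : MvPolynomial (Fin 3) ℂ) = 0 := fun i =>
    (pderiv i).map_natCast 2
  have h3 : ∀ i, pderiv i (3 : MvPolynomial (Fin 3) ℂ) = 0 := fun i =>
    (pderiv i).map_natCast 3
  refine ⟨?_, fun i => ?_, ?_⟩
  · rw [standardNode, mk_mem_zeroLocus isHomogeneous_standardCubic]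
    simp [standardCubic]
  · rw [hrep]
    fin_cases i <;> simp [standardCubic, pderiv_X]
  · have hdiag : (Matrix.of fun i j => eval standardNode.rep (pderiv i (pderiv j standardCubic))) =
        Matrix.diagonal ![-2 * c, 2 * c, 0] := by
      ext i j
      rw [hrep]
      fin_cases i <;> fin_cases j <;>
        simp [standardCubic, pderiv_X, Pi.single_apply, h2, h3, mul_comm]
    rw [hdiag, Matrix.rank_diagonal, Fintype.card_subtype]
    have : (Finset.univ.filter fun i => (![-2 * c, 2 * c, 0] : Fin 3 → ℂ) i ≠ 0) = {0, 1} := by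
      ext i
      fin_cases i <;> simp [hc]
    rw [this]
    rfl

lemma nodalMap_standardCoord_pointOneZero :
    nodalMap standardCoord pointOneZero = standardNode := by
  rw [pointOneZero, nodalMap_mk]
  refine mk_eq_mk _ _ (c := 1) ?_
  ext i
  fin_cases i <;> simp [standardCoord_apply, nodalParam]

lemma standardCoord_nodalParam (s t : ℂ) : standardCoord (nodalParam ![s, t]) =
    ![-4 * s * t * (s + t), -4 * s * t * (s - t), (s + t) ^ 3] := by
  ext i
  fin_cases i <;> simp [standardCoord_apply, nodalParam] <;> ring

lemma not_isZero_of_betti_eq_one {X : Type} [TopologicalSpace X] {k : ℕ} (h : betti k X = 1) :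
    ¬ Limits.IsZero (H k X) := by
  intro h0
  have := ModuleCat.subsingleton_of_isZero h0
  rw [betti, rank_subsingleton'] at h
  exact zero_ne_one h

end
end ProjVar

/-! ### Assembly of the theorem. -/

theorem mainTheorem11 :
    -- Every irreducible plane cubic `C` with a node `p`.
    (∀ (F : MvPolynomial (Fin 3) ℂ) (p : PSpace (Fin 3)),
      F.IsHomogeneous 3 → Irreducible F → ∀ hp : IsNode F p,
      IsProjectiveVariety (zeroLocus F) ∧ HasDimension (zeroLocus F) 1 ∧
      (∃ (σ : PSpace (Fin 2) → PSpace (Fin 3)) (a : CStarAction (zeroLocus F)),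
        IsNormalization (zeroLocus F) σ ∧
        (∀ x, σ x = p ↔ x = pointOneZero ∨ x = pointZeroOne) ∧
        (∀ (t : ℂˣ) (x : PSpace (Fin 2)) (hx : σ x ∈ zeroLocus F),
          (a.act t ⟨σ x, hx⟩ : PSpace (Fin 3)) = σ (scale t x)) ∧
        a.fixedPoints = {⟨p, hp.1⟩} ∧
        -- The product with `P^{n-1}`, for every `n ≥ 1`.
        ∀ n : ℕ, 1 ≤ n →
          ∃ (b : CStarAction (Set.univ : Set (PSpace (Fin n))))
            (c : CStarAction (segreProduct (zeroLocus F) (Set.univ : Set (PSpace (Fin n))))),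
            b.HasIsolatedFixedPoints ∧ c.IsProductOf a b ∧ c.HasIsolatedFixedPoints) ∧
      Nonempty (FundamentalGroup (zeroLocus F) ⟨p, hp.1⟩ ≃* Multiplicative ℤ) ∧
      Nonempty (H 1 (zeroLocus F) ≅ ModuleCat.of ℤ ℤ) ∧
      betti 1 (zeroLocus F) = 1 ∧
      ∀ n : ℕ, 1 ≤ n →
        IsProjectiveVariety (segreProduct (zeroLocus F) (Set.univ : Set (PSpace (Fin n)))) ∧
        HasDimension (segreProduct (zeroLocus F) (Set.univ : Set (PSpace (Fin n)))) n ∧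
        betti 1 (segreProduct (zeroLocus F) (Set.univ : Set (PSpace (Fin n)))) =
          betti 1 (zeroLocus F)) ∧
    -- The standard action on `P^1` has exactly two fixed points.
    (∀ x : PSpace (Fin 2), (∀ t, scale t x = x) ↔ x = pointOneZero ∨ x = pointZeroOne) ∧
    -- The explicit cubic `z y^2 = x^3 + x^2 z` and its explicit normalization.
    standardCubic.IsHomogeneous 3 ∧ Irreducible standardCubic ∧
    IsNode standardCubic standardNode ∧
    (∃ (σ : PSpace (Fin 2) → PSpace (Fin 3)) (a : CStarAction (zeroLocus standardCubic)),
      (∀ (s t : ℂ) (h : ![s, t] ≠ 0),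
        ∃ h' : ![-4 * s * t * (s + t), -4 * s * t * (s - t), (s + t) ^ 3] ≠ 0,
          σ (Projectivization.mk ℂ ![s, t] h) =
            Projectivization.mk ℂ
              ![-4 * s * t * (s + t), -4 * s * t * (s - t), (s + t) ^ 3] h') ∧
      IsNormalization (zeroLocus standardCubic) σ ∧
      (∀ x, σ x = standardNode ↔ x = pointOneZero ∨ x = pointZeroOne) ∧
      (∀ (t : ℂˣ) (x : PSpace (Fin 2)) (hx : σ x ∈ zeroLocus standardCubic),
        (a.act t ⟨σ x, hx⟩ : PSpace (Fin 3)) = σ (scale t x)) ∧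
      ∀ x, x ∈ a.fixedPoints ↔ x.1 = standardNode) ∧
    -- The answer to Carrell's question is negative in every dimension `n ≥ 1`.
    (∀ n : ℕ, 1 ≤ n →
      ¬ ∀ (ι : Type) [Fintype ι] (X : Set (PSpace ι)), IsProjectiveVariety X →
        HasDimension X n → (∃ a : CStarAction X, a.HasIsolatedFixedPoints) →
        ∀ k : ℕ, Odd k → CategoryTheory.Limits.IsZero (H k X)) := by
  refine ⟨fun F p hF hirr hp => ?_, scale_eq_self_iff, isHomogeneous_standardCubic,
    irreducible_standardCubic, isNode_standardCubic, ?_, fun n hn hall => ?_⟩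
  · obtain ⟨A, hA, rfl⟩ := exists_isNodalForm hF hirr hp
    have hfix : hA.action.fixedPoints.Finite := by
      rw [hA.fixedPoints_action]
      exact Set.finite_singleton _
    have hbetti := betti_one_eq_one hA.nonempty_H_one_iso
    refine ⟨hA.isProjectiveVariety, hA.hasDimension, ⟨nodalMap A, hA.action, hA.isNormalization,
      nodalMap_eq_node_iff A, hA.action_nodalMap, hA.fixedPoints_action, fun n _ =>
        ⟨rotation n, prodAction hA.action n,
          hasIsolatedFixedPoints_of_finite _ finite_fixedPoints_rotation,
          prodAction_isProductOf _ _,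
          hasIsolatedFixedPoints_of_finite _ (finite_fixedPoints_prodAction _ _ hfix)⟩⟩,
      hA.nonempty_fundamentalGroup_mulEquiv, hA.nonempty_H_one_iso, hbetti, fun n hn =>
        ⟨hA.isProjectiveVariety_prod hn, hA.hasDimension_prod hn, ?_⟩⟩
    rw [hbetti]
    exact betti_one_eq_one (hA.nonempty_H_one_prod_iso hn)
  · have hA := isNodalForm_standardCubic
    refine ⟨nodalMap standardCoord, hA.action, fun s t h => ⟨?_, ?_⟩, hA.isNormalization, fun x => ?_,
      hA.action_nodalMap, fun x => ?_⟩
    · rw [← standardCoord_nodalParam]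
      exact standardCoord.map_ne_zero_iff.mpr (nodalParam_ne_zero h)
    · rw [nodalMap_mk]
      exact mk_eq_mk _ _ (c := 1) (by rw [standardCoord_nodalParam, one_smul])
    · rw [← nodalMap_standardCoord_pointOneZero]
      exact nodalMap_eq_node_iff _ x
    · rw [hA.fixedPoints_action, Set.mem_singleton_iff, Subtype.ext_iff,
        ← nodalMap_standardCoord_pointOneZero]
      rfl
  · have hA := isNodalForm_standardCubic
    have hfix : hA.action.fixedPoints.Finite := by
      rw [hA.fixedPoints_action]
      exact Set.finite_singleton _
    -- The counterexample is the explicit cubic times `P^{n-1}`, in odd degree `k = 1`.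
    exact not_isZero_of_betti_eq_one (betti_one_eq_one (hA.nonempty_H_one_prod_iso hn))
      (hall (Fin 3 × Fin n) _ (hA.isProjectiveVariety_prod hn) (hA.hasDimension_prod hn)
        ⟨prodAction hA.action n,
          hasIsolatedFixedPoints_of_finite _ (finite_fixedPoints_prodAction _ _ hfix)⟩ 1 odd_one)
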